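/- Theorem 1.1. For a symmetric real $n\times n$ matrix $A$ with eigenvalues $\lambda_1(A),\dots,\lambda_n(A)$ (with multiplicity), let $\hat\mu(A)=\frac1n\sum_{j=1}^n\delta_{\lambda_j(A)}$. For a real sequence $(X_k)_{k\ge 0}$ let $T_n=[X_{|i-j|}]_{1\le i,j\le n}$. A *partition word* of length $2k$ is a word $w=w[1]\cdots w[2k]$ in $k$ letters in which every letter occurs exactly twice and the first occurrences of the letters are in alphabetic order; partition words of length $2k$ correspond to the pair partitions of $\{1,\dots,2k\}$. To $w$ attach the linear system in $x_0,\dots,x_{2k}$ $$(x_i-x_{i-1})+(x_j-x_{j-1})=0\qquad\text{for all } i<j \text{ with } w[i]=w[j].$$ It determines all variables from the $k+1$ undetermined ones, namely $x_0$ and the $k$ variables $x_i$ that follow the first occurrence $w[i]$ of a letter. Let $S(w)\subset[0,1]^{k+1}$ be the set of values of the undetermined variables for which all the variables $x_0,\dots,x_{2k}$ lie in $[0,1]$, and let $p_T(w)$ be the $(k+1)$-dimensional volume of $S(w)$. Let $A_{n,m}$ be the Eulerian number, that is, the number of permutations $\sigma$ of $\{1,\dots,n\}$ with $\sigma_i>\sigma_{i-1}$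 for exactly $m$ indices $i\in\{1,\dots,n\}$, where $\sigma_0=0$. (1) There is a (nonrandom) probability measure $\gamma_T$ on $\mathbb R$ such that, for every sequence $(X_k)_{k\ge0}$ of i.i.d. real-valued random variables with $\operatorname{Var}(X_1)=1$, with probability $1$ the measures $\hat\mu(T_n/\sqrt n)$ converge weakly to $\gamma_T$ as $n\to\infty$; in particular $\gamma_T$ does not depend on the distribution of $X_1$. The measure $\gamma_T$ is symmetric, has unbounded support, and for every $k\ge 0$ its moment of order $2k$ is finite and equals $$\int t^{2k}\,\gamma_T(dt)=\sum_{w:\,|w|=2k}p_T(w),$$ the sum being over all partition words $w$ of length $2k$. (2) For every partition word $w$ of length $2k$, the set $S(w)$ is the intersection of the cube $[0,1]^{k+1}$ with $k$ solids of the form $$\Big\{u\in[0,1]^{k+1}:\ \sum_{i\in A}u_i-\sum_{i\in B}u_i\in[0,1]\Big\},$$ with $A,B$ disjoint sets of coordinates (depending on the solid) and $|A|=|B|+1$; such a solid has volume $A_{n,m}/n!$ with $n=|A|+|B|$ (an odd number) and $m=|A|=(n+1)/2$. -/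

import Mathlib

open MeasureTheory ProbabilityTheory Filter Topology

open scoped ENNReal Nat

namespace ToeplitzSpectrum

/-- The symmetric Toeplitz matrix `[x_{|i-j|}]` of size `n`. -/
def toeplitz (n : ℕ) (x : ℕ → ℝ) : Matrix (Fin n) (Fin n) ℝ :=
  Matrix.of fun i j => x ((i : ℤ) - (j : ℤ)).natAbs

theorem toeplitz_isHermitian (n : ℕ) (x : ℕ → ℝ) : (toeplitz n x).IsHermitian := by
  ext i j
  simp only [toeplitz, Matrix.conjTranspose_apply, Matrix.of_apply, star_trivial]
  rw [← Int.natAbs_neg, neg_sub]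

/-- The rescaled matrix `T_n / √n`. -/
noncomputable def scaledToeplitz (n : ℕ) (x : ℕ → ℝ) : Matrix (Fin n) (Fin n) ℝ :=
  (√(n : ℝ))⁻¹ • toeplitz n x

theorem scaledToeplitz_isHermitian (n : ℕ) (x : ℕ → ℝ) : (scaledToeplitz n x).IsHermitian := by
  unfold scaledToeplitz Matrix.IsHermitian
  rw [Matrix.conjTranspose_smul, (toeplitz_isHermitian n x).eq, star_trivial]

/-- The empirical spectral measure `n⁻¹ ∑ j, δ_{λ_j(A)}` of a symmetric `n × n` matrix, `n ≥ 1`;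
eigenvalues are counted with multiplicity. -/
noncomputable def spectralMeasure {n : ℕ} [NeZero n] (A : Matrix (Fin n) (Fin n) ℝ)
    (hA : A.IsHermitian) : ProbabilityMeasure ℝ :=
  ⟨(n : ℝ≥0∞)⁻¹ • ∑ j, Measure.dirac (hA.eigenvalues j), ⟨by
    simp [ENNReal.inv_mul_cancel (Nat.cast_ne_zero.2 (NeZero.ne n)) (ENNReal.natCast_ne_top n)]⟩⟩

/-- Partition words of length `2k` in the alphabet `Fin k`: every letter occurs exactly twice, and
the first occurrences of the letters are in alphabetic order. They index the pair partitions of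
the `2k` positions. -/
def IsPartitionWord {k : ℕ} (w : Fin (2 * k) → Fin k) : Prop :=
  (∀ a, (Finset.univ.filter fun i => w i = a).card = 2) ∧
    ∀ a b, a < b → ∃ i, w i = a ∧ ∀ j, w j = b → i < j

instance {k : ℕ} : DecidablePred (IsPartitionWord (k := k)) := fun _ =>
  inferInstanceAs (Decidable (_ ∧ _))

/-- The finite set of all partition words of length `2k`. -/
def partitionWords (k : ℕ) : Finset (Fin (2 * k) → Fin k) :=
  Finset.univ.filter IsPartitionWord

/-- The linear system attached to `w` in the unknowns `x_0, …, x_{2k}`: whenever two distinct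
positions carry the same letter, the increments of `x` across these positions add up to zero.
Position `i : Fin (2 * k)` lies between the unknowns `x i.castSucc` and `x i.succ`. -/
def SolvesToeplitzSystem {k : ℕ} (w : Fin (2 * k) → Fin k) (x : Fin (2 * k + 1) → ℝ) : Prop :=
  ∀ i j, i < j → w i = w j → (x i.succ - x i.castSucc) + (x j.succ - x j.castSucc) = 0

/-- The unit cube `[0,1]^d`. -/
def unitCube (d : ℕ) : Set (Fin d → ℝ) :=
  {u | ∀ i, u i ∈ Set.Icc (0 : ℝ) 1}

/-- The section of the cube `[0,1]^{k+1}` attached to `w`. The coordinates of the cube are the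
`k + 1` undetermined variables: `u 0` is `x_0`, and `u a.succ` is the variable that follows the
first occurrence of the letter `a`. A point `u` belongs to the section when the solution `x` of
the system with these values has all its coordinates in `[0,1]`. -/
def toeplitzSection {k : ℕ} (w : Fin (2 * k) → Fin k) : Set (Fin (k + 1) → ℝ) :=
  {u | u ∈ unitCube (k + 1) ∧ ∃ x : Fin (2 * k + 1) → ℝ, SolvesToeplitzSystem w x ∧
    x 0 = u 0 ∧ (∀ i, (∀ j, w j = w i → i ≤ j) → x i.succ = u (w i).succ) ∧
    ∀ i, x i ∈ Set.Icc (0 : ℝ) 1}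

/-- The Toeplitz volume `p_T(w)`. -/
noncomputable def toeplitzVolume {k : ℕ} (w : Fin (2 * k) → Fin k) : ℝ :=
  volume.real (toeplitzSection w)

/-- The solid `{u ∈ [0,1]^d : ∑_{i ∈ A} u_i - ∑_{i ∈ B} u_i ∈ [0,1]}`. -/
def eulerianSolid {d : ℕ} (A B : Finset (Fin d)) : Set (Fin d → ℝ) :=
  {u | u ∈ unitCube d ∧ (∑ i ∈ A, u i) - ∑ i ∈ B, u i ∈ Set.Icc (0 : ℝ) 1}

/-- The Eulerian number `A_{n,m}`: the number of permutations `σ` of `n` letters with exactly `m`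
rises, the first position always counting as a rise. -/
def eulerianNumber (n m : ℕ) : ℕ :=
  (Finset.univ.filter fun σ : Equiv.Perm (Fin n) =>
    (Finset.univ.filter fun i : Fin n =>
      ∀ j : Fin n, (j : ℕ) + 1 = (i : ℕ) → σ j < σ i).card = m).card

end ToeplitzSpectrum

/-!
**Convergence for bounded noise.** Let the entries be i.i.d., bounded, centered and of unit
variance. The trace of `T_n ^ r` is a sum over closed paths in `{1, …, n}`, weighted by the entries
at the absolute values of the steps. In expectation a path contributes only if no label occurs
exactly once, and since the steps of a closed path sum to zero, counting free choices leaves in the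
limit only the paths whose labels pair up through opposite steps, that is, the integer solutions in
`{1, …, n}` of the linear system of a partition word `w`. They are the lattice points of a dilate of
the convex set `S(w)`, so their number divided by `n ^ (k + 1)` tends to `p_T(w)`. The limiting
moment of order `2k` is at most `(2k) ^ k`, which is small enough for the Taylor polynomials of the
characteristic function to converge, so the moments determine the law. The variance of a normalized
trace is `O(1 / n)`: the moments converge almost surely along the sizes `n = m ^ 2`, and comparing
`T_n` with the zero-padded matrix of size `⌊√n⌋ ^ 2` fills the gaps.

**General entries.** A continuous bounded truncation of the entries is close to them in `L²`. If `A`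
and `B` have eigenbases `u`, `v`, the squares of the overlaps `O i j = ⟪u i, v j⟫` form a doubly
stochastic matrix, and `(λ i - μ j) * O i j = ⟪u i, (A - B) v j⟫`. Hence the characteristic function
of the spectral measure is Lipschitz for the normalized Frobenius norm, which controls the
truncation. For a rank-one difference it also bounds the change at `t` by `|t|` times the trace norm
divided by `n`, so that adding a constant to all the entries does not matter: this removes the mean.

**Unbounded support.** Two paths with the same starting point and the same multiset of steps glue,
one followed by the other reversed, to a closed path in which no label is isolated. By the
Cauchy–Schwarz inequality there are many such pairs, and the moment of order `2k` is at least
`k! / 2 ^ k`.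

**Volumes.** Replacing `u i` by `1 - u i` for `i ∈ B` turns a solid into
`{∑ u i - |B| ∈ [0, 1]}`. The map from a point of the torus to its increments preserves the volume,
and the representatives in `[0, 1)` of the increments of `x` sum to the last coordinate plus the
number of descents of `x`. So the volume is that of the points with `|A|` rises.
-/

namespace ToeplitzSpectrum

section EigenvaluePerturbation

open Matrix

variable {ι : Type*} [Fintype ι]

lemma sum_sq_entries_eq_trace (M : Matrix ι ι ℝ) :
    ∑ i, ∑ j, M i j ^ 2 = (star M * M).trace := by
  rw [Finset.sum_comm]
  simp [trace, mul_apply, star_apply, sq]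

variable [DecidableEq ι] {A B O U V : Matrix ι ι ℝ}

lemma sum_sq_col_of_mem_orthogonalGroup (hO : O ∈ orthogonalGroup ι ℝ) (j : ι) :
    ∑ i, O i j ^ 2 = 1 := by
  have h := congrFun (congrFun (mem_unitaryGroup_iff'.1 hO) j) j
  simpa [mul_apply, sq] using h

lemma sum_sq_row_of_mem_orthogonalGroup (hO : O ∈ orthogonalGroup ι ℝ) (i : ι) :
    ∑ j, O i j ^ 2 = 1 := by
  simpa [star_apply] using sum_sq_col_of_mem_orthogonalGroup (Unitary.star_mem hO) i

lemma star_mulVec_dotProduct_self (hU : U ∈ orthogonalGroup ι ℝ) (v : ι → ℝ) :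
    (star U *ᵥ v) ⬝ᵥ (star U *ᵥ v) = v ⬝ᵥ v := by
  have h := mem_unitaryGroup_iff.1 hU
  rw [star_eq_conjTranspose, conjTranspose_eq_transpose_of_trivial] at h ⊢
  rw [dotProduct_mulVec, vecMul_mulVec, transpose_transpose, h, vecMul_one]

lemma sum_sq_entries_star_mul_mul (hU : U ∈ orthogonalGroup ι ℝ) (hV : V ∈ orthogonalGroup ι ℝ)
    (M : Matrix ι ι ℝ) :
    ∑ i, ∑ j, (star U * M * V) i j ^ 2 = ∑ i, ∑ j, M i j ^ 2 := by
  simp only [sum_sq_entries_eq_trace]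
  calc (star (star U * M * V) * (star U * M * V)).trace
      = (star V * (star M * (U * star U) * M) * V).trace := by
        simp only [star_mul, star_star, Matrix.mul_assoc]
    _ = (star M * M).trace := by
        rw [mem_unitaryGroup_iff.1 hU, Matrix.mul_one, trace_mul_cycle,
          mem_unitaryGroup_iff.1 hV, Matrix.one_mul]

/-- The matrix of scalar products of the eigenbases of two symmetric matrices. The squares of its
entries form a doubly stochastic matrix, which couples the two spectra. -/
noncomputable def eigenOverlap (hA : A.IsHermitian) (hB : B.IsHermitian) : Matrix ι ι ℝ :=
  star (hA.eigenvectorUnitary : Matrix ι ι ℝ) * hB.eigenvectorUnitary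

lemma eigenOverlap_mem (hA : A.IsHermitian) (hB : B.IsHermitian) :
    eigenOverlap hA hB ∈ orthogonalGroup ι ℝ :=
  mul_mem (Unitary.star_mem hA.eigenvectorUnitary.2) hB.eigenvectorUnitary.2

lemma mul_eigenvectorUnitary (hA : A.IsHermitian) :
    A * (hA.eigenvectorUnitary : Matrix ι ι ℝ) =
      (hA.eigenvectorUnitary : Matrix ι ι ℝ) * diagonal hA.eigenvalues := by
  ext i j
  have h := congrFun (hA.mulVec_eigenvectorBasis j) i
  rw [mul_diagonal]
  simpa [mulVec, dotProduct, mul_apply, mul_comm] using h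

lemma eigenvalues_sub_mul_eigenOverlap (hA : A.IsHermitian) (hB : B.IsHermitian) (i j : ι) :
    (hA.eigenvalues i - hB.eigenvalues j) * eigenOverlap hA hB i j =
      (star (hA.eigenvectorUnitary : Matrix ι ι ℝ) * (A - B) * hB.eigenvectorUnitary) i j := by
  have hstar : star (hA.eigenvectorUnitary : Matrix ι ι ℝ) * A =
      diagonal hA.eigenvalues * star (hA.eigenvectorUnitary : Matrix ι ι ℝ) := by
    have h := congrArg star (mul_eigenvectorUnitary hA)
    rwa [star_mul, star_mul, star_eq_conjTranspose A, hA.eq, star_eq_conjTranspose (diagonal _),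
      diagonal_conjTranspose, star_trivial hA.eigenvalues] at h
  have h : star (hA.eigenvectorUnitary : Matrix ι ι ℝ) * (A - B) * hB.eigenvectorUnitary =
      diagonal hA.eigenvalues * eigenOverlap hA hB -
        eigenOverlap hA hB * diagonal hB.eigenvalues := by
    rw [eigenOverlap, Matrix.mul_sub, Matrix.sub_mul, hstar, Matrix.mul_assoc,
      Matrix.mul_assoc _ B, mul_eigenvectorUnitary hB, Matrix.mul_assoc]
  rw [h, Matrix.sub_apply, diagonal_mul, mul_diagonal]
  ring

lemma sum_sub_sum_eq_sum_sq_smul {E : Type*} [AddCommGroup E] [Module ℝ E]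
    (hO : O ∈ orthogonalGroup ι ℝ) (f g : ι → E) :
    ∑ i, f i - ∑ j, g j = ∑ i, ∑ j, O i j ^ 2 • (f i - g j) := by
  simp only [smul_sub, Finset.sum_sub_distrib]
  rw [Finset.sum_comm (f := fun i j => O i j ^ 2 • g j)]
  simp only [← Finset.sum_smul, sum_sq_row_of_mem_orthogonalGroup hO,
    sum_sq_col_of_mem_orthogonalGroup hO, one_smul]

lemma norm_sum_eigenvalues_sub_le {E : Type*} [NormedAddCommGroup E] [NormedSpace ℝ E]
    (hA : A.IsHermitian) (hB : B.IsHermitian) {f : ℝ → E} {K : NNReal} (hf : LipschitzWith K f) :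
    ‖∑ i, f (hA.eigenvalues i) - ∑ i, f (hB.eigenvalues i)‖ ≤
      K * (√(∑ i, ∑ j, (A i j - B i j) ^ 2) * √(Fintype.card ι)) := by
  set O := eigenOverlap hA hB
  set D := star (hA.eigenvectorUnitary : Matrix ι ι ℝ) * (A - B) * hB.eigenvectorUnitary
  have hDO : ∀ i j, D i j = (hA.eigenvalues i - hB.eigenvalues j) * O i j := fun i j =>
    (eigenvalues_sub_mul_eigenOverlap hA hB i j).symm
  have hD : ∑ p : ι × ι, |D p.1 p.2| ^ 2 = ∑ i, ∑ j, (A i j - B i j) ^ 2 := by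
    simp only [Fintype.sum_prod_type, sq_abs]
    exact sum_sq_entries_star_mul_mul hA.eigenvectorUnitary.2 hB.eigenvectorUnitary.2 (A - B)
  have hO : ∑ p : ι × ι, |O p.1 p.2| ^ 2 = Fintype.card ι := by
    simp [Fintype.sum_prod_type, sq_abs, O,
      sum_sq_row_of_mem_orthogonalGroup (eigenOverlap_mem hA hB)]
  have hterm : ∀ i j, ‖O i j ^ 2 • (f (hA.eigenvalues i) - f (hB.eigenvalues j))‖ ≤
      K * (|D i j| * |O i j|) := fun i j => by
    have hLip := hf.dist_le_mul (hA.eigenvalues i) (hB.eigenvalues j)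
    rw [dist_eq_norm, Real.dist_eq] at hLip
    rw [norm_smul, hDO, abs_mul, Real.norm_eq_abs, abs_pow]
    calc |O i j| ^ 2 * ‖f (hA.eigenvalues i) - f (hB.eigenvalues j)‖
        ≤ |O i j| ^ 2 * (K * |hA.eigenvalues i - hB.eigenvalues j|) := by gcongr
      _ = K * (|hA.eigenvalues i - hB.eigenvalues j| * |O i j| * |O i j|) := by ring
  rw [sum_sub_sum_eq_sum_sq_smul (eigenOverlap_mem hA hB)]
  calc ‖∑ i, ∑ j, O i j ^ 2 • (f (hA.eigenvalues i) - f (hB.eigenvalues j))‖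
      ≤ ∑ i, ∑ j, K * (|D i j| * |O i j|) :=
        norm_sum_le_of_le _ fun i _ => norm_sum_le_of_le _ fun j _ => hterm i j
    _ = K * ∑ p : ι × ι, |D p.1 p.2| * |O p.1 p.2| := by
        simp only [Fintype.sum_prod_type, Finset.mul_sum]
    _ ≤ K * (√(∑ p : ι × ι, |D p.1 p.2| ^ 2) * √(∑ p : ι × ι, |O p.1 p.2| ^ 2)) := by
        gcongr
        exact Real.sum_mul_le_sqrt_mul_sqrt _ _ _
    _ = K * (√(∑ i, ∑ j, (A i j - B i j) ^ 2) * √(Fintype.card ι)) := by rw [hD, hO]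

lemma sum_norm_sq_mulVec_of_mem_orthogonalGroup (hO : O ∈ orthogonalGroup ι ℝ) (β : ι → ℂ) :
    ∑ i, ‖∑ j, (O i j : ℂ) * β j‖ ^ 2 = ∑ j, ‖β j‖ ^ 2 := by
  have hreal : ∀ b : ι → ℝ, ∑ i, (∑ j, O i j * b j) ^ 2 = ∑ j, b j ^ 2 := fun b => by
    have h := star_mulVec_dotProduct_self (Unitary.star_mem hO) b
    simpa [star_star, dotProduct, mulVec, sq] using h
  have hnorm : ∀ z : ℂ, ‖z‖ ^ 2 = z.re ^ 2 + z.im ^ 2 := fun z => by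
    rw [Complex.sq_norm, Complex.normSq_apply]
    ring
  simp only [hnorm, Complex.re_sum, Complex.im_sum, Complex.re_ofReal_mul, Complex.im_ofReal_mul,
    Finset.sum_add_distrib, hreal]

lemma norm_bilinear_le_of_mem_orthogonalGroup (hO : O ∈ orthogonalGroup ι ℝ) (α β : ι → ℂ) :
    ‖∑ i, ∑ j, α i * (O i j : ℂ) * β j‖ ≤ (∑ i, ‖α i‖ ^ 2 + ∑ j, ‖β j‖ ^ 2) / 2 := by
  rw [← sum_norm_sq_mulVec_of_mem_orthogonalGroup hO β, ← Finset.sum_add_distrib, Finset.sum_div]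
  refine norm_sum_le_of_le _ fun i _ => ?_
  simp only [mul_assoc]
  rw [← Finset.mul_sum, norm_mul]
  nlinarith [sq_nonneg (‖α i‖ - ‖∑ j, (O i j : ℂ) * β j‖)]

lemma hasDerivAt_cexp_interpolation (a b s : ℝ) :
    HasDerivAt (fun s : ℝ => Complex.exp ((s * a : ℝ) * Complex.I) *
        Complex.exp (((1 - s) * b : ℝ) * Complex.I))
      (((a - b : ℝ) * Complex.I) * (Complex.exp ((s * a : ℝ) * Complex.I) *
        Complex.exp (((1 - s) * b : ℝ) * Complex.I))) s := by
  have ha : HasDerivAt (fun s : ℝ => s * a) a s := by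
    simpa using (hasDerivAt_id s).mul_const a
  have hb : HasDerivAt (fun s : ℝ => (1 - s) * b) (-b) s := by
    simpa using ((hasDerivAt_id s).const_sub 1).mul_const b
  refine ((ha.ofReal_comp.mul_const Complex.I).cexp.mul
    (hb.ofReal_comp.mul_const Complex.I).cexp).congr_deriv ?_
  push_cast
  ring

lemma cexp_sub_cexp_eq_integral (a b : ℝ) :
    Complex.exp (a * Complex.I) - Complex.exp (b * Complex.I) =
      ((a - b : ℝ) * Complex.I) * ∫ s in (0 : ℝ)..1,
        Complex.exp ((s * a : ℝ) * Complex.I) * Complex.exp (((1 - s) * b : ℝ) * Complex.I) := by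
  have hcont : Continuous fun s : ℝ => ((a - b : ℝ) * Complex.I) *
      (Complex.exp ((s * a : ℝ) * Complex.I) *
        Complex.exp (((1 - s) * b : ℝ) * Complex.I)) := by fun_prop
  rw [← intervalIntegral.integral_const_mul, intervalIntegral.integral_eq_sub_of_hasDerivAt
    (fun s _ => hasDerivAt_cexp_interpolation a b s) (hcont.intervalIntegrable _ _)]
  simp

lemma eigenvalues_sub_mul_eigenOverlap_of_rank_one (hA : A.IsHermitian) (hB : B.IsHermitian)
    {c : ℝ} {v : ι → ℝ} (hAB : A - B = c • vecMulVec v v) (i j : ι) :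
    (hA.eigenvalues i - hB.eigenvalues j) * eigenOverlap hA hB i j =
      c * ((star (hA.eigenvectorUnitary : Matrix ι ι ℝ) *ᵥ v) i *
        (star (hB.eigenvectorUnitary : Matrix ι ι ℝ) *ᵥ v) j) := by
  rw [eigenvalues_sub_mul_eigenOverlap, hAB, Matrix.mul_smul, Matrix.smul_mul, mul_vecMulVec,
    vecMulVec_mul, star_eq_conjTranspose (hB.eigenvectorUnitary : Matrix ι ι ℝ),
    conjTranspose_eq_transpose_of_trivial, mulVec_transpose]
  rfl

/-- Duhamel's formula for `tr exp (i t A) - tr exp (i t B)`, written in the two eigenbases. -/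
lemma sum_cexp_eigenvalues_sub_eq_integral (hA : A.IsHermitian) (hB : B.IsHermitian) {c : ℝ}
    {v : ι → ℝ} (hAB : A - B = c • vecMulVec v v) (t : ℝ) :
    ∑ i, Complex.exp ((t * hA.eigenvalues i : ℝ) * Complex.I) -
      ∑ i, Complex.exp ((t * hB.eigenvalues i : ℝ) * Complex.I) =
    ∫ s in (0 : ℝ)..1, ((t * c : ℝ) * Complex.I) * ∑ i, ∑ j,
      (Complex.exp ((s * (t * hA.eigenvalues i) : ℝ) * Complex.I) *
        (star (hA.eigenvectorUnitary : Matrix ι ι ℝ) *ᵥ v) i) * (eigenOverlap hA hB i j : ℂ) *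
      (Complex.exp (((1 - s) * (t * hB.eigenvalues j) : ℝ) * Complex.I) *
        (star (hB.eigenvectorUnitary : Matrix ι ι ℝ) *ᵥ v) j) := by
  set p := star (hA.eigenvectorUnitary : Matrix ι ι ℝ) *ᵥ v
  set q := star (hB.eigenvectorUnitary : Matrix ι ι ℝ) *ᵥ v
  have hterm : ∀ i j, eigenOverlap hA hB i j ^ 2 •
      (Complex.exp ((t * hA.eigenvalues i : ℝ) * Complex.I) -
        Complex.exp ((t * hB.eigenvalues j : ℝ) * Complex.I)) =
      ∫ s in (0 : ℝ)..1, ((t * c : ℝ) * Complex.I) *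
        ((Complex.exp ((s * (t * hA.eigenvalues i) : ℝ) * Complex.I) * p i) *
          (eigenOverlap hA hB i j : ℂ) *
          (Complex.exp (((1 - s) * (t * hB.eigenvalues j) : ℝ) * Complex.I) * q j)) := by
    intro i j
    rw [cexp_sub_cexp_eq_integral, ← intervalIntegral.integral_const_mul,
      ← intervalIntegral.integral_smul]
    congr 1 with s
    have h := congrArg (fun x : ℝ => (x : ℂ))
      (eigenvalues_sub_mul_eigenOverlap_of_rank_one hA hB hAB i j)
    rw [Complex.real_smul]
    push_cast at h ⊢
    linear_combination ((t : ℂ) * Complex.I * Complex.exp (s * (t * hA.eigenvalues i) * Complex.I) *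
      Complex.exp ((1 - s) * (t * hB.eigenvalues j) * Complex.I) * eigenOverlap hA hB i j) * h
  rw [sum_sub_sum_eq_sum_sq_smul (eigenOverlap_mem hA hB)]
  simp only [hterm, Finset.mul_sum]
  rw [intervalIntegral.integral_finsetSum fun i _ =>
    Continuous.intervalIntegrable (by fun_prop) _ _]
  refine Finset.sum_congr rfl fun i _ => ?_
  rw [intervalIntegral.integral_finsetSum fun j _ =>
    Continuous.intervalIntegrable (by fun_prop) _ _]

lemma norm_sum_cexp_eigenvalues_sub_le_of_rank_one (hA : A.IsHermitian) (hB : B.IsHermitian)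
    {c : ℝ} {v : ι → ℝ} (hAB : A - B = c • vecMulVec v v) (t : ℝ) :
    ‖∑ i, Complex.exp ((t * hA.eigenvalues i : ℝ) * Complex.I) -
      ∑ i, Complex.exp ((t * hB.eigenvalues i : ℝ) * Complex.I)‖ ≤ |t| * |c| * (v ⬝ᵥ v) := by
  have hsq : ∀ {W : Matrix ι ι ℝ}, W ∈ orthogonalGroup ι ℝ →
      ∑ i, (star W *ᵥ v) i ^ 2 = v ⬝ᵥ v := fun hW => by
    rw [← star_mulVec_dotProduct_self hW, dotProduct]
    simp only [sq]
  have hbound : ∀ s : ℝ, ‖((t * c : ℝ) * Complex.I) * ∑ i, ∑ j,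
      (Complex.exp ((s * (t * hA.eigenvalues i) : ℝ) * Complex.I) *
        (star (hA.eigenvectorUnitary : Matrix ι ι ℝ) *ᵥ v) i) * (eigenOverlap hA hB i j : ℂ) *
      (Complex.exp (((1 - s) * (t * hB.eigenvalues j) : ℝ) * Complex.I) *
        (star (hB.eigenvectorUnitary : Matrix ι ι ℝ) *ᵥ v) j)‖ ≤ |t| * |c| * (v ⬝ᵥ v) := by
    intro s
    rw [norm_mul, norm_mul, Complex.norm_real, Complex.norm_I, mul_one, Real.norm_eq_abs, abs_mul]
    gcongr
    refine (norm_bilinear_le_of_mem_orthogonalGroup (eigenOverlap_mem hA hB) _ _).trans_eq ?_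
    simp only [norm_mul, Complex.norm_exp_ofReal_mul_I, one_mul, Complex.norm_real,
      Real.norm_eq_abs, sq_abs]
    rw [hsq hA.eigenvectorUnitary.2, hsq hB.eigenvectorUnitary.2, add_self_div_two]
  rw [sum_cexp_eigenvalues_sub_eq_integral hA hB hAB]
  simpa using intervalIntegral.norm_integral_le_of_norm_le_const
    (a := (0 : ℝ)) (b := 1) fun s _ => hbound s

end EigenvaluePerturbation

section SpectralMeasure

open Matrix

variable {n : ℕ} {A B : Matrix (Fin n) (Fin n) ℝ}

lemma integrable_spectralMeasure [NeZero n] {E : Type*} [NormedAddCommGroup E]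
    (hA : A.IsHermitian) (f : ℝ → E) :
    Integrable f (spectralMeasure A hA : Measure ℝ) := by
  change Integrable f ((n : ℝ≥0∞)⁻¹ • ∑ j, Measure.dirac (hA.eigenvalues j))
  refine Integrable.smul_measure ?_ (by simp [NeZero.ne n])
  rw [integrable_finsetSum_measure]
  exact fun i _ => integrable_dirac (by simp)

lemma integral_spectralMeasure [NeZero n] {E : Type*} [NormedAddCommGroup E] [NormedSpace ℝ E]
    [CompleteSpace E] (hA : A.IsHermitian) (f : ℝ → E) :
    ∫ x, f x ∂(spectralMeasure A hA : Measure ℝ) = (n : ℝ)⁻¹ • ∑ j, f (hA.eigenvalues j) := by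
  change ∫ x, f x ∂((n : ℝ≥0∞)⁻¹ • ∑ j, Measure.dirac (hA.eigenvalues j)) = _
  rw [integral_smul_measure, integral_finsetSum_measure fun i _ => integrable_dirac (by simp)]
  simp

lemma charFun_spectralMeasure [NeZero n] (hA : A.IsHermitian) (t : ℝ) :
    charFun (spectralMeasure A hA : Measure ℝ) t =
      (n : ℝ)⁻¹ • ∑ j, Complex.exp ((t * hA.eigenvalues j : ℝ) * Complex.I) := by
  rw [charFun_apply_real, integral_spectralMeasure]
  simp

lemma norm_charFun_spectralMeasure_sub [NeZero n] (hA : A.IsHermitian) (hB : B.IsHermitian)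
    (t : ℝ) :
    ‖charFun (spectralMeasure A hA : Measure ℝ) t - charFun (spectralMeasure B hB : Measure ℝ) t‖ =
      (n : ℝ)⁻¹ * ‖∑ j, Complex.exp ((t * hA.eigenvalues j : ℝ) * Complex.I) -
        ∑ j, Complex.exp ((t * hB.eigenvalues j : ℝ) * Complex.I)‖ := by
  rw [charFun_spectralMeasure, charFun_spectralMeasure, ← smul_sub, norm_smul,
    Real.norm_of_nonneg (by positivity)]

lemma trace_pow_eq_sum_eigenvalues_pow {ι : Type*} [Fintype ι] [DecidableEq ι]
    {A : Matrix ι ι ℝ} (hA : A.IsHermitian) (r : ℕ) :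
    (A ^ r).trace = ∑ j, hA.eigenvalues j ^ r := by
  set U := (hA.eigenvectorUnitary : Matrix ι ι ℝ)
  have hU : U * star U = 1 := mem_unitaryGroup_iff.1 hA.eigenvectorUnitary.2
  have hU' : star U * U = 1 := mem_unitaryGroup_iff'.1 hA.eigenvectorUnitary.2
  have hpow : U * diagonal hA.eigenvalues ^ r = A ^ r * U :=
    SemiconjBy.pow_right (mul_eigenvectorUnitary hA).symm r
  calc (A ^ r).trace = (A ^ r * U * star U).trace := by rw [Matrix.mul_assoc, hU, Matrix.mul_one]
    _ = (diagonal hA.eigenvalues ^ r).trace := by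
        rw [← hpow, Matrix.trace_mul_comm, ← Matrix.mul_assoc, hU', Matrix.one_mul]
    _ = ∑ j, hA.eigenvalues j ^ r := by simp [diagonal_pow, trace]

lemma integral_pow_spectralMeasure [NeZero n] (hA : A.IsHermitian) (r : ℕ) :
    ∫ x, x ^ r ∂(spectralMeasure A hA : Measure ℝ) = (n : ℝ)⁻¹ * (A ^ r).trace := by
  rw [integral_spectralMeasure, trace_pow_eq_sum_eigenvalues_pow hA, smul_eq_mul]

lemma lipschitzWith_cexp_mul_I (t : ℝ) :
    LipschitzWith ‖t‖₊ fun x : ℝ => Complex.exp ((t * x : ℝ) * Complex.I) := by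
  refine LipschitzWith.of_dist_le_mul fun x y => ?_
  have hfactor : Complex.exp ((t * x : ℝ) * Complex.I) - Complex.exp ((t * y : ℝ) * Complex.I) =
      Complex.exp ((t * y : ℝ) * Complex.I) *
        (Complex.exp (Complex.I * ((t * (x - y) : ℝ) : ℂ)) - 1) := by
    rw [mul_sub, ← Complex.exp_add, mul_one]
    congr 2
    push_cast
    ring
  rw [dist_eq_norm, hfactor, norm_mul, Complex.norm_exp_ofReal_mul_I, one_mul, Real.dist_eq,
    coe_nnnorm, Real.norm_eq_abs, ← abs_mul]
  exact Real.norm_exp_I_mul_ofReal_sub_one_le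

lemma norm_charFun_spectralMeasure_sub_le [NeZero n] (hA : A.IsHermitian) (hB : B.IsHermitian)
    (t : ℝ) :
    ‖charFun (spectralMeasure A hA : Measure ℝ) t - charFun (spectralMeasure B hB : Measure ℝ) t‖ ≤
      |t| * √((n : ℝ)⁻¹ * ∑ i, ∑ j, (A i j - B i j) ^ 2) := by
  have hn : (0 : ℝ) < n := Nat.cast_pos.2 (NeZero.pos n)
  have hroot : (n : ℝ)⁻¹ * √n = √(n : ℝ)⁻¹ := by
    rw [inv_mul_eq_div, Real.sqrt_div_self', Real.sqrt_inv, one_div]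
  have hlip := norm_sum_eigenvalues_sub_le hA hB (lipschitzWith_cexp_mul_I t)
  rw [coe_nnnorm, Real.norm_eq_abs, Fintype.card_fin] at hlip
  rw [norm_charFun_spectralMeasure_sub, Real.sqrt_mul (by positivity), ← hroot]
  calc _ ≤ (n : ℝ)⁻¹ * (|t| * (√(∑ i, ∑ j, (A i j - B i j) ^ 2) * √n)) := by gcongr
    _ = _ := by ring

end SpectralMeasure

section ToeplitzMeasure

open Matrix

variable {n : ℕ}

/-- The empirical spectral measure of `T_n / √n`. -/
noncomputable abbrev toeplitzMeasure (n : ℕ) [NeZero n] (x : ℕ → ℝ) : ProbabilityMeasure ℝ :=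
  spectralMeasure (scaledToeplitz n x) (scaledToeplitz_isHermitian n x)

lemma scaledToeplitz_apply (x : ℕ → ℝ) (i j : Fin n) :
    scaledToeplitz n x i j = (√(n : ℝ))⁻¹ * x ((i : ℤ) - (j : ℤ)).natAbs := rfl

lemma inv_sqrt_natCast_sq (n : ℕ) : (√(n : ℝ))⁻¹ ^ 2 = (n : ℝ)⁻¹ := by
  rw [inv_pow, Real.sq_sqrt n.cast_nonneg]

lemma card_filter_natAbs_sub_le_two (i : Fin n) (k : ℕ) :
    (Finset.univ.filter fun j : Fin n => ((i : ℤ) - (j : ℤ)).natAbs = k).card ≤ 2 := by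
  have hcard : _ ≤ ({(k : ℤ), -(k : ℤ)} : Finset ℤ).card :=
    Finset.card_le_card_of_injOn (s := Finset.univ.filter fun j : Fin n =>
      ((i : ℤ) - (j : ℤ)).natAbs = k) (fun j => (i : ℤ) - (j : ℤ)) (fun j hj => by
        have := (Finset.mem_filter.1 hj).2
        simp only [Finset.coe_insert, Finset.coe_singleton, Set.mem_insert_iff,
          Set.mem_singleton_iff]
        omega) fun a _ b _ hab => Fin.ext (by simp only at hab; omega)
  exact hcard.trans Finset.card_le_two

lemma sum_natAbs_sub_le {z : ℕ → ℝ} (hz : ∀ k, 0 ≤ z k) (i : Fin n) :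
    ∑ j : Fin n, z ((i : ℤ) - (j : ℤ)).natAbs ≤ 2 * ∑ k ∈ Finset.range n, z k := by
  have hmaps : ∀ j ∈ (Finset.univ : Finset (Fin n)),
      ((i : ℤ) - (j : ℤ)).natAbs ∈ Finset.range n := fun j _ => by
    have := i.2
    have := j.2
    simp only [Finset.mem_range]
    omega
  rw [← Finset.sum_fiberwise_of_maps_to hmaps, Finset.mul_sum]
  refine Finset.sum_le_sum fun k _ => ?_
  rw [Finset.sum_congr rfl (g := fun _ => z k) fun j hj => by rw [(Finset.mem_filter.1 hj).2],
    Finset.sum_const, nsmul_eq_mul]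
  exact mul_le_mul_of_nonneg_right (by exact_mod_cast card_filter_natAbs_sub_le_two i k) (hz k)

lemma norm_charFun_toeplitzMeasure_sub_le [NeZero n] (x y : ℕ → ℝ) (t : ℝ) :
    ‖charFun (toeplitzMeasure n x : Measure ℝ) t - charFun (toeplitzMeasure n y : Measure ℝ) t‖ ≤
      |t| * √(2 * ((∑ k ∈ Finset.range n, (x k - y k) ^ 2) / n)) := by
  have hn : (n : ℝ) ≠ 0 := Nat.cast_ne_zero.2 (NeZero.ne n)
  have hentry : ∀ i j : Fin n, (scaledToeplitz n x i j - scaledToeplitz n y i j) ^ 2 =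
      (n : ℝ)⁻¹ * (x ((i : ℤ) - (j : ℤ)).natAbs - y ((i : ℤ) - (j : ℤ)).natAbs) ^ 2 := fun i j => by
    rw [scaledToeplitz_apply, scaledToeplitz_apply, ← mul_sub, mul_pow, inv_sqrt_natCast_sq]
  refine (norm_charFun_spectralMeasure_sub_le _ _ t).trans
    (mul_le_mul_of_nonneg_left (Real.sqrt_le_sqrt ?_) (abs_nonneg t))
  simp only [hentry, ← Finset.mul_sum]
  calc (n : ℝ)⁻¹ * ((n : ℝ)⁻¹ * ∑ i : Fin n, ∑ j : Fin n,
        (x ((i : ℤ) - (j : ℤ)).natAbs - y ((i : ℤ) - (j : ℤ)).natAbs) ^ 2)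
      ≤ (n : ℝ)⁻¹ * ((n : ℝ)⁻¹ * ∑ _i : Fin n, 2 * ∑ k ∈ Finset.range n, (x k - y k) ^ 2) := by
        gcongr with i
        exact sum_natAbs_sub_le (z := fun k => (x k - y k) ^ 2) (fun k => sq_nonneg _) i
    _ = 2 * ((∑ k ∈ Finset.range n, (x k - y k) ^ 2) / n) := by
        rw [Finset.sum_const, Finset.card_univ, Fintype.card_fin, nsmul_eq_mul]
        field_simp

lemma norm_charFun_toeplitzMeasure_add_const_sub_le [NeZero n] (x : ℕ → ℝ) (c t : ℝ) :
    ‖charFun (toeplitzMeasure n fun k => x k + c : Measure ℝ) t -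
      charFun (toeplitzMeasure n x : Measure ℝ) t‖ ≤ |t| * |c| / √n := by
  have hn : (n : ℝ) ≠ 0 := Nat.cast_ne_zero.2 (NeZero.ne n)
  have hrank : scaledToeplitz n (fun k => x k + c) - scaledToeplitz n x =
      ((√n)⁻¹ * c) • vecMulVec (fun _ => 1) (fun _ => 1) := by
    ext i j
    rw [Matrix.sub_apply, scaledToeplitz_apply, scaledToeplitz_apply, Matrix.smul_apply,
      vecMulVec_apply, smul_eq_mul]
    ring
  have hones : (fun _ => 1 : Fin n → ℝ) ⬝ᵥ (fun _ => 1) = n := by simp [dotProduct]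
  have htrace := norm_sum_cexp_eigenvalues_sub_le_of_rank_one (scaledToeplitz_isHermitian n _)
    (scaledToeplitz_isHermitian n x) hrank t
  rw [hones, abs_mul, abs_of_nonneg (by positivity : 0 ≤ (√(n : ℝ))⁻¹)] at htrace
  rw [norm_charFun_spectralMeasure_sub]
  calc _ ≤ (n : ℝ)⁻¹ * (|t| * ((√n)⁻¹ * |c|) * n) := by gcongr
    _ = |t| * |c| / √n := by field_simp

end ToeplitzMeasure

section SizeComparison

open Matrix

variable {N : ℕ}

/-- The extension of a square matrix by `m` zero rows and columns. It is used to compare Toeplitz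
matrices of different sizes. -/
def padZero (m : ℕ) (A : Matrix (Fin N) (Fin N) ℝ) : Matrix (Fin (N + m)) (Fin (N + m)) ℝ :=
  reindex finSumFinEquiv finSumFinEquiv (fromBlocks A 0 0 0)

variable {m : ℕ} {A : Matrix (Fin N) (Fin N) ℝ}

lemma padZero_isHermitian (m : ℕ) (hA : A.IsHermitian) : (padZero m A).IsHermitian := by
  have hblocks := IsHermitian.fromBlocks (B := (0 : Matrix (Fin N) (Fin m) ℝ)) (C := 0) hA
    (by simp) isHermitian_zero
  exact hblocks.submatrix _

lemma sum_eigenvalues_padZero (hA : A.IsHermitian) (f : ℝ → ℂ) :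
    ∑ i, f ((padZero_isHermitian m hA).eigenvalues i) =
      ∑ i, f (hA.eigenvalues i) + m * f 0 := by
  have hcharpoly : (padZero m A).charpoly = A.charpoly * Polynomial.X ^ m := by
    rw [padZero, charpoly_reindex, charpoly_fromBlocks_zero₁₂]
    simp [charpoly_zero]
  have hroots := congrArg Polynomial.roots hcharpoly
  rw [Polynomial.roots_mul (mul_ne_zero A.charpoly_monic.ne_zero
      (pow_ne_zero _ Polynomial.X_ne_zero)),
    (padZero_isHermitian m hA).roots_charpoly_eq_eigenvalues,
    hA.roots_charpoly_eq_eigenvalues, Polynomial.roots_X_pow] at hroots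
  have hsum := congrArg (fun s => (Multiset.map f s).sum) hroots
  simpa [Function.comp_def, Finset.sum, Multiset.map_map, Multiset.nsmul_singleton] using hsum

lemma norm_charFun_spectralMeasure_padZero_sub_le [NeZero N] [NeZero (N + m)]
    (hA : A.IsHermitian) (t : ℝ) :
    ‖charFun (spectralMeasure (padZero m A) (padZero_isHermitian m hA) : Measure ℝ) t -
      charFun (spectralMeasure A hA : Measure ℝ) t‖ ≤ 2 * ((m : ℝ) / (N + m : ℕ)) := by
  have hN : (N : ℂ) ≠ 0 := Nat.cast_ne_zero.2 (NeZero.ne N)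
  have hn : (N + m : ℂ) ≠ 0 := by exact_mod_cast NeZero.ne (N + m)
  set χ := charFun (spectralMeasure A hA : Measure ℝ) t with hχ
  have hmix : charFun (spectralMeasure (padZero m A) (padZero_isHermitian m hA) : Measure ℝ) t -
      χ = ((m : ℝ) / (N + m : ℕ) : ℝ) * (1 - χ) := by
    rw [hχ, charFun_spectralMeasure, charFun_spectralMeasure,
      sum_eigenvalues_padZero hA fun y => Complex.exp ((t * y : ℝ) * Complex.I)]
    simp only [mul_zero, Complex.ofReal_zero, zero_mul, Complex.exp_zero, mul_one,
      Complex.real_smul]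
    generalize ∑ j, Complex.exp ((t * hA.eigenvalues j : ℝ) * Complex.I) = s
    push_cast
    field_simp
    ring
  rw [hmix, norm_mul, Complex.norm_real, Real.norm_of_nonneg (by positivity), mul_comm]
  gcongr
  calc ‖1 - χ‖ ≤ ‖(1 : ℂ)‖ + ‖χ‖ := norm_sub_le _ _
    _ ≤ 1 + 1 := add_le_add norm_one.le (norm_charFun_le_one t)
    _ = 2 := one_add_one_eq_two

lemma sum_sq_sub_padZero_le {M : Matrix (Fin (N + m)) (Fin (N + m)) ℝ} {a b : ℝ}
    (ha : ∀ i j, (M (Fin.castAdd m i) (Fin.castAdd m j) - A i j) ^ 2 ≤ a)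
    (hb : ∀ i j, M i j ^ 2 ≤ b) :
    ∑ i, ∑ j, (M i j - padZero m A i j) ^ 2 ≤ N * (N * a) + (m * (2 * N + m)) * b := by
  have hcorner : ∑ i : Fin N, ∑ j : Fin N,
      (M (Fin.castAdd m i) (Fin.castAdd m j) - A i j) ^ 2 ≤ N * (N * a) :=
    (Finset.sum_le_sum fun i _ => Finset.sum_le_sum fun j _ => ha i j).trans_eq (by simp)
  have hright : ∑ i : Fin N, ∑ j : Fin m, M (Fin.castAdd m i) (Fin.natAdd N j) ^ 2 ≤
      N * (m * b) :=
    (Finset.sum_le_sum fun i _ => Finset.sum_le_sum fun j _ => hb _ _).trans_eq (by simp)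
  have hlower : ∑ i : Fin m, ∑ j, M (Fin.natAdd N i) j ^ 2 ≤ m * ((N + m) * b) :=
    (Finset.sum_le_sum fun i _ => Finset.sum_le_sum fun j _ => hb _ _).trans_eq (by simp)
  calc ∑ i, ∑ j, (M i j - padZero m A i j) ^ 2
      = ∑ i : Fin N, ∑ j : Fin N, (M (Fin.castAdd m i) (Fin.castAdd m j) - A i j) ^ 2 +
          ∑ i : Fin N, ∑ j : Fin m, M (Fin.castAdd m i) (Fin.natAdd N j) ^ 2 +
          ∑ i : Fin m, ∑ j, M (Fin.natAdd N i) j ^ 2 := by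
        simp [Fin.sum_univ_add, padZero, Finset.sum_add_distrib]
        ring
    _ ≤ N * (N * a) + (m * (2 * N + m)) * b := by linarith

lemma mul_mul_sq_inv_sqrt_sub_le {a b : ℝ} (ha : 0 < a) (hab : a ≤ b) :
    a * (a * ((√b)⁻¹ - (√a)⁻¹) ^ 2) ≤ b - a := by
  have hs : 0 < √a := Real.sqrt_pos.2 ha
  have hsr : √a ≤ √b := Real.sqrt_le_sqrt hab
  have hr : 0 < √b := hs.trans_le hsr
  have hratio : (√a / √b) ^ 2 ≤ 1 := pow_le_one₀ (by positivity) ((div_le_one hr).2 hsr)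
  rw [← Real.sq_sqrt ha.le, ← Real.sq_sqrt (ha.le.trans hab), Real.sqrt_sq hs.le,
    Real.sqrt_sq hr.le]
  calc √a ^ 2 * (√a ^ 2 * ((√b)⁻¹ - (√a)⁻¹) ^ 2) = (√a / √b) ^ 2 * (√b - √a) ^ 2 := by
        field_simp
        ring
    _ ≤ 1 * (√b - √a) ^ 2 := by gcongr
    _ ≤ √b ^ 2 - √a ^ 2 := by nlinarith

lemma sum_sq_scaledToeplitz_sub_padZero_le [NeZero N] {x : ℕ → ℝ} {C : ℝ}
    (hx : ∀ k, |x k| ≤ C) :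
    ∑ i, ∑ j, (scaledToeplitz (N + m) x i j - padZero m (scaledToeplitz N x) i j) ^ 2 ≤
      3 * C ^ 2 * m := by
  have hN : (0 : ℝ) < N := Nat.cast_pos.2 (NeZero.pos N)
  have hx2 : ∀ k, x k ^ 2 ≤ C ^ 2 := fun k => sq_le_sq.2 ((hx k).trans (le_abs_self C))
  have hcorner : ∀ i j : Fin N, (scaledToeplitz (N + m) x (Fin.castAdd m i) (Fin.castAdd m j) -
      scaledToeplitz N x i j) ^ 2 ≤ C ^ 2 * ((√(N + m : ℝ))⁻¹ - (√(N : ℝ))⁻¹) ^ 2 := by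
    intro i j
    simp only [scaledToeplitz_apply, Fin.val_castAdd, Nat.cast_add]
    rw [← sub_mul, mul_pow, mul_comm]
    exact mul_le_mul_of_nonneg_right (hx2 _) (by positivity)
  have hentry : ∀ i j, scaledToeplitz (N + m) x i j ^ 2 ≤ C ^ 2 * (N + m : ℝ)⁻¹ := by
    intro i j
    rw [scaledToeplitz_apply, mul_pow, inv_sqrt_natCast_sq, mul_comm, Nat.cast_add]
    exact mul_le_mul_of_nonneg_right (hx2 _) (by positivity)
  have hband : (m * (2 * N + m)) * (N + m : ℝ)⁻¹ ≤ 2 * m := by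
    rw [← div_eq_mul_inv, div_le_iff₀ (by positivity)]
    nlinarith [(m.cast_nonneg : (0 : ℝ) ≤ m)]
  have hrescale : (N : ℝ) * (N * ((√(N + m : ℝ))⁻¹ - (√(N : ℝ))⁻¹) ^ 2) ≤ m :=
    (mul_mul_sq_inv_sqrt_sub_le hN (le_add_of_nonneg_right m.cast_nonneg)).trans_eq (by ring)
  refine (sum_sq_sub_padZero_le hcorner hentry).trans ?_
  calc _ = C ^ 2 * (N * (N * ((√(N + m : ℝ))⁻¹ - (√(N : ℝ))⁻¹) ^ 2) +
          (m * (2 * N + m)) * (N + m : ℝ)⁻¹) := by ring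
    _ ≤ C ^ 2 * (m + 2 * m) := by gcongr
    _ = 3 * C ^ 2 * m := by ring

lemma norm_charFun_toeplitzMeasure_add_size_sub_le [NeZero N] [NeZero (N + m)]
    {x : ℕ → ℝ} {C : ℝ} (hx : ∀ k, |x k| ≤ C) (t : ℝ) :
    ‖charFun (toeplitzMeasure (N + m) x : Measure ℝ) t -
      charFun (toeplitzMeasure N x : Measure ℝ) t‖ ≤
        |t| * √(3 * C ^ 2 * ((m : ℝ) / (N + m : ℕ))) + 2 * ((m : ℝ) / (N + m : ℕ)) := by
  have hS := scaledToeplitz_isHermitian N x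
  refine (norm_sub_le_norm_sub_add_norm_sub _
    (charFun (spectralMeasure (padZero m (scaledToeplitz N x)) (padZero_isHermitian m hS) :
      Measure ℝ) t) _).trans (add_le_add ?_ (norm_charFun_spectralMeasure_padZero_sub_le hS t))
  refine (norm_charFun_spectralMeasure_sub_le _ _ t).trans
    (mul_le_mul_of_nonneg_left (Real.sqrt_le_sqrt ?_) (abs_nonneg t))
  rw [mul_div_assoc', div_eq_inv_mul]
  exact mul_le_mul_of_nonneg_left (sum_sq_scaledToeplitz_sub_padZero_le hx) (by positivity)

end SizeComparison

section TraceExpansion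

lemma matrix_pow_apply_eq_sum {ι R : Type*} [Fintype ι] [DecidableEq ι] [CommSemiring R]
    (M : Matrix ι ι R) (r : ℕ) (a b : ι) :
    (M ^ r) a b = ∑ x : Fin (r + 1) → ι,
      if x 0 = a ∧ x (Fin.last r) = b then ∏ i : Fin r, M (x i.castSucc) (x i.succ) else 0 := by
  induction r generalizing a with
  | zero =>
    rw [← (Equiv.funUnique (Fin 1) ι).symm.sum_comp]
    simp [Matrix.one_apply, ite_and]
  | succ r ih =>
    rw [pow_succ', Matrix.mul_apply, ← (Fin.consEquiv fun _ : Fin (r + 2) => ι).sum_comp,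
      Fintype.sum_prod_type]
    simp only [ih, Finset.mul_sum]
    conv_lhs => rw [Finset.sum_comm]
    conv_rhs => rw [Finset.sum_comm]
    refine Finset.sum_congr rfl fun y _ => ?_
    simp only [Fin.consEquiv_apply, Fin.cons_zero, Fin.prod_univ_succ, Fin.castSucc_zero,
      ← Fin.succ_last, Fin.cons_succ, ← Fin.succ_castSucc, mul_ite, mul_zero, ite_and]
    simp

variable {n : ℕ}

/-- The closed paths `x 0, …, x r` in `Fin n`; they index the expansion of the trace of an
`r`-th power. -/
def loops (n r : ℕ) : Finset (Fin (r + 1) → Fin n) :=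
  Finset.univ.filter fun x => x 0 = x (Fin.last r)

/-- The steps `x (i - 1) - x i` of a path. -/
def steps {n r : ℕ} (x : Fin (r + 1) → Fin n) (i : Fin r) : ℤ :=
  (x i.castSucc : ℤ) - (x i.succ : ℤ)

/-- The absolute values of the steps of a path, that is, the indices of the entries of a Toeplitz
matrix that the path visits. -/
def label {n r : ℕ} (x : Fin (r + 1) → Fin n) (i : Fin r) : ℕ :=
  (steps x i).natAbs

lemma trace_toeplitz_pow (X : ℕ → ℝ) (r : ℕ) :
    (toeplitz n X ^ r).trace = ∑ x ∈ loops n r, ∏ i, X (label x i) := by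
  simp only [Matrix.trace, Matrix.diag_apply, matrix_pow_apply_eq_sum]
  rw [Finset.sum_comm, loops, Finset.sum_filter]
  refine Finset.sum_congr rfl fun x _ => ?_
  simp only [ite_and, Finset.sum_ite_eq, Finset.mem_univ, if_true]
  simp only [eq_comm (a := x (Fin.last r))]
  rfl

end TraceExpansion

section LabelCounting

variable {I : Type*}

/-- The vector `s` with all entries of absolute value `v` replaced by `0`. -/
def eraseLabel (v : ℕ) (s : I → ℤ) (i : I) : ℤ := if (s i).natAbs = v then 0 else s i

/-- The signs of the entries of `s` of absolute value `v`, and `0` at the other entries. -/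
noncomputable def labelSign (v : ℕ) (s : I → ℤ) (i : I) : SignType :=
  if (s i).natAbs = v then SignType.sign (s i) else 0

lemma eraseLabel_add_mul_labelSign (v : ℕ) (s : I → ℤ) (i : I) :
    eraseLabel v s i + v * labelSign v s i = s i := by
  unfold eraseLabel labelSign
  split_ifs with hv
  · rw [zero_add, ← hv, Int.natCast_natAbs, abs_mul_sign]
  · simp

lemma eq_of_eraseLabel_eq_of_labelSign_eq {J : Finset I} {s s' : I → ℤ} {v v' : ℕ}
    (hs : ∑ i ∈ J, s i = 0) (hs' : ∑ i ∈ J, s' i = 0) (herase : eraseLabel v s = eraseLabel v' s')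
    (hsign : labelSign v s = labelSign v' s')
    (hv : ∑ i ∈ J with (s i).natAbs = v, s i ≠ 0) : s = s' := by
  have hsigns : ∑ i ∈ J, (labelSign v s i : ℤ) ≠ 0 := by
    contrapose! hv
    calc ∑ i ∈ J with (s i).natAbs = v, s i = ∑ i ∈ J, v * (labelSign v s i : ℤ) := by
          rw [Finset.sum_filter]
          refine Finset.sum_congr rfl fun i _ => ?_
          by_cases hi : (s i).natAbs = v
          · rw [if_pos hi, ← eraseLabel_add_mul_labelSign v s i, eraseLabel, if_pos hi, zero_add]
          · rw [if_neg hi, labelSign, if_neg hi, SignType.coe_zero, mul_zero]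
      _ = 0 := by rw [← Finset.mul_sum, hv, mul_zero]
  have hmul : ((v : ℤ) - v') * ∑ i ∈ J, (labelSign v s i : ℤ) = 0 := by
    have hdiff : ∀ i, s i - s' i = ((v : ℤ) - v') * labelSign v s i := fun i => by
      rw [← eraseLabel_add_mul_labelSign v s i, ← eraseLabel_add_mul_labelSign v' s' i, herase,
        hsign]
      ring
    rw [Finset.mul_sum, ← Finset.sum_congr rfl fun i _ => hdiff i, Finset.sum_sub_distrib, hs, hs',
      sub_zero]
  have hvv : (v : ℤ) = v' := sub_eq_zero.1 ((mul_eq_zero.1 hmul).resolve_right hsigns)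
  funext i
  rw [← eraseLabel_add_mul_labelSign v s i, herase, hsign, hvv, eraseLabel_add_mul_labelSign]

variable [Fintype I]

/-- The set of nonzero absolute values of an integer vector. Its size is the number of degrees of
freedom of a vector with prescribed coincidences between the absolute values of its entries. -/
def nonzeroLabels (s : I → ℤ) : Finset ℕ :=
  (Finset.univ.image fun i => (s i).natAbs).erase 0

lemma nonzeroLabels_subset (s : I → ℤ) :
    nonzeroLabels s ⊆ Finset.univ.image fun i => (s i).natAbs :=
  Finset.erase_subset _ _

lemma natAbs_mem_nonzeroLabels {s : I → ℤ} {i : I} (hi : s i ≠ 0) :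
    (s i).natAbs ∈ nonzeroLabels s :=
  Finset.mem_erase.2 ⟨Int.natAbs_ne_zero.2 hi, Finset.mem_image_of_mem _ (Finset.mem_univ i)⟩

lemma exists_units_mul_natAbs_eq (a : ℤ) : ∃ u : ℤˣ, a = u * a.natAbs := by
  rcases Int.natAbs_eq a with ha | ha
  · exact ⟨1, by simpa using ha⟩
  · exact ⟨-1, by simpa using ha⟩

lemma exists_enumeration {n q : ℕ} (hn : 0 < n) {L : Finset ℕ} (hL : L.card ≤ q)
    (hLn : ∀ v ∈ L, v < n) : ∃ e : Fin q → Fin n, ∀ v ∈ L, ∃ c, (e c : ℕ) = v := by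
  let g := L.equivFin
  refine ⟨fun c => if h : (c : ℕ) < L.card then ⟨g.symm ⟨c, h⟩, hLn _ (g.symm ⟨c, h⟩).2⟩
    else ⟨0, hn⟩, fun v hv => ⟨⟨g ⟨v, hv⟩, (g ⟨v, hv⟩).2.trans_le hL⟩, ?_⟩⟩
  simp

lemma card_le_of_card_nonzeroLabels_le {n q : ℕ} (hn : 0 < n) {S : Finset (I → ℤ)}
    (hlt : ∀ s ∈ S, ∀ i, (s i).natAbs < n) (hq : ∀ s ∈ S, (nonzeroLabels s).card ≤ q) :
    S.card ≤ (2 * q + 1) ^ Fintype.card I * n ^ q := by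
  classical
  let decode : (I → Option (ℤˣ × Fin q)) × (Fin q → Fin n) → I → ℤ := fun p i =>
    (p.1 i).elim 0 fun c => (c.1 : ℤ) * (p.2 c.2 : ℕ)
  have hsub : S ⊆ Finset.univ.image decode := by
    intro s hs
    obtain ⟨e, he⟩ := exists_enumeration hn (hq s hs) fun v hv => by
      obtain ⟨i, -, rfl⟩ := Finset.mem_image.1 (nonzeroLabels_subset s hv)
      exact hlt s hs i
    have hcode : ∀ i, ∃ o : Option (ℤˣ × Fin q),
        o.elim 0 (fun c => (c.1 : ℤ) * (e c.2 : ℕ)) = s i := by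
      intro i
      by_cases h0 : s i = 0
      · exact ⟨none, h0.symm⟩
      · obtain ⟨c, hc⟩ := he _ (natAbs_mem_nonzeroLabels h0)
        obtain ⟨u, hu⟩ := exists_units_mul_natAbs_eq (s i)
        exact ⟨some (u, c), by rw [Option.elim_some, hc, ← hu]⟩
    choose o ho using hcode
    exact Finset.mem_image.2 ⟨(o, e), Finset.mem_univ _, funext ho⟩
  calc S.card ≤ (Finset.univ.image decode).card := Finset.card_le_card hsub
    _ ≤ (2 * q + 1) ^ Fintype.card I * n ^ q := by
      simpa [Fintype.card_units_int] using Finset.card_image_le (s := Finset.univ) (f := decode)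

lemma nonzeroLabels_eraseLabel_subset (v : ℕ) (s : I → ℤ) :
    nonzeroLabels (eraseLabel v s) ⊆ (nonzeroLabels s).erase v := by
  intro a ha
  obtain ⟨ha0, ha⟩ := Finset.mem_erase.1 ha
  obtain ⟨i, -, rfl⟩ := Finset.mem_image.1 ha
  unfold eraseLabel at ha0 ⊢
  split_ifs at ha0 ⊢ with hv
  · exact absurd rfl ha0
  · exact Finset.mem_erase.2 ⟨hv, natAbs_mem_nonzeroLabels (Int.natAbs_ne_zero.1 ha0)⟩

/-- A linear relation determines the absolute value `v` from the remaining entries and the signs,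
which saves one factor `n`. -/
lemma card_le_of_card_nonzeroLabels_erase_le {n q : ℕ} (hn : 0 < n) {S : Finset (I → ℤ)}
    {J : Finset I} (hlt : ∀ s ∈ S, ∀ i, (s i).natAbs < n) (hsum : ∀ s ∈ S, ∑ i ∈ J, s i = 0)
    (hq : ∀ s ∈ S, ∃ v : ℕ, ((nonzeroLabels s).erase v).card ≤ q ∧
      ∑ i ∈ J with (s i).natAbs = v, s i ≠ 0) :
    S.card ≤ (6 * q + 3) ^ Fintype.card I * n ^ q := by
  classical
  choose! v hcard hv using hq
  set T := S.image fun s => eraseLabel (v s) s with hT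
  have hTcard : T.card ≤ (2 * q + 1) ^ Fintype.card I * n ^ q := by
    refine card_le_of_card_nonzeroLabels_le hn ?_ ?_ <;>
      simp only [hT, Finset.forall_mem_image]
    · intro s hs i
      unfold eraseLabel
      split_ifs
      exacts [hn, hlt s hs i]
    · exact fun s hs => (Finset.card_le_card (nonzeroLabels_eraseLabel_subset _ s)).trans
        (hcard s hs)
  have hST : S.card ≤ (T ×ˢ (Finset.univ : Finset (I → SignType))).card := by
    refine Finset.card_le_card_of_injOn (fun s => (eraseLabel (v s) s, labelSign (v s) s))
      (fun s hs => ?_) fun s hs s' hs' hss' => ?_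
    · exact Finset.mem_coe.2 (Finset.mk_mem_product (Finset.mem_image_of_mem _ hs)
        (Finset.mem_univ _))
    · obtain ⟨herase, hsign⟩ := Prod.mk.inj hss'
      exact eq_of_eraseLabel_eq_of_labelSign_eq (hsum s hs) (hsum s' hs') herase hsign (hv s hs)
  have hsigns : Fintype.card SignType = 3 := rfl
  rw [Finset.card_product, Finset.card_univ, Fintype.card_fun, hsigns] at hST
  calc S.card ≤ (2 * q + 1) ^ Fintype.card I * n ^ q * 3 ^ Fintype.card I :=
        hST.trans (Nat.mul_le_mul_right _ hTcard)
    _ = ((2 * q + 1) * 3) ^ Fintype.card I * n ^ q := by rw [mul_pow]; ring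
    _ = (6 * q + 3) ^ Fintype.card I * n ^ q := by ring_nf

end LabelCounting

section PathCounting

variable {n r : ℕ}

lemma natAbs_steps_lt (x : Fin (r + 1) → Fin n) (i : Fin r) : (steps x i).natAbs < n := by
  have := (x i.castSucc).2
  have := (x i.succ).2
  simp only [steps]
  omega

lemma sum_steps (x : Fin (r + 1) → Fin n) :
    ∑ i, steps x i = (x 0 : ℤ) - (x (Fin.last r) : ℤ) := by
  induction r with
  | zero => simp
  | succ r ih =>
    calc ∑ i, steps x i = steps x 0 + ∑ i, steps (fun i => x i.succ) i := Fin.sum_univ_succ _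
      _ = _ := by rw [ih]; simp [steps]

lemma sum_steps_eq_zero {x : Fin (r + 1) → Fin n} (hx : x ∈ loops n r) :
    ∑ i, steps x i = 0 := by
  rw [sum_steps, (Finset.mem_filter.1 hx).2, sub_self]

lemma eq_of_steps_eq {x y : Fin (r + 1) → Fin n} (h0 : x 0 = y 0) (h : steps x = steps y) :
    x = y := by
  funext i
  induction i using Fin.induction with
  | zero => exact h0
  | succ i ih =>
    have hi := congrFun h i
    simp only [steps, ih] at hi
    exact Fin.ext (by omega)

lemma card_paths_le (S : Finset (Fin (r + 1) → Fin n)) :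
    S.card ≤ n * (S.image steps).card := by
  have hcard : S.card ≤ ((Finset.univ : Finset (Fin n)) ×ˢ (S.image steps)).card :=
    Finset.card_le_card_of_injOn (fun x => (x 0, steps x))
      (fun x hx => Finset.mem_coe.2 (Finset.mk_mem_product (Finset.mem_univ _)
        (Finset.mem_image_of_mem _ hx)))
      fun x _ y _ hxy => eq_of_steps_eq (Prod.mk.inj hxy).1 (Prod.mk.inj hxy).2
  simpa using hcard

lemma card_paths_le_of_card_labels_le (hn : 0 < n) {q : ℕ} {S : Finset (Fin (r + 1) → Fin n)}
    (hS : ∀ x ∈ S, (Finset.univ.image (label x)).card ≤ q) :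
    S.card ≤ (2 * q + 1) ^ r * n ^ (q + 1) := by
  have hsteps : (S.image steps).card ≤ (2 * q + 1) ^ r * n ^ q := by
    conv_rhs => rw [← Fintype.card_fin r]
    refine card_le_of_card_nonzeroLabels_le hn ?_ ?_ <;> simp only [Finset.forall_mem_image]
    · exact fun x _ => natAbs_steps_lt x
    · exact fun x hx => (Finset.card_le_card (nonzeroLabels_subset _)).trans (hS x hx)
  calc S.card ≤ n * (S.image steps).card := card_paths_le S
    _ ≤ n * ((2 * q + 1) ^ r * n ^ q) := Nat.mul_le_mul_left _ hsteps
    _ = (2 * q + 1) ^ r * n ^ (q + 1) := by ring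

/-- The steps of two paths, as one vector. -/
def pairSteps (p : (Fin (r + 1) → Fin n) × (Fin (r + 1) → Fin n)) : Fin r ⊕ Fin r → ℤ :=
  Sum.elim (steps p.1) (steps p.2)

/-- The labels of two paths, as one vector. -/
def pairLabel (p : (Fin (r + 1) → Fin n) × (Fin (r + 1) → Fin n)) : Fin r ⊕ Fin r → ℕ :=
  Sum.elim (label p.1) (label p.2)

lemma natAbs_pairSteps (p : (Fin (r + 1) → Fin n) × (Fin (r + 1) → Fin n)) (i : Fin r ⊕ Fin r) :
    (pairSteps p i).natAbs = pairLabel p i := by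
  rcases i with i | i <;> rfl

lemma natAbs_pairSteps_lt (p : (Fin (r + 1) → Fin n) × (Fin (r + 1) → Fin n))
    (i : Fin r ⊕ Fin r) : (pairSteps p i).natAbs < n := by
  rcases i with i | i
  exacts [natAbs_steps_lt p.1 i, natAbs_steps_lt p.2 i]

lemma nonzeroLabels_pairSteps_subset (p : (Fin (r + 1) → Fin n) × (Fin (r + 1) → Fin n)) :
    nonzeroLabels (pairSteps p) ⊆ Finset.univ.image (pairLabel p) := by
  simpa only [natAbs_pairSteps] using nonzeroLabels_subset (pairSteps p)

lemma card_path_pairs_le (S : Finset ((Fin (r + 1) → Fin n) × (Fin (r + 1) → Fin n))) :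
    S.card ≤ n ^ 2 * (S.image pairSteps).card := by
  have hcard : S.card ≤ ((Finset.univ : Finset (Fin n × Fin n)) ×ˢ (S.image pairSteps)).card := by
    refine Finset.card_le_card_of_injOn (fun p => ((p.1 0, p.2 0), pairSteps p))
      (fun p hp => Finset.mem_coe.2 (Finset.mk_mem_product (Finset.mem_univ _)
        (Finset.mem_image_of_mem _ hp))) fun p _ p' _ hp => ?_
    obtain ⟨hstart, hsteps⟩ := Prod.mk.inj hp
    obtain ⟨hstart₁, hstart₂⟩ := Prod.mk.inj hstart
    exact Prod.ext (eq_of_steps_eq hstart₁ (funext fun i => congrFun hsteps (Sum.inl i)))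
      (eq_of_steps_eq hstart₂ (funext fun i => congrFun hsteps (Sum.inr i)))
  simpa [sq] using hcard

end PathCounting

section Multiplicity

variable {I I' α : Type*} [Fintype I] [Fintype I'] [DecidableEq α] {l : I → α}

/-- The number of indices that carry the same label as `i`. -/
def multiplicity (l : I → α) (i : I) : ℕ :=
  (Finset.univ.filter fun j => l j = l i).card

lemma multiplicity_pos (l : I → α) (i : I) : 0 < multiplicity l i :=
  Finset.card_pos.2 ⟨i, by simp⟩

lemma two_le_multiplicity (h : ¬∃ i, multiplicity l i = 1) (i : I) :
    2 ≤ multiplicity l i :=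
  (Nat.succ_le_of_lt (multiplicity_pos l i)).lt_of_ne' fun hi => h ⟨i, hi⟩

lemma multiplicity_le_inl (l : I → α) (l' : I' → α) (i : I) :
    multiplicity l i ≤ multiplicity (Sum.elim l l') (Sum.inl i) :=
  Finset.card_le_card_of_injOn Sum.inl
    (fun _ hj => Finset.mem_filter.2 ⟨Finset.mem_univ _, (Finset.mem_filter.1 hj).2⟩)
    Sum.inl_injective.injOn

lemma multiplicity_le_inr (l : I → α) (l' : I' → α) (i : I') :
    multiplicity l' i ≤ multiplicity (Sum.elim l l') (Sum.inr i) :=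
  Finset.card_le_card_of_injOn Sum.inr
    (fun _ hj => Finset.mem_filter.2 ⟨Finset.mem_univ _, (Finset.mem_filter.1 hj).2⟩)
    Sum.inr_injective.injOn

lemma card_eq_sum_card_fiber (l : I → α) :
    Fintype.card I = ∑ v ∈ Finset.univ.image l, (Finset.univ.filter fun j => l j = v).card :=
  Finset.card_eq_sum_card_image l Finset.univ

lemma two_mul_card_image_le (h : ∀ i, 2 ≤ multiplicity l i) :
    2 * (Finset.univ.image l).card ≤ Fintype.card I := by
  rw [card_eq_sum_card_fiber l, mul_comm, ← smul_eq_mul]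
  exact Finset.card_nsmul_le_sum _ _ _ (Finset.forall_mem_image.2 fun i _ => h i)

lemma two_mul_card_image_lt (h : ∀ i, 2 ≤ multiplicity l i) (h' : ∃ i, multiplicity l i ≠ 2) :
    2 * (Finset.univ.image l).card < Fintype.card I := by
  obtain ⟨i, hi⟩ := h'
  rw [card_eq_sum_card_fiber l, mul_comm, ← smul_eq_mul, ← Finset.sum_const]
  exact Finset.sum_lt_sum (Finset.forall_mem_image.2 fun i _ => h i)
    ⟨l i, by simp, (h i).lt_of_ne' hi⟩

lemma two_mul_card_image_eq (h : ∀ i, multiplicity l i = 2) :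
    2 * (Finset.univ.image l).card = Fintype.card I := by
  rw [card_eq_sum_card_fiber l, mul_comm, ← smul_eq_mul, ← Finset.sum_const]
  exact Finset.sum_congr rfl (Finset.forall_mem_image.2 fun i _ => (h i).symm)

end Multiplicity

/-- An i.i.d. sequence of centered random variables with unit variance that are bounded by `C`. -/
structure IsBoundedNoise {Ω : Type*} [MeasurableSpace Ω] (Y : ℕ → Ω → ℝ) (P : Measure Ω)
    (C : ℝ) : Prop where
  measurable : ∀ i, Measurable (Y i)
  indep : iIndepFun Y P
  ident : ∀ i, IdentDistrib (Y i) (Y 1) P P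
  bound : ∀ i ω, |Y i ω| ≤ C
  mean : ∫ ω, Y 1 ω ∂P = 0
  var : ∫ ω, Y 1 ω ^ 2 ∂P = 1

namespace IsBoundedNoise

variable {Ω : Type*} [MeasurableSpace Ω] {P : Measure Ω} {Y : ℕ → Ω → ℝ} {C : ℝ}
  {I I' : Type*} [Fintype I] [Fintype I']

lemma measurable_prod (h : IsBoundedNoise Y P C) (l : I → ℕ) :
    Measurable fun ω => ∏ i, Y (l i) ω :=
  Finset.measurable_fun_prod _ fun _ _ => h.measurable _

lemma abs_prod_le (h : IsBoundedNoise Y P C) (l : I → ℕ) (ω : Ω) :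
    |∏ i, Y (l i) ω| ≤ C ^ Fintype.card I := by
  rw [Finset.abs_prod, ← Finset.card_univ, ← Finset.prod_const]
  exact Finset.prod_le_prod (fun _ _ => abs_nonneg _) fun i _ => h.bound _ _

lemma integral_prod (h : IsBoundedNoise Y P C) (l : I → ℕ) :
    ∫ ω, ∏ i, Y (l i) ω ∂P = ∏ v ∈ Finset.univ.image l,
      ∫ ω, Y 1 ω ^ (Finset.univ.filter fun i => l i = v).card ∂P := by
  set m : ℕ → ℕ := fun v => (Finset.univ.filter fun i => l i = v).card
  have hindep : iIndepFun (fun v : (Finset.univ.image l : Finset ℕ) => Y v) P :=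
    h.indep.precomp Subtype.val_injective
  have hmoment : ∀ v, ∫ ω, Y v ω ^ m v ∂P = ∫ ω, Y 1 ω ^ m v ∂P := fun v =>
    ((h.ident v).comp (u := fun x : ℝ => x ^ m v) (by fun_prop)).integral_eq
  calc ∫ ω, ∏ i, Y (l i) ω ∂P
      = ∫ ω, ∏ v : (Finset.univ.image l : Finset ℕ), Y v ω ^ m v ∂P := by
        refine integral_congr_ae (Eventually.of_forall fun ω => ?_)
        simp only [Finset.prod_comp (fun v => Y v ω) l]
        exact (Finset.prod_coe_sort _ fun v => Y v ω ^ m v).symm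
    _ = ∏ v : (Finset.univ.image l : Finset ℕ), ∫ ω, Y v ω ^ m v ∂P :=
        hindep.integral_fun_prod_comp (f := fun (v : ↥(Finset.univ.image l)) (x : ℝ) => x ^ m v)
          (fun v => (h.measurable _).aemeasurable) (fun v => by fun_prop)
    _ = ∏ v ∈ Finset.univ.image l, ∫ ω, Y 1 ω ^ m v ∂P := by
        rw [Finset.prod_coe_sort _ fun v => ∫ ω, Y v ω ^ m v ∂P]
        exact Finset.prod_congr rfl fun v _ => hmoment v

lemma integral_prod_eq_zero (h : IsBoundedNoise Y P C) {l : I → ℕ}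
    (hl : ∃ i, multiplicity l i = 1) : ∫ ω, ∏ i, Y (l i) ω ∂P = 0 := by
  obtain ⟨i, hi⟩ := hl
  rw [multiplicity] at hi
  rw [h.integral_prod]
  exact Finset.prod_eq_zero (Finset.mem_image_of_mem l (Finset.mem_univ i)) (by simp [hi, h.mean])

lemma integral_prod_eq_one (h : IsBoundedNoise Y P C) {l : I → ℕ}
    (hl : ∀ i, multiplicity l i = 2) : ∫ ω, ∏ i, Y (l i) ω ∂P = 1 := by
  simp only [multiplicity] at hl
  rw [h.integral_prod]
  exact Finset.prod_eq_one (Finset.forall_mem_image.2 fun i _ => by rw [hl i, h.var])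

lemma indepFun_prod (h : IsBoundedNoise Y P C) {l : I → ℕ} {l' : I' → ℕ}
    (hl : ∀ i j, l i ≠ l' j) :
    IndepFun (fun ω => ∏ i, Y (l i) ω) (fun ω => ∏ i, Y (l' i) ω) P := by
  have hdisj : Disjoint (Finset.univ.image l) (Finset.univ.image l') :=
    Finset.disjoint_left.2 (Finset.forall_mem_image.2 fun i _ hi => by
      obtain ⟨j, -, hj⟩ := Finset.mem_image.1 hi
      exact hl i j hj.symm)
  have hmeas : Measurable fun z : ↥(Finset.univ.image l) → ℝ =>
      ∏ i, z ⟨l i, Finset.mem_image_of_mem l (Finset.mem_univ i)⟩ := by fun_prop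
  have hmeas' : Measurable fun z : ↥(Finset.univ.image l') → ℝ =>
      ∏ i, z ⟨l' i, Finset.mem_image_of_mem l' (Finset.mem_univ i)⟩ := by fun_prop
  exact (h.indep.indepFun_finset _ _ hdisj h.measurable).comp hmeas hmeas'

variable [IsProbabilityMeasure P]

lemma bound_nonneg (h : IsBoundedNoise Y P C) : 0 ≤ C :=
  have ⟨ω⟩ := nonempty_of_isProbabilityMeasure P
  (abs_nonneg _).trans (h.bound 0 ω)

lemma memLp_prod (h : IsBoundedNoise Y P C) (l : I → ℕ) :
    MemLp (fun ω => ∏ i, Y (l i) ω) 2 P :=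
  MemLp.of_bound (h.measurable_prod l).aestronglyMeasurable (C ^ Fintype.card I)
    (Eventually.of_forall fun ω => (Real.norm_eq_abs _).trans_le (h.abs_prod_le l ω))

lemma integrable_prod (h : IsBoundedNoise Y P C) (l : I → ℕ) :
    Integrable (fun ω => ∏ i, Y (l i) ω) P :=
  (h.memLp_prod l).integrable one_le_two

lemma abs_integral_prod_le (h : IsBoundedNoise Y P C) (l : I → ℕ) :
    |∫ ω, ∏ i, Y (l i) ω ∂P| ≤ C ^ Fintype.card I := by
  simpa using norm_integral_le_of_norm_le_const (μ := P)
    (Eventually.of_forall fun ω => (Real.norm_eq_abs _).trans_le (h.abs_prod_le l ω))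

end IsBoundedNoise

section LinkedLoops

variable {n r : ℕ}

/-- Pairs of loops that share a label and in which no label is isolated. -/
def linkedLoopPairs (n r : ℕ) : Finset ((Fin (r + 1) → Fin n) × (Fin (r + 1) → Fin n)) :=
  (loops n r ×ˢ loops n r).filter fun p =>
    (∀ i, 2 ≤ multiplicity (pairLabel p) i) ∧ ∃ i j, label p.1 i = label p.2 j

lemma card_labels_le_of_mem_linkedLoopPairs {p : (Fin (r + 1) → Fin n) × (Fin (r + 1) → Fin n)}
    (hp : p ∈ linkedLoopPairs n r) : (Finset.univ.image (pairLabel p)).card ≤ r := by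
  have hcard := two_mul_card_image_le (Finset.mem_filter.1 hp).2.1
  rw [Fintype.card_sum, Fintype.card_fin] at hcard
  omega

lemma sum_steps_filter_label_eq {p : (Fin (r + 1) → Fin n) × (Fin (r + 1) → Fin n)} {i j : Fin r}
    (hij : label p.1 i = label p.2 j) (hmult : multiplicity (pairLabel p) (Sum.inl i) = 2) :
    ∑ k with label p.1 k = label p.1 i, steps p.1 k = steps p.1 i := by
  have hadd : (Finset.univ.filter fun k => label p.1 k = label p.1 i).card +
      (Finset.univ.filter fun k => label p.2 k = label p.1 i).card = 2 := by
    unfold multiplicity at hmult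
    rw [← hmult, Finset.card_filter, Finset.card_filter, Finset.card_filter, Fintype.sum_sum_type]
    rfl
  have hpos : 0 < (Finset.univ.filter fun k => label p.2 k = label p.1 i).card :=
    Finset.card_pos.2 ⟨j, by simp [hij]⟩
  have hsingle : (Finset.univ.filter fun k => label p.1 k = label p.1 i) = {i} :=
    (Finset.eq_of_subset_of_card_le (by simp) (by rw [Finset.card_singleton]; omega)).symm
  rw [hsingle, Finset.sum_singleton]

/-- When a linked pair has as many labels as possible, every label occurs twice, so a shared label
occurs once in the first loop and can be recovered from the equation of that loop. -/
lemma exists_label_of_mem_linkedLoopPairs {p : (Fin (r + 1) → Fin n) × (Fin (r + 1) → Fin n)}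
    (hp : p ∈ linkedLoopPairs n r) (hr : r ≤ (nonzeroLabels (pairSteps p)).card) :
    ∃ v : ℕ, ((nonzeroLabels (pairSteps p)).erase v).card ≤ r - 1 ∧
      ∑ i ∈ Finset.univ.map Function.Embedding.inl with (pairSteps p i).natAbs = v,
        pairSteps p i ≠ 0 := by
  have hle := card_labels_le_of_mem_linkedLoopPairs hp
  obtain ⟨-, hmult, i, j, hij⟩ := Finset.mem_filter.1 hp
  have heq : nonzeroLabels (pairSteps p) = Finset.univ.image (pairLabel p) :=
    Finset.eq_of_subset_of_card_le (nonzeroLabels_pairSteps_subset p) (hle.trans hr)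
  have hmult₂ : ∀ i, multiplicity (pairLabel p) i = 2 := by
    by_contra! hcon
    have hlt := two_mul_card_image_lt hmult hcon
    rw [Fintype.card_sum, Fintype.card_fin, ← heq] at hlt
    omega
  have hmem : label p.1 i ∈ nonzeroLabels (pairSteps p) := by
    rw [heq]
    exact Finset.mem_image_of_mem (pairLabel p) (Finset.mem_univ (Sum.inl i))
  refine ⟨label p.1 i, ?_, ?_⟩
  · rw [Finset.card_erase_of_mem hmem, heq]
    omega
  · rw [Finset.sum_filter, Finset.sum_map, ← Finset.sum_filter]
    refine (sum_steps_filter_label_eq hij (hmult₂ _)).trans_ne fun h0 => ?_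
    exact (Finset.mem_erase.1 hmem).1 (Int.natAbs_eq_zero.2 h0)

lemma card_linkedLoopPairs_le (hn : 0 < n) :
    (linkedLoopPairs n r).card ≤ 2 * (6 * r) ^ (2 * r) * n ^ (r + 1) := by
  rcases r with _ | q
  · have hempty : linkedLoopPairs n 0 = ∅ :=
      Finset.filter_eq_empty_iff.2 fun p _ ⟨_, i, _⟩ => i.elim0
    simp [hempty]
  set few := (linkedLoopPairs n (q + 1)).filter fun p => (nonzeroLabels (pairSteps p)).card ≤ q
  set many := (linkedLoopPairs n (q + 1)).filter fun p => ¬(nonzeroLabels (pairSteps p)).card ≤ q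
  have hI : Fintype.card (Fin (q + 1) ⊕ Fin (q + 1)) = 2 * (q + 1) := by
    rw [Fintype.card_sum, Fintype.card_fin, two_mul]
  have hfew : (few.image pairSteps).card ≤ (2 * q + 1) ^ (2 * (q + 1)) * n ^ q := by
    rw [← hI]
    refine card_le_of_card_nonzeroLabels_le hn ?_ ?_ <;> simp only [Finset.forall_mem_image]
    · exact fun p _ => natAbs_pairSteps_lt p
    · exact fun p hp => (Finset.mem_filter.1 hp).2
  have hmany : (many.image pairSteps).card ≤ (6 * q + 3) ^ (2 * (q + 1)) * n ^ q := by
    rw [← hI]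
    refine card_le_of_card_nonzeroLabels_erase_le hn
      (J := Finset.univ.map Function.Embedding.inl) ?_ ?_ ?_ <;>
      simp only [Finset.forall_mem_image]
    · exact fun p _ => natAbs_pairSteps_lt p
    · intro p hp
      have hloops := Finset.mem_product.1 (Finset.mem_filter.1 (Finset.mem_filter.1 hp).1).1
      rw [Finset.sum_map]
      exact sum_steps_eq_zero hloops.1
    · intro p hp
      obtain ⟨hp, hcard⟩ := Finset.mem_filter.1 hp
      exact exists_label_of_mem_linkedLoopPairs hp (not_le.1 hcard)
  calc (linkedLoopPairs n (q + 1)).card = few.card + many.card :=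
        (Finset.card_filter_add_card_filter_not _).symm
    _ ≤ n ^ 2 * ((2 * q + 1) ^ (2 * (q + 1)) * n ^ q) +
          n ^ 2 * ((6 * q + 3) ^ (2 * (q + 1)) * n ^ q) :=
        add_le_add ((card_path_pairs_le _).trans (Nat.mul_le_mul_left _ hfew))
          ((card_path_pairs_le _).trans (Nat.mul_le_mul_left _ hmany))
    _ = ((2 * q + 1) ^ (2 * (q + 1)) + (6 * q + 3) ^ (2 * (q + 1))) * n ^ (q + 1 + 1) := by ring
    _ ≤ ((6 * (q + 1)) ^ (2 * (q + 1)) + (6 * (q + 1)) ^ (2 * (q + 1))) * n ^ (q + 1 + 1) := by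
        gcongr <;> omega
    _ = 2 * (6 * (q + 1)) ^ (2 * (q + 1)) * n ^ (q + 1 + 1) := by ring

end LinkedLoops

section PairLoops

/-- The loops in which every label occurs exactly twice. They carry the whole expected trace, up to
lower order terms. -/
def pairLoops (n r : ℕ) : Finset (Fin (r + 1) → Fin n) :=
  (loops n r).filter fun x => ∀ i, multiplicity (label x) i = 2

/-- The loops without isolated label that are not pair loops. -/
def degenerateLoops (n r : ℕ) : Finset (Fin (r + 1) → Fin n) :=
  (loops n r).filter fun x =>
    (∀ i, 2 ≤ multiplicity (label x) i) ∧ ¬∀ i, multiplicity (label x) i = 2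

lemma pairLoops_eq_empty_of_odd {n r : ℕ} (hr : Odd r) : pairLoops n r = ∅ := by
  refine Finset.filter_eq_empty_iff.2 fun x _ hx => Nat.not_even_iff_odd.2 hr ?_
  have hcard := two_mul_card_image_eq hx
  rw [Fintype.card_fin] at hcard
  exact even_iff_two_dvd.2 ⟨_, hcard.symm⟩

lemma card_degenerateLoops_le {n : ℕ} (hn : 0 < n) (r : ℕ) :
    (degenerateLoops n r).card ≤ (2 * r + 1) ^ r * n ^ ((r + 1) / 2) := by
  have hlabels : ∀ x ∈ degenerateLoops n r, 2 * (Finset.univ.image (label x)).card < r := by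
    intro x hx
    obtain ⟨-, hmult, hne⟩ := Finset.mem_filter.1 hx
    simpa only [Fintype.card_fin] using two_mul_card_image_lt hmult (not_forall.1 hne)
  rcases (degenerateLoops n r).eq_empty_or_nonempty with hempty | ⟨x, hx⟩
  · simp [hempty]
  have hr : 0 < r := (Nat.zero_le _).trans_lt (hlabels x hx)
  calc (degenerateLoops n r).card ≤ (2 * ((r - 1) / 2) + 1) ^ r * n ^ ((r - 1) / 2 + 1) :=
        card_paths_le_of_card_labels_le hn fun x hx => by have := hlabels x hx; omega
    _ ≤ (2 * r + 1) ^ r * n ^ ((r - 1) / 2 + 1) := by gcongr; omega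
    _ = (2 * r + 1) ^ r * n ^ ((r + 1) / 2) := by congr 2; omega

end PairLoops

namespace IsBoundedNoise

variable {Ω : Type*} [MeasurableSpace Ω] {P : Measure Ω} [IsProbabilityMeasure P]
  {Y : ℕ → Ω → ℝ} {C : ℝ} {I I' : Type*} [Fintype I] [Fintype I']

lemma abs_integral_prod_sub_le (h : IsBoundedNoise Y P C) {r : ℕ} (l : Fin r → ℕ) :
    |∫ ω, ∏ i, Y (l i) ω ∂P - if ∀ i, multiplicity l i = 2 then 1 else 0| ≤
      if (∀ i, 2 ≤ multiplicity l i) ∧ ¬∀ i, multiplicity l i = 2 then C ^ r else 0 := by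
  by_cases htwo : ∀ i, multiplicity l i = 2
  · simp [h.integral_prod_eq_one htwo, htwo]
  rw [if_neg htwo, sub_zero]
  by_cases hone : ∃ i, multiplicity l i = 1
  · rw [h.integral_prod_eq_zero hone, abs_zero]
    have := h.bound_nonneg
    positivity
  · rw [if_pos ⟨two_le_multiplicity hone, htwo⟩]
    exact (h.abs_integral_prod_le l).trans_eq (by rw [Fintype.card_fin])

lemma abs_integral_trace_sub_le (h : IsBoundedNoise Y P C) {n : ℕ} (hn : 0 < n) (r : ℕ) :
    |∫ ω, (toeplitz n (fun k => Y k ω) ^ r).trace ∂P - (pairLoops n r).card| ≤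
      C ^ r * (2 * r + 1) ^ r * n ^ ((r + 1) / 2) := by
  have hcard : ((degenerateLoops n r).card : ℝ) ≤ (2 * r + 1) ^ r * n ^ ((r + 1) / 2) := by
    exact_mod_cast card_degenerateLoops_le hn r
  simp only [trace_toeplitz_pow]
  rw [integral_finsetSum _ fun x _ => h.integrable_prod _, pairLoops, Finset.card_filter,
    Nat.cast_sum, ← Finset.sum_sub_distrib]
  calc |∑ x ∈ loops n r, (∫ ω, ∏ i, Y (label x i) ω ∂P -
          ((if ∀ i, multiplicity (label x) i = 2 then 1 else 0 : ℕ) : ℝ))|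
      ≤ ∑ x ∈ loops n r, if (∀ i, 2 ≤ multiplicity (label x) i) ∧
          ¬∀ i, multiplicity (label x) i = 2 then C ^ r else 0 :=
        (Finset.abs_sum_le_sum_abs _ _).trans (Finset.sum_le_sum fun x _ => by
          simpa only [Nat.cast_ite, Nat.cast_one, Nat.cast_zero] using
            h.abs_integral_prod_sub_le (label x))
    _ = C ^ r * (degenerateLoops n r).card := by
        rw [← Finset.sum_filter, Finset.sum_const, nsmul_eq_mul, mul_comm, degenerateLoops]
    _ ≤ C ^ r * (2 * r + 1) ^ r * n ^ ((r + 1) / 2) := by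
        rw [mul_assoc]
        exact mul_le_mul_of_nonneg_left hcard (pow_nonneg h.bound_nonneg r)

lemma covariance_prod (h : IsBoundedNoise Y P C) (l : I → ℕ) (l' : I' → ℕ) :
    cov[fun ω => ∏ i, Y (l i) ω, fun ω => ∏ i, Y (l' i) ω; P] =
      ∫ ω, ∏ i, Y (Sum.elim l l' i) ω ∂P -
        (∫ ω, ∏ i, Y (l i) ω ∂P) * ∫ ω, ∏ i, Y (l' i) ω ∂P := by
  simpa only [Fintype.prod_sum_type, Sum.elim_inl, Sum.elim_inr, Pi.mul_apply] using
    covariance_eq_sub (h.memLp_prod l) (h.memLp_prod l')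

lemma covariance_prod_eq_zero_of_isolated (h : IsBoundedNoise Y P C) {l : I → ℕ} {l' : I' → ℕ}
    (hl : ∃ i, multiplicity (Sum.elim l l') i = 1) :
    cov[fun ω => ∏ i, Y (l i) ω, fun ω => ∏ i, Y (l' i) ω; P] = 0 := by
  rw [h.covariance_prod, h.integral_prod_eq_zero hl]
  obtain ⟨i | i, hi⟩ := hl
  · have hone : multiplicity l i = 1 :=
      le_antisymm ((multiplicity_le_inl l l' i).trans hi.le) (multiplicity_pos l i)
    rw [h.integral_prod_eq_zero ⟨i, hone⟩, zero_mul, sub_zero]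
  · have hone : multiplicity l' i = 1 :=
      le_antisymm ((multiplicity_le_inr l l' i).trans hi.le) (multiplicity_pos l' i)
    rw [h.integral_prod_eq_zero ⟨i, hone⟩, mul_zero, sub_zero]

lemma covariance_prod_le (h : IsBoundedNoise Y P C) (l : I → ℕ) (l' : I' → ℕ) :
    cov[fun ω => ∏ i, Y (l i) ω, fun ω => ∏ i, Y (l' i) ω; P] ≤
      2 * C ^ (Fintype.card I + Fintype.card I') := by
  have hjoint := h.abs_integral_prod_le (Sum.elim l l')
  rw [Fintype.card_sum] at hjoint
  have hprod : |(∫ ω, ∏ i, Y (l i) ω ∂P) * ∫ ω, ∏ i, Y (l' i) ω ∂P| ≤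
      C ^ (Fintype.card I + Fintype.card I') := by
    rw [abs_mul, pow_add]
    exact mul_le_mul (h.abs_integral_prod_le l) (h.abs_integral_prod_le l') (abs_nonneg _)
      (pow_nonneg h.bound_nonneg _)
  rw [h.covariance_prod]
  linarith [le_of_abs_le hjoint, neg_le_of_abs_le hprod]

lemma covariance_loops_le (h : IsBoundedNoise Y P C) {n r : ℕ}
    (p : (Fin (r + 1) → Fin n) × (Fin (r + 1) → Fin n)) :
    cov[fun ω => ∏ i, Y (label p.1 i) ω, fun ω => ∏ i, Y (label p.2 i) ω; P] ≤
      if (∀ i, 2 ≤ multiplicity (pairLabel p) i) ∧ ∃ i j, label p.1 i = label p.2 j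
        then 2 * C ^ (2 * r) else 0 := by
  have hnonneg : 0 ≤ 2 * C ^ (2 * r) := by
    have := h.bound_nonneg
    positivity
  by_cases hlink : ∃ i j, label p.1 i = label p.2 j
  swap
  · push Not at hlink
    rw [(h.indepFun_prod hlink).covariance_eq_zero (h.memLp_prod _) (h.memLp_prod _)]
    positivity
  by_cases hone : ∃ i, multiplicity (pairLabel p) i = 1
  · rw [h.covariance_prod_eq_zero_of_isolated hone]
    positivity
  · rw [if_pos ⟨two_le_multiplicity hone, hlink⟩]
    simpa only [Fintype.card_fin, ← two_mul] using h.covariance_prod_le (label p.1) (label p.2)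

lemma memLp_trace (h : IsBoundedNoise Y P C) (n r : ℕ) :
    MemLp (fun ω => (toeplitz n (fun k => Y k ω) ^ r).trace) 2 P := by
  simp only [trace_toeplitz_pow]
  exact memLp_finsetSum _ fun x _ => h.memLp_prod _

lemma variance_trace_le (h : IsBoundedNoise Y P C) {n : ℕ} (hn : 0 < n) (r : ℕ) :
    Var[fun ω => (toeplitz n (fun k => Y k ω) ^ r).trace; P] ≤
      2 * C ^ (2 * r) * (2 * (6 * r) ^ (2 * r)) * n ^ (r + 1) := by
  have hcard : ((linkedLoopPairs n r).card : ℝ) ≤ 2 * (6 * r) ^ (2 * r) * n ^ (r + 1) := by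
    exact_mod_cast card_linkedLoopPairs_le hn
  simp only [trace_toeplitz_pow]
  calc Var[fun ω => ∑ x ∈ loops n r, ∏ i, Y (label x i) ω; P]
      = ∑ p ∈ loops n r ×ˢ loops n r,
          cov[fun ω => ∏ i, Y (label p.1 i) ω, fun ω => ∏ i, Y (label p.2 i) ω; P] := by
        rw [variance_fun_sum' fun x _ => h.memLp_prod (label x), Finset.sum_product]
    _ ≤ 2 * C ^ (2 * r) * (linkedLoopPairs n r).card := by
        refine (Finset.sum_le_sum fun p _ => h.covariance_loops_le p).trans_eq ?_
        rw [← Finset.sum_filter, Finset.sum_const, nsmul_eq_mul, mul_comm, linkedLoopPairs]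
    _ ≤ 2 * C ^ (2 * r) * (2 * (6 * r) ^ (2 * r)) * n ^ (r + 1) := by
        rw [mul_assoc _ (2 * (6 * (r : ℝ)) ^ (2 * r))]
        have := h.bound_nonneg
        gcongr

end IsBoundedNoise

section TraceMoments

lemma integral_pow_toeplitzMeasure (n : ℕ) [NeZero n] (x : ℕ → ℝ) (r : ℕ) :
    ∫ t, t ^ r ∂(toeplitzMeasure n x : Measure ℝ) =
      (n * √(n : ℝ) ^ r)⁻¹ * (toeplitz n x ^ r).trace := by
  rw [integral_pow_spectralMeasure, scaledToeplitz, smul_pow, Matrix.trace_smul, smul_eq_mul,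
    mul_inv, inv_pow, mul_assoc]

/-- The sequence of moments whose term of order `2k` is `M k` and whose odd terms vanish. -/
def evenMoments (M : ℕ → ℝ) (r : ℕ) : ℝ := if Even r then M (r / 2) else 0

lemma tendsto_inv_mul_card_pairLoops {M : ℕ → ℝ}
    (hM : ∀ k, Tendsto (fun n : ℕ => ((pairLoops (n + 1) (2 * k)).card : ℝ) / (n + 1 : ℕ) ^ (k + 1))
      atTop (𝓝 (M k))) (r : ℕ) :
    Tendsto (fun n : ℕ => (((n + 1 : ℕ) : ℝ) * √((n + 1 : ℕ) : ℝ) ^ r)⁻¹ *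
      (pairLoops (n + 1) r).card) atTop (𝓝 (evenMoments M r)) := by
  rcases Nat.even_or_odd' r with ⟨k, rfl | rfl⟩
  · have heven : evenMoments M (2 * k) = M k := by simp [evenMoments]
    rw [heven]
    refine (hM k).congr fun n => ?_
    rw [pow_mul, Real.sq_sqrt (Nat.cast_nonneg _), ← pow_succ', div_eq_inv_mul]
  · have hodd : Odd (2 * k + 1) := odd_two_mul_add_one k
    simp [evenMoments, Nat.not_even_iff_odd.2 hodd, pairLoops_eq_empty_of_odd hodd]

namespace IsBoundedNoise

variable {Ω : Type*} [MeasurableSpace Ω] {P : Measure Ω} [IsProbabilityMeasure P]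
  {Y : ℕ → Ω → ℝ} {C : ℝ}

lemma abs_inv_mul_integral_trace_sub_le (h : IsBoundedNoise Y P C) {n : ℕ} (hn : 0 < n) (r : ℕ) :
    |(n * √(n : ℝ) ^ r)⁻¹ *
        (∫ ω, (toeplitz n (fun k => Y k ω) ^ r).trace ∂P - (pairLoops n r).card)| ≤
      C ^ r * (2 * r + 1) ^ r * (√(n : ℝ))⁻¹ := by
  have hC := h.bound_nonneg
  set a := √(n : ℝ)
  have hone : 1 ≤ a := Real.one_le_sqrt.2 (Nat.one_le_cast.2 hn)
  have hsq : (n : ℝ) = a ^ 2 := (Real.sq_sqrt n.cast_nonneg).symm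
  have htrace := h.abs_integral_trace_sub_le hn r
  rw [abs_mul, abs_of_nonneg (by positivity)]
  calc (n * a ^ r)⁻¹ * |∫ ω, (toeplitz n (fun k => Y k ω) ^ r).trace ∂P - (pairLoops n r).card|
      ≤ (n * a ^ r)⁻¹ * (C ^ r * (2 * r + 1) ^ r * n ^ ((r + 1) / 2)) := by gcongr
    _ = (a ^ 2 * a ^ r)⁻¹ * (C ^ r * (2 * r + 1) ^ r * a ^ (2 * ((r + 1) / 2))) := by
        rw [hsq, pow_mul]
    _ ≤ (a ^ 2 * a ^ r)⁻¹ * (C ^ r * (2 * r + 1) ^ r * a ^ (r + 1)) := by gcongr; omega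
    _ = C ^ r * (2 * r + 1) ^ r * a⁻¹ := by field_simp; ring

lemma tendsto_integral_moment (h : IsBoundedNoise Y P C) {M : ℕ → ℝ}
    (hM : ∀ k, Tendsto (fun n : ℕ => ((pairLoops (n + 1) (2 * k)).card : ℝ) / (n + 1 : ℕ) ^ (k + 1))
      atTop (𝓝 (M k))) (r : ℕ) :
    Tendsto (fun n : ℕ => ∫ ω, ∫ t, t ^ r ∂(toeplitzMeasure (n + 1) fun k => Y k ω : Measure ℝ) ∂P)
      atTop (𝓝 (evenMoments M r)) := by
  have hsqrt : Tendsto (fun n : ℕ => √((n + 1 : ℕ) : ℝ)) atTop atTop :=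
    Real.tendsto_sqrt_atTop.comp (tendsto_natCast_atTop_atTop.comp (tendsto_add_atTop_nat 1))
  have hbound := (tendsto_inv_atTop_zero.comp hsqrt).const_mul (C ^ r * (2 * r + 1) ^ r)
  rw [mul_zero] at hbound
  have herror : Tendsto (fun n : ℕ => (((n + 1 : ℕ) : ℝ) * √((n + 1 : ℕ) : ℝ) ^ r)⁻¹ *
      (∫ ω, (toeplitz (n + 1) (fun k => Y k ω) ^ r).trace ∂P - (pairLoops (n + 1) r).card))
      atTop (𝓝 0) :=
    squeeze_zero_norm (fun n => h.abs_inv_mul_integral_trace_sub_le n.succ_pos r) hbound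
  have hsum := herror.add (tendsto_inv_mul_card_pairLoops hM r)
  rw [zero_add] at hsum
  refine hsum.congr fun n => ?_
  simp only [integral_pow_toeplitzMeasure, integral_const_mul]
  ring

lemma variance_moment_le (h : IsBoundedNoise Y P C) (n r : ℕ) [NeZero n] :
    Var[fun ω => ∫ t, t ^ r ∂(toeplitzMeasure n fun k => Y k ω : Measure ℝ); P] ≤
      2 * C ^ (2 * r) * (2 * (6 * r) ^ (2 * r)) / n := by
  have hn : (0 : ℝ) < n := Nat.cast_pos.2 (NeZero.pos n)
  have htrace := h.variance_trace_le (NeZero.pos n) r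
  simp only [integral_pow_toeplitzMeasure]
  rw [variance_const_mul]
  calc (n * √(n : ℝ) ^ r)⁻¹ ^ 2 * Var[fun ω => (toeplitz n (fun k => Y k ω) ^ r).trace; P]
      ≤ (n * √(n : ℝ) ^ r)⁻¹ ^ 2 * (2 * C ^ (2 * r) * (2 * (6 * r) ^ (2 * r)) * n ^ (r + 1)) := by
        gcongr
    _ = (n ^ 2 * n ^ r : ℝ)⁻¹ * (2 * C ^ (2 * r) * (2 * (6 * r) ^ (2 * r)) * n ^ (r + 1)) := by
        rw [inv_pow, mul_pow, pow_right_comm, Real.sq_sqrt hn.le]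
    _ = 2 * C ^ (2 * r) * (2 * (6 * r) ^ (2 * r)) / n := by field_simp; ring

end IsBoundedNoise

variable {Ω : Type*} [MeasurableSpace Ω] {P : Measure Ω} [IsProbabilityMeasure P]

lemma ae_tendsto_sub_integral_of_summable_variance {f : ℕ → Ω → ℝ} (hf : ∀ m, MemLp (f m) 2 P)
    (hsum : Summable fun m => Var[f m; P]) :
    ∀ᵐ ω ∂P, Tendsto (fun m => f m ω - ∫ ω', f m ω' ∂P) atTop (𝓝 0) := by
  have hmeas : ∀ m, AEMeasurable (fun ω => ‖f m ω - ∫ ω', f m ω' ∂P‖ₑ ^ 2) P := fun m =>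
    (((hf m).aestronglyMeasurable.aemeasurable.sub_const _).enorm).pow_const 2
  have hlintegral : ∫⁻ ω, ∑' m, ‖f m ω - ∫ ω', f m ω' ∂P‖ₑ ^ 2 ∂P ≠ ∞ := by
    rw [lintegral_tsum hmeas]
    simpa only [ofReal_variance (hf _), evariance] using hsum.tsum_ofReal_ne_top
  filter_upwards [ae_lt_top' (AEMeasurable.tsum hmeas) hlintegral] with ω hω
  have hsq := ENNReal.tendsto_atTop_zero_of_tsum_ne_top hω.ne
  refine tendsto_zero_iff_enorm_tendsto_zero.2 ?_
  simpa only [ENNReal.pow_rpow_inv_natCast two_ne_zero,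
    ENNReal.zero_rpow_of_pos (inv_pos.2 (Nat.cast_pos.2 two_pos))] using
    hsq.ennrpow_const ((2 : ℕ) : ℝ)⁻¹

/-- The variances are `O(1 / n)`, hence summable along the squares. -/
lemma IsBoundedNoise.ae_tendsto_moments {Y : ℕ → Ω → ℝ} {C : ℝ} (h : IsBoundedNoise Y P C)
    {M : ℕ → ℝ}
    (hM : ∀ k, Tendsto (fun n : ℕ => ((pairLoops (n + 1) (2 * k)).card : ℝ) / (n + 1 : ℕ) ^ (k + 1))
      atTop (𝓝 (M k))) :
    ∀ᵐ ω ∂P, ∀ r, Tendsto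
      (fun m : ℕ => ∫ t, t ^ r ∂(toeplitzMeasure ((m + 1) ^ 2) fun k => Y k ω : Measure ℝ))
      atTop (𝓝 (evenMoments M r)) := by
  refine ae_all_iff.2 fun r => ?_
  set moment : ℕ → Ω → ℝ := fun m ω =>
    ∫ t, t ^ r ∂(toeplitzMeasure ((m + 1) ^ 2) fun k => Y k ω : Measure ℝ)
  have hmemLp : ∀ m, MemLp (moment m) 2 P := fun m => by
    simpa only [moment, integral_pow_toeplitzMeasure] using (h.memLp_trace _ r).const_mul _
  have hsummable : Summable fun m => Var[moment m; P] := by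
    refine Summable.of_nonneg_of_le (fun m => variance_nonneg _ P)
      (fun m => h.variance_moment_le ((m + 1) ^ 2) r) ?_
    simpa only [div_eq_mul_inv, one_mul, Nat.cast_pow] using
      ((summable_nat_add_iff 1).2 (Real.summable_one_div_nat_pow.2 one_lt_two)).mul_left _
  have hmean : Tendsto (fun m => ∫ ω, moment m ω ∂P) atTop (𝓝 (evenMoments M r)) := by
    have hsquares : Tendsto (fun m : ℕ => m ^ 2 + 2 * m) atTop atTop :=
      tendsto_atTop_mono (fun m => by rw [id]; omega) tendsto_id
    refine ((h.tendsto_integral_moment hM r).comp hsquares).congr fun m => ?_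
    have hsq : m ^ 2 + 2 * m + 1 = (m + 1) ^ 2 := by ring
    simp only [Function.comp_apply, moment, integral_pow_toeplitzMeasure]
    rw [hsq]
  filter_upwards [ae_tendsto_sub_integral_of_summable_variance hmemLp hsummable] with ω hω
  simpa using hω.add hmean

end TraceMoments

section Words

variable {k : ℕ} {w : Fin (2 * k) → Fin k} {fst snd : Fin k → Fin (2 * k)}

/-- `fst a < snd a` are the two occurrences of the letter `a` in the partition word `w`; the first
occurrences are in alphabetic order. -/
structure IsOccurrences (w : Fin (2 * k) → Fin k) (fst snd : Fin k → Fin (2 * k)) : Prop where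
  iff : ∀ i a, w i = a ↔ i = fst a ∨ i = snd a
  lt : ∀ a, fst a < snd a
  mono : StrictMono fst

lemma IsPartitionWord.exists_occurrences (hw : IsPartitionWord w) :
    ∃ fst snd, IsOccurrences w fst snd := by
  have exists_positions (a : Fin k) : ∃ p : Fin (2 * k) × Fin (2 * k), p.1 < p.2 ∧
      ∀ i, w i = a ↔ i = p.1 ∨ i = p.2 := by
    obtain ⟨i, j, hij, hpair⟩ := Finset.card_eq_two.1 (hw.1 a)
    have hmem (l : Fin (2 * k)) : w l = a ↔ l = i ∨ l = j := by
      simpa using Finset.ext_iff.1 hpair l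
    rcases lt_or_gt_of_ne hij with hlt | hgt
    · exact ⟨(i, j), hlt, hmem⟩
    · exact ⟨(j, i), hgt, fun l => by rw [hmem l, or_comm]⟩
  choose p hlt hp using exists_positions
  refine ⟨fun a => (p a).1, fun a => (p a).2, fun i a => hp a i, hlt, fun a b hab => ?_⟩
  obtain ⟨i, hi, hib⟩ := hw.2 a b hab
  have hle : (p a).1 ≤ i := by
    rcases (hp a i).1 hi with rfl | rfl
    · exact le_rfl
    · exact (hlt a).le
  exact hle.trans_lt (hib _ ((hp b _).2 (Or.inl rfl)))

namespace IsOccurrences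

lemma apply_fst (h : IsOccurrences w fst snd) (a : Fin k) : w (fst a) = a :=
  (h.iff _ _).2 (Or.inl rfl)

lemma apply_snd (h : IsOccurrences w fst snd) (a : Fin k) : w (snd a) = a :=
  (h.iff _ _).2 (Or.inr rfl)

lemma eq_fst_or_eq_snd (h : IsOccurrences w fst snd) (i : Fin (2 * k)) :
    i = fst (w i) ∨ i = snd (w i) :=
  (h.iff i (w i)).1 rfl

lemma first_iff (h : IsOccurrences w fst snd) (i : Fin (2 * k)) :
    (∀ j, w j = w i → i ≤ j) ↔ i = fst (w i) := by
  constructor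
  · intro hi
    refine (h.eq_fst_or_eq_snd i).resolve_right fun hsnd => ?_
    exact (h.lt (w i)).not_ge (hsnd ▸ hi _ (h.apply_fst _))
  · intro hi j hj
    rw [hi]
    rcases (h.iff j (w i)).1 hj with rfl | rfl
    · exact le_rfl
    · exact (h.lt _).le

lemma eq_fst_and_eq_snd_of_lt (h : IsOccurrences w fst snd) {i j : Fin (2 * k)} (hij : i < j)
    (hw : w i = w j) : i = fst (w i) ∧ j = snd (w i) := by
  have hi : i = fst (w i) := by
    refine (h.eq_fst_or_eq_snd i).resolve_right fun hi => ?_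
    rcases (h.iff j (w i)).1 hw.symm with hj | hj
    · exact (h.lt (w i)).not_gt (hi ▸ hj ▸ hij)
    · exact hij.ne (hi.trans hj.symm)
  exact ⟨hi, ((h.iff j (w i)).1 hw.symm).resolve_left fun hj => hij.ne (hi.trans hj.symm)⟩

end IsOccurrences

/-- The letter `b` has occurred exactly once among the first `t` positions. -/
def IsPending (fst snd : Fin k → Fin (2 * k)) (t : ℕ) (b : Fin k) : Prop :=
  (fst b : ℕ) < t ∧ t ≤ (snd b : ℕ)

instance (t : ℕ) : DecidablePred (IsPending fst snd t) := fun _ =>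
  inferInstanceAs (Decidable (_ ∧ _))

/-- The increment of the unknowns across the first occurrence of a letter, as a linear form in the
undetermined variables. -/
noncomputable def increment (fst snd : Fin k → Fin (2 * k)) (a : Fin k) : Fin (k + 1) → ℤ :=
  Pi.single a.succ 1 - Pi.single 0 1 - ∑ b : Fin k,
    if _h : b < a then (if IsPending fst snd (fst a) b then increment fst snd b else 0) else 0
termination_by a.val
decreasing_by exact _h

/-- The unknown `x_t`, as a linear form in the undetermined variables: closed letters contribute
opposite increments, so that only the pending ones remain. -/
noncomputable def variableForm (fst snd : Fin k → Fin (2 * k)) (t : ℕ) : Fin (k + 1) → ℤ :=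
  Pi.single 0 1 + ∑ b ∈ Finset.univ.filter (IsPending fst snd t), increment fst snd b

lemma variableForm_zero : variableForm fst snd 0 = Pi.single 0 1 := by
  rw [variableForm, Finset.filter_false_of_mem, Finset.sum_empty, add_zero]
  exact fun b _ hb => absurd hb.1 (Nat.not_lt_zero _)

lemma abs_mul_single_le_one {ι : Type*} [DecidableEq ι] {ε : ℤ} (hε : ε = 0 ∨ ε = 1) (d c : ι) :
    |ε * (Pi.single d 1 : ι → ℤ) c| ≤ 1 := by
  rw [Pi.single_apply]
  rcases hε with rfl | rfl <;> split_ifs <;> simp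

namespace IsOccurrences

lemma increment_eq (h : IsOccurrences w fst snd) (a : Fin k) :
    increment fst snd a = Pi.single a.succ 1 - variableForm fst snd (fst a) := by
  rw [increment, variableForm, Finset.sum_filter, ← sub_sub]
  congr 1
  refine Finset.sum_congr rfl fun b _ => ?_
  by_cases hb : b < a
  · rw [dif_pos hb]
  · rw [dif_neg hb, if_neg]
    exact fun ho => hb (h.mono.lt_iff_lt.1 ho.1)

lemma isPending_succ_iff (h : IsOccurrences w fst snd) (i : Fin (2 * k)) {b : Fin k}
    (hb : b ≠ w i) : IsPending fst snd (i + 1) b ↔ IsPending fst snd i b := by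
  have hfst : (fst b : ℕ) ≠ i := fun he => hb (by rw [← Fin.ext he, h.apply_fst])
  have hsnd : (snd b : ℕ) ≠ i := fun he => hb (by rw [← Fin.ext he, h.apply_snd])
  simp only [IsPending]
  omega

lemma isPending_fst (h : IsOccurrences w fst snd) (a : Fin k) :
    ¬ IsPending fst snd (fst a) a ∧ IsPending fst snd (fst a + 1) a := by
  have := Fin.lt_def.1 (h.lt a)
  simp only [IsPending]
  omega

lemma isPending_snd (h : IsOccurrences w fst snd) (a : Fin k) :
    IsPending fst snd (snd a) a ∧ ¬ IsPending fst snd (snd a + 1) a := by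
  have := Fin.lt_def.1 (h.lt a)
  simp only [IsPending]
  omega

lemma eq_fst_of_isPending_succ (h : IsOccurrences w fst snd) {i : Fin (2 * k)}
    (hi : IsPending fst snd (i + 1) (w i)) : i = fst (w i) := by
  refine (h.eq_fst_or_eq_snd i).resolve_right fun hsnd => (h.isPending_snd (w i)).2 ?_
  rwa [← hsnd]

lemma variableForm_succ_sub (h : IsOccurrences w fst snd) (i : Fin (2 * k)) :
    variableForm fst snd (i + 1) - variableForm fst snd i =
      if i = fst (w i) then increment fst snd (w i) else -increment fst snd (w i) := by
  have only_current_letter : variableForm fst snd (i + 1) - variableForm fst snd i =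
      (if IsPending fst snd (i + 1) (w i) then increment fst snd (w i) else 0) -
        (if IsPending fst snd i (w i) then increment fst snd (w i) else 0) := by
    rw [variableForm, variableForm, add_sub_add_left_eq_sub, Finset.sum_filter, Finset.sum_filter,
      ← Finset.sum_sub_distrib]
    refine Finset.sum_eq_single (w i) (fun b _ hb => ?_) (fun hn => absurd (Finset.mem_univ _) hn)
    simp only [h.isPending_succ_iff i hb, sub_self]
  rw [only_current_letter]
  rcases h.eq_fst_or_eq_snd i with hi | hi
  · obtain ⟨hbefore, hafter⟩ := h.isPending_fst (w i)
    rw [← hi] at hbefore hafter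
    rw [if_pos hafter, if_neg hbefore, if_pos hi, sub_zero]
  · obtain ⟨hbefore, hafter⟩ := h.isPending_snd (w i)
    have hne : i ≠ fst (w i) := fun hf => (h.lt (w i)).ne (hf.symm.trans hi)
    rw [← hi] at hbefore hafter
    rw [if_neg hafter, if_pos hbefore, if_neg hne, zero_sub]

lemma variableForm_fst_succ (h : IsOccurrences w fst snd) (a : Fin k) :
    variableForm fst snd (fst a + 1) = Pi.single a.succ 1 := by
  have := h.variableForm_succ_sub (fst a)
  rw [h.apply_fst, if_pos rfl, h.increment_eq, sub_eq_sub_iff_add_eq_add] at this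
  exact add_right_cancel this

lemma increment_apply_eq_zero (h : IsOccurrences w fst snd) (a : Fin k)
    (c : Fin (k + 1)) (hc : a.succ < c) : increment fst snd a c = 0 := by
  induction a using WellFoundedLT.induction with
  | _ a ih =>
    have hc_zero : c ≠ 0 := ne_of_gt ((Fin.succ_pos a).trans hc)
    rw [h.increment_eq, variableForm, Pi.sub_apply, Pi.add_apply, Finset.sum_apply,
      Pi.single_eq_of_ne hc_zero, Pi.single_eq_of_ne hc.ne', Finset.sum_eq_zero, add_zero,
      sub_zero]
    intro b hb
    have hba : b < a := h.mono.lt_iff_lt.1 (Finset.mem_filter.1 hb).2.1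
    exact ih b hba ((Fin.succ_lt_succ_iff.2 hba).trans hc)

lemma sum_increment (h : IsOccurrences w fst snd) (a : Fin k) :
    ∑ c, increment fst snd a c = 0 := by
  induction a using WellFoundedLT.induction with
  | _ a ih =>
    rw [h.increment_eq a]
    simp only [variableForm, Pi.sub_apply, Pi.add_apply, Finset.sum_apply,
      Finset.sum_sub_distrib, Finset.sum_add_distrib]
    rw [Finset.sum_comm, Finset.sum_eq_zero (s := Finset.univ.filter _)]
    · simp
    · exact fun b hb => ih b (h.mono.lt_iff_lt.1 (Finset.mem_filter.1 hb).2.1)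

lemma sum_variableForm (h : IsOccurrences w fst snd) (t : ℕ) :
    ∑ c, variableForm fst snd t c = 1 := by
  simp only [variableForm, Pi.add_apply, Finset.sum_apply, Finset.sum_add_distrib]
  rw [Finset.sum_comm, Finset.sum_eq_zero (s := Finset.univ.filter _)]
  · simp
  · exact fun b _ => h.sum_increment b

/-- Since `x_{fst a}` is `u_0` plus the increments of all pending letters, a subset sum of
increments that contains the newest letter is `u_{a+1}` minus the complementary subset sum. -/
lemma add_sum_increment_eq_sub (h : IsOccurrences w fst snd) (a : Fin k) {S : Finset (Fin k)}
    (hS : S ⊆ Finset.univ.filter (IsPending fst snd (fst a))) (ε : ℤ) (c : Fin (k + 1)) :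
    ε * (Pi.single 0 1 : Fin (k + 1) → ℤ) c +
        (increment fst snd a c + ∑ b ∈ S, increment fst snd b c) =
      (Pi.single a.succ 1 : Fin (k + 1) → ℤ) c -
        ((1 - ε) * (Pi.single 0 1 : Fin (k + 1) → ℤ) c +
          ∑ b ∈ Finset.univ.filter (IsPending fst snd (fst a)) \ S, increment fst snd b c) := by
  have hsplit := Finset.sum_sdiff (f := fun b => increment fst snd b c) hS
  simp only [h.increment_eq a, variableForm, Pi.sub_apply, Pi.add_apply, Finset.sum_apply]
  linear_combination hsplit

lemma abs_subset_sum_increment_le_one (h : IsOccurrences w fst snd) (t : ℕ)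
    (S : Finset (Fin k)) (hS : ∀ b ∈ S, IsPending fst snd t b) {ε : ℤ} (hε : ε = 0 ∨ ε = 1)
    (c : Fin (k + 1)) :
    |ε * (Pi.single 0 1 : Fin (k + 1) → ℤ) c + ∑ b ∈ S, increment fst snd b c| ≤ 1 := by
  induction t generalizing S ε with
  | zero =>
    rw [Finset.eq_empty_of_forall_notMem fun b hb => Nat.not_lt_zero _ (hS b hb).1]
    simpa using abs_mul_single_le_one hε 0 c
  | succ t ih =>
    rcases S.eq_empty_or_nonempty with rfl | ⟨b₀, hb₀⟩
    · simpa using abs_mul_single_le_one hε 0 c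
    obtain ⟨i, rfl⟩ : ∃ i : Fin (2 * k), (i : ℕ) = t :=
      ⟨⟨t, (Nat.lt_succ_self t).trans ((hS b₀ hb₀).2.trans_lt (snd b₀).2)⟩, rfl⟩
    have hpending (b : Fin k) (hb : b ∈ S) (hne : b ≠ w i) : IsPending fst snd i b :=
      (h.isPending_succ_iff i hne).1 (hS b hb)
    by_cases hmem : w i ∈ S
    swap
    · exact ih S (fun b hb => hpending b hb fun he => hmem (he ▸ hb)) hε
    have hi : i = fst (w i) := h.eq_fst_of_isPending_succ (hS _ hmem)
    have hsub : S.erase (w i) ⊆ Finset.univ.filter (IsPending fst snd (fst (w i))) := fun b hb =>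
      Finset.mem_filter.2 ⟨Finset.mem_univ _,
        hi ▸ hpending b (Finset.mem_of_mem_erase hb) (Finset.ne_of_mem_erase hb)⟩
    rw [← Finset.add_sum_erase S _ hmem, h.add_sum_increment_eq_sub (w i) hsub]
    by_cases hc : c = (w i).succ
    · rw [Finset.sum_eq_zero, hc, Pi.single_eq_same, Pi.single_eq_of_ne (Fin.succ_ne_zero _)]
      · simp
      · intro b hb
        refine h.increment_apply_eq_zero b c (hc ▸ Fin.succ_lt_succ_iff.2 ?_)
        exact h.mono.lt_iff_lt.1 (Finset.mem_filter.1 (Finset.mem_sdiff.1 hb).1).2.1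
    · rw [Pi.single_eq_of_ne hc, zero_sub, abs_neg]
      refine ih _ (fun b hb => ?_) (by omega)
      rw [hi]
      exact (Finset.mem_filter.1 (Finset.mem_sdiff.1 hb).1).2

lemma abs_variableForm_le_one (h : IsOccurrences w fst snd) (t : ℕ)
    (c : Fin (k + 1)) : |variableForm fst snd t c| ≤ 1 := by
  have := h.abs_subset_sum_increment_le_one t (Finset.univ.filter (IsPending fst snd t))
    (fun b hb => (Finset.mem_filter.1 hb).2) (Or.inr rfl) c
  simpa [variableForm, Finset.sum_apply] using this

end IsOccurrences

/-- The value at position `t` of the solution of the linear system with undetermined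
variables `u`. -/
noncomputable def solution (fst snd : Fin k → Fin (2 * k)) (u : Fin (k + 1) → ℝ) (t : ℕ) : ℝ :=
  ∑ c, (variableForm fst snd t c : ℝ) * u c

lemma solution_zero (u : Fin (k + 1) → ℝ) : solution fst snd u 0 = u 0 := by
  simp [solution, variableForm_zero, Pi.single_apply]

namespace IsOccurrences

lemma solution_fst_succ (h : IsOccurrences w fst snd) (u : Fin (k + 1) → ℝ)
    (a : Fin k) : solution fst snd u (fst a + 1) = u a.succ := by
  simp [solution, h.variableForm_fst_succ, Pi.single_apply]

lemma solution_snd_succ_sub (h : IsOccurrences w fst snd) (u : Fin (k + 1) → ℝ)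
    (a : Fin k) : solution fst snd u (snd a + 1) - solution fst snd u (snd a) =
      -(solution fst snd u (fst a + 1) - solution fst snd u (fst a)) := by
  have hfst := h.variableForm_succ_sub (fst a)
  have hsnd := h.variableForm_succ_sub (snd a)
  rw [h.apply_fst, if_pos rfl] at hfst
  rw [h.apply_snd, if_neg (h.lt a).ne', ← hfst] at hsnd
  simp only [solution, ← Finset.sum_sub_distrib, ← sub_mul, ← Finset.sum_neg_distrib, ← neg_mul]
  refine Finset.sum_congr rfl fun c _ => ?_
  congr 1
  exact_mod_cast congrFun hsnd c

lemma solves_solution (h : IsOccurrences w fst snd) (u : Fin (k + 1) → ℝ) :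
    SolvesToeplitzSystem w fun t => solution fst snd u t := by
  intro i j hij hw
  obtain ⟨hi, hj⟩ := h.eq_fst_and_eq_snd_of_lt hij hw
  have := h.solution_snd_succ_sub u (w i)
  rw [← hi, ← hj] at this
  simp only [Fin.val_succ, Fin.val_castSucc]
  linarith

lemma eq_solution (h : IsOccurrences w fst snd) {u : Fin (k + 1) → ℝ}
    {x : Fin (2 * k + 1) → ℝ} (hx : SolvesToeplitzSystem w x) (hzero : x 0 = u 0)
    (hfst : ∀ a, x (fst a).succ = u a.succ) (t : Fin (2 * k + 1)) :
    x t = solution fst snd u t := by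
  induction t using WellFoundedLT.induction with
  | _ t ih =>
    cases t using Fin.cases with
    | zero => rw [hzero, Fin.val_zero, solution_zero]
    | succ i =>
      rcases h.eq_fst_or_eq_snd i with hi | hi
      · rw [hi, hfst, Fin.val_succ, h.solution_fst_succ]
      · have hlt : fst (w i) < i := (h.lt (w i)).trans_eq hi.symm
        have hsystem := hx (fst (w i)) i hlt (h.apply_fst _)
        have hsolution := h.solves_solution u (fst (w i)) i hlt (h.apply_fst _)
        rw [ih i.castSucc Fin.castSucc_lt_succ,
          ih (fst (w i)).castSucc ((Fin.castSucc_lt_castSucc_iff.2 hlt).trans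
            Fin.castSucc_lt_succ),
          ih (fst (w i)).succ (Fin.succ_lt_succ_iff.2 hlt)] at hsystem
        linarith

lemma mem_toeplitzSection_iff (h : IsOccurrences w fst snd) (u : Fin (k + 1) → ℝ) :
    u ∈ toeplitzSection w ↔ u ∈ unitCube (k + 1) ∧
      ∀ t : Fin (2 * k + 1), solution fst snd u t ∈ Set.Icc (0 : ℝ) 1 := by
  constructor
  · rintro ⟨hu, x, hx, hzero, hfirst, hxI⟩
    refine ⟨hu, fun t => ?_⟩
    rw [← h.eq_solution hx hzero (fun a => ?_) t]
    · exact hxI t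
    · have := hfirst (fst a) ((h.first_iff _).2 (by rw [h.apply_fst]))
      rwa [h.apply_fst] at this
  · rintro ⟨hu, hs⟩
    refine ⟨hu, fun t => solution fst snd u t, h.solves_solution u, solution_zero u, ?_, hs⟩
    intro i hi
    have hsolution := h.solution_fst_succ u (w i)
    rw [← (h.first_iff i).1 hi] at hsolution
    rwa [← Fin.val_succ] at hsolution

end IsOccurrences

/-- The undetermined variables that enter with a plus sign in the variable that follows the second
occurrence of `a`. -/
noncomputable def plusSet (fst snd : Fin k → Fin (2 * k)) (a : Fin k) : Finset (Fin (k + 1)) :=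
  Finset.univ.filter fun c => variableForm fst snd (snd a + 1) c = 1

/-- The undetermined variables that enter with a minus sign in the variable that follows the second
occurrence of `a`. -/
noncomputable def minusSet (fst snd : Fin k → Fin (2 * k)) (a : Fin k) : Finset (Fin (k + 1)) :=
  Finset.univ.filter fun c => variableForm fst snd (snd a + 1) c = -1

lemma disjoint_plusSet_minusSet (a : Fin k) :
    Disjoint (plusSet fst snd a) (minusSet fst snd a) :=
  Finset.disjoint_filter.2 fun _ _ hplus => by omega

namespace IsOccurrences

lemma variableForm_eq_ite (h : IsOccurrences w fst snd) (a : Fin k) (c : Fin (k + 1)) :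
    variableForm fst snd (snd a + 1) c =
      (if c ∈ plusSet fst snd a then 1 else 0) - (if c ∈ minusSet fst snd a then 1 else 0) := by
  have := h.abs_variableForm_le_one (snd a + 1) c
  rw [abs_le] at this
  simp only [plusSet, minusSet, Finset.mem_filter, Finset.mem_univ, true_and]
  split_ifs <;> omega

lemma card_plusSet (h : IsOccurrences w fst snd) (a : Fin k) :
    (plusSet fst snd a).card = (minusSet fst snd a).card + 1 := by
  have := h.sum_variableForm (snd a + 1)
  simp only [h.variableForm_eq_ite, Finset.sum_sub_distrib, Finset.sum_ite_mem,
    Finset.univ_inter, Finset.sum_const, nsmul_eq_mul, mul_one] at this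
  omega

lemma solution_snd_succ (h : IsOccurrences w fst snd) (u : Fin (k + 1) → ℝ) (a : Fin k) :
    solution fst snd u (snd a + 1) =
      ∑ c ∈ plusSet fst snd a, u c - ∑ c ∈ minusSet fst snd a, u c := by
  simp only [solution, h.variableForm_eq_ite]
  push_cast
  simp only [sub_mul, Finset.sum_sub_distrib, ite_mul, one_mul, zero_mul, Finset.sum_ite_mem,
    Finset.univ_inter]

lemma toeplitzSection_eq (h : IsOccurrences w fst snd) :
    toeplitzSection w = unitCube (k + 1) ∩
      ⋂ a, eulerianSolid (plusSet fst snd a) (minusSet fst snd a) := by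
  ext u
  rw [h.mem_toeplitzSection_iff, Set.mem_inter_iff, Set.mem_iInter]
  refine and_congr_right fun hu => ⟨fun hs a => ⟨hu, ?_⟩, fun hs t => ?_⟩
  · rw [← h.solution_snd_succ]
    exact hs (snd a).succ
  · cases t using Fin.cases with
    | zero => rw [Fin.val_zero, solution_zero]; exact hu 0
    | succ i =>
      rw [Fin.val_succ]
      rcases h.eq_fst_or_eq_snd i with hi | hi
      · rw [hi, h.solution_fst_succ]; exact hu _
      · rw [hi, h.solution_snd_succ]; exact (hs _).2

end IsOccurrences

end Words

section SectionVolume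

variable {k : ℕ} {w : Fin (2 * k) → Fin k} {fst snd : Fin k → Fin (2 * k)}

lemma unitCube_eq (d : ℕ) : unitCube d = Set.Icc (0 : Fin d → ℝ) 1 := by
  ext u
  simp only [unitCube, Set.mem_ofPred_eq, Set.mem_Icc, Pi.le_def, Pi.zero_apply, Pi.one_apply]
  exact ⟨fun h => ⟨fun i => (h i).1, fun i => (h i).2⟩, fun h i => ⟨h.1 i, h.2 i⟩⟩

lemma volume_unitCube (d : ℕ) : volume (unitCube d) = 1 := by
  rw [unitCube_eq, Real.volume_Icc_pi]
  simp

lemma continuous_solution (t : ℕ) : Continuous fun u => solution fst snd u t := by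
  unfold solution
  fun_prop

namespace IsOccurrences

lemma toeplitzSection_eq_inter (h : IsOccurrences w fst snd) :
    toeplitzSection w = Set.Icc (0 : Fin (k + 1) → ℝ) 1 ∩
      ⋂ t : Fin (2 * k + 1), (fun u => solution fst snd u t) ⁻¹' Set.Icc 0 1 := by
  ext u
  rw [h.mem_toeplitzSection_iff, unitCube_eq]
  simp

lemma isClosed_toeplitzSection (h : IsOccurrences w fst snd) :
    IsClosed (toeplitzSection w) := by
  rw [h.toeplitzSection_eq_inter]
  exact isClosed_Icc.inter (isClosed_iInter fun t =>
    isClosed_Icc.preimage (continuous_solution t))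

lemma convex_toeplitzSection (h : IsOccurrences w fst snd) :
    Convex ℝ (toeplitzSection w) := by
  rw [h.toeplitzSection_eq_inter]
  refine (convex_Icc _ _).inter (convex_iInter fun t => ?_)
  refine (convex_Icc (0 : ℝ) 1).is_linear_preimage ⟨fun u v => ?_, fun c u => ?_⟩
  · simp [solution, mul_add, Finset.sum_add_distrib]
  · simp only [solution, Pi.smul_apply, smul_eq_mul, Finset.mul_sum]
    exact Finset.sum_congr rfl fun i _ => mul_left_comm _ _ _

lemma isBounded_toeplitzSection (h : IsOccurrences w fst snd) :
    Bornology.IsBounded (toeplitzSection w) := by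
  rw [h.toeplitzSection_eq_inter]
  exact (Metric.isBounded_Icc _ _).subset Set.inter_subset_left

end IsOccurrences

lemma toeplitzVolume_le_one (w : Fin (2 * k) → Fin k) : toeplitzVolume w ≤ 1 := by
  have hsub : toeplitzSection w ⊆ unitCube (k + 1) := fun _ hu => hu.1
  calc toeplitzVolume w ≤ volume.real (unitCube (k + 1)) :=
        measureReal_mono hsub (by rw [volume_unitCube]; exact ENNReal.one_ne_top)
    _ = 1 := by rw [measureReal_def, volume_unitCube, ENNReal.toReal_one]

lemma toeplitzVolume_nonneg (w : Fin (2 * k) → Fin k) : 0 ≤ toeplitzVolume w :=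
  measureReal_nonneg

/-- The paths in `Fin N` that solve the linear system of the word `w`. -/
def solutionPaths (w : Fin (2 * k) → Fin k) (N : ℕ) : Finset (Fin (2 * k + 1) → Fin N) :=
  Finset.univ.filter fun x => ∀ i j, i < j → w i = w j → steps x i + steps x j = 0

lemma mem_solutionPaths_iff {N : ℕ} {x : Fin (2 * k + 1) → Fin N} :
    x ∈ solutionPaths w N ↔ SolvesToeplitzSystem w fun t => ((x t : ℕ) : ℝ) := by
  rw [solutionPaths, Finset.mem_filter_univ]
  simp only [SolvesToeplitzSystem, steps]
  refine forall₄_congr fun i j _ _ => ?_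
  rw [← @Int.cast_inj ℝ, ← neg_inj]
  push_cast
  ring_nf

/-- The undetermined variables of a path, rescaled by `n`. -/
noncomputable def undetermined (fst : Fin k → Fin (2 * k)) (n : ℕ)
    (x : Fin (2 * k + 1) → Fin (n + 1)) : Fin (k + 1) → ℝ :=
  Fin.cons ((n : ℝ)⁻¹ * ((x 0 : ℕ) : ℝ)) fun a => (n : ℝ)⁻¹ * ((x (fst a).succ : ℕ) : ℝ)

lemma SolvesToeplitzSystem.const_mul {x : Fin (2 * k + 1) → ℝ} (hx : SolvesToeplitzSystem w x)
    (c : ℝ) : SolvesToeplitzSystem w fun t => c * x t := fun i j hij hw => by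
  linear_combination c * hx i j hij hw

lemma inv_mul_mem_Icc {n : ℕ} (y : Fin (n + 1)) :
    (n : ℝ)⁻¹ * ((y : ℕ) : ℝ) ∈ Set.Icc (0 : ℝ) 1 := by
  refine ⟨by positivity, ?_⟩
  rw [inv_mul_eq_div]
  exact div_le_one_of_le₀ (by exact_mod_cast Nat.lt_succ_iff.1 y.2) (Nat.cast_nonneg n)

lemma exists_fin_eq_mul {n : ℕ} {m : ℤ} {r : ℝ} (hm : (m : ℝ) = n * r)
    (hr : r ∈ Set.Icc (0 : ℝ) 1) : ∃ y : Fin (n + 1), ((y : ℕ) : ℝ) = n * r := by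
  have hnonneg : 0 ≤ m := by
    have : (0 : ℝ) ≤ m := hm ▸ mul_nonneg (Nat.cast_nonneg n) hr.1
    exact_mod_cast this
  have hle : m ≤ n := by
    have : (m : ℝ) ≤ n := hm ▸ mul_le_of_le_one_right (Nat.cast_nonneg n) hr.2
    exact_mod_cast this
  lift m to ℕ using hnonneg
  exact ⟨⟨m, by omega⟩, by exact_mod_cast hm⟩

namespace IsOccurrences

lemma solution_undetermined (h : IsOccurrences w fst snd) {n : ℕ}
    {x : Fin (2 * k + 1) → Fin (n + 1)} (hx : x ∈ solutionPaths w (n + 1))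
    (t : Fin (2 * k + 1)) :
    (n : ℝ)⁻¹ * ((x t : ℕ) : ℝ) = solution fst snd (undetermined fst n x) t :=
  h.eq_solution (u := undetermined fst n x) ((mem_solutionPaths_iff.1 hx).const_mul _) rfl
    (fun _ => rfl) t

lemma undetermined_injOn (h : IsOccurrences w fst snd) {n : ℕ} (hn : n ≠ 0) :
    Set.InjOn (undetermined fst n) (solutionPaths w (n + 1) : Set _) := by
  intro x hx y hy hxy
  funext t
  have hscaled := h.solution_undetermined hx t
  rw [hxy, ← h.solution_undetermined hy t] at hscaled
  have := mul_left_cancel₀ (inv_ne_zero (Nat.cast_ne_zero.2 hn)) hscaled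
  exact Fin.ext (by exact_mod_cast this)

lemma exists_path_eq_mul_solution (h : IsOccurrences w fst snd) {n : ℕ} {u : Fin (k + 1) → ℝ}
    (hu : ∀ t : Fin (2 * k + 1), solution fst snd u t ∈ Set.Icc (0 : ℝ) 1)
    {z : Fin (k + 1) → ℤ} (hz : ∀ c, (z c : ℝ) = n * u c) :
    ∃ x ∈ solutionPaths w (n + 1), ∀ t, ((x t : ℕ) : ℝ) = n * solution fst snd u t := by
  have hint (t : ℕ) :
      ((∑ c, variableForm fst snd t c * z c : ℤ) : ℝ) = n * solution fst snd u t := by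
    push_cast
    simp only [hz, solution, Finset.mul_sum]
    exact Finset.sum_congr rfl fun c _ => mul_left_comm _ _ _
  choose x hx using fun t : Fin (2 * k + 1) => exists_fin_eq_mul (hint t) (hu t)
  refine ⟨x, mem_solutionPaths_iff.2 ?_, hx⟩
  simp only [hx]
  exact (h.solves_solution u).const_mul n

open scoped Pointwise in
lemma toeplitzSection_inter_lattice (h : IsOccurrences w fst snd) {n : ℕ} [NeZero n] :
    toeplitzSection w ∩ (((n : ℝ)⁻¹ • Submodule.span ℤ (Set.range (Pi.basisFun ℝ (Fin (k + 1)))) :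
      Submodule ℤ (Fin (k + 1) → ℝ)) : Set (Fin (k + 1) → ℝ)) =
      undetermined fst n '' (solutionPaths w (n + 1) : Set _) := by
  have hn : (n : ℝ) ≠ 0 := Nat.cast_ne_zero.2 (NeZero.ne n)
  ext u
  rw [Set.mem_inter_iff, SetLike.mem_coe, BoxIntegral.unitPartition.mem_smul_span_iff,
    h.mem_toeplitzSection_iff]
  constructor
  · rintro ⟨⟨-, hu⟩, hlattice⟩
    choose z hz using hlattice
    obtain ⟨x, hx, hxu⟩ := h.exists_path_eq_mul_solution hu (z := z) fun c => by
      simpa using hz c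
    refine ⟨x, hx, funext fun c => ?_⟩
    cases c using Fin.cases with
    | zero =>
      rw [undetermined, Fin.cons_zero, hxu, Fin.val_zero, solution_zero,
        inv_mul_cancel_left₀ hn]
    | succ a =>
      rw [undetermined, Fin.cons_succ, hxu, Fin.val_succ, h.solution_fst_succ,
        inv_mul_cancel_left₀ hn]
  · rintro ⟨x, hx, rfl⟩
    refine ⟨⟨fun c => ?_, fun t => ?_⟩, fun c => ?_⟩
    · cases c using Fin.cases <;> exact inv_mul_mem_Icc _
    · rw [← h.solution_undetermined hx t]; exact inv_mul_mem_Icc _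
    · cases c using Fin.cases with
      | zero => exact ⟨(x 0 : ℕ), by simp [undetermined, hn]⟩
      | succ a => exact ⟨(x (fst a).succ : ℕ), by simp [undetermined, hn]⟩

lemma tendsto_card_solutionPaths (h : IsOccurrences w fst snd) :
    Tendsto (fun n : ℕ => ((solutionPaths w (n + 1)).card : ℝ) / ((n + 1 : ℕ) : ℝ) ^ (k + 1)) atTop
      (𝓝 (toeplitzVolume w)) := by
  have hlattice := tendsto_card_div_pow_atTop_volume (toeplitzSection w)
    h.isBounded_toeplitzSection h.isClosed_toeplitzSection.measurableSet
    (h.convex_toeplitzSection.addHaar_frontier volume)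
  have hratio : Tendsto (fun n : ℕ => ((n : ℝ) / ((n : ℝ) + 1)) ^ (k + 1)) atTop (𝓝 1) := by
    simpa using (tendsto_natCast_div_add_atTop (1 : ℝ)).pow (k + 1)
  have hprod := hlattice.mul hratio
  rw [mul_one] at hprod
  refine hprod.congr' ?_
  filter_upwards [eventually_ne_atTop 0] with n hn
  have : NeZero n := ⟨hn⟩
  have : (n : ℝ) ≠ 0 := Nat.cast_ne_zero.2 hn
  rw [Fintype.card_fin, Nat.card_coe_set_eq, ← Submodule.coe_pointwise_smul,
    h.toeplitzSection_inter_lattice, (h.undetermined_injOn hn).ncard_image,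
    Set.ncard_coe_finset, Nat.cast_add_one, div_pow]
  field_simp

end IsOccurrences

end SectionVolume

section FirstPositions

variable {I α : Type*} [Fintype I] [LinearOrder I] [DecidableEq α] {l : I → α}

/-- The positions at which a label occurs for the first time. -/
def firstPositions (l : I → α) : Finset I :=
  Finset.univ.filter fun i => ∀ j, l j = l i → i ≤ j

lemma mem_firstPositions {i : I} : i ∈ firstPositions l ↔ ∀ j, l j = l i → i ≤ j := by
  rw [firstPositions, Finset.mem_filter_univ]

lemma injOn_firstPositions : Set.InjOn l (firstPositions l : Set I) := fun i hi j hj hij =>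
  le_antisymm (mem_firstPositions.1 hi j hij.symm) (mem_firstPositions.1 hj i hij)

lemma exists_mem_firstPositions (i : I) : ∃ f ∈ firstPositions l, l f = l i := by
  have hne : (Finset.univ.filter fun j => l j = l i).Nonempty := ⟨i, by simp⟩
  have hmin := (Finset.mem_filter.1 (Finset.min'_mem _ hne)).2
  refine ⟨Finset.min' _ hne, mem_firstPositions.2 fun j hj => ?_, hmin⟩
  exact Finset.min'_le _ j ((Finset.mem_filter_univ j).2 (hj.trans hmin))

lemma card_firstPositions : (firstPositions l).card = (Finset.univ.image l).card := by
  have himage : (firstPositions l).image l = Finset.univ.image l := by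
    refine (Finset.image_subset_image (Finset.subset_univ _)).antisymm fun v hv => ?_
    obtain ⟨i, -, rfl⟩ := Finset.mem_image.1 hv
    exact Finset.mem_image.2 (exists_mem_firstPositions i)
  rw [← himage, Finset.card_image_of_injOn injOn_firstPositions]

end FirstPositions

section PairLoops

variable {k N : ℕ} {w : Fin (2 * k) → Fin k} {fst snd : Fin k → Fin (2 * k)}

/-- The loops whose labels induce exactly the partition of the word `w`. -/
def kernelLoops (w : Fin (2 * k) → Fin k) (N : ℕ) : Finset (Fin (2 * k + 1) → Fin N) :=
  (loops N (2 * k)).filter fun x => ∀ i j, label x i = label x j ↔ w i = w j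

lemma label_eq_of_mem_solutionPaths {x : Fin (2 * k + 1) → Fin N} (hx : x ∈ solutionPaths w N)
    {i j : Fin (2 * k)} (hij : w i = w j) : label x i = label x j := by
  rw [solutionPaths, Finset.mem_filter_univ] at hx
  rcases lt_trichotomy i j with hlt | rfl | hlt
  · have := hx i j hlt hij
    simp only [label]; omega
  · rfl
  · have := hx j i hlt hij.symm
    simp only [label]; omega

namespace IsOccurrences

lemma filter_eq (h : IsOccurrences w fst snd) (a : Fin k) :
    (Finset.univ.filter fun i => w i = a) = {fst a, snd a} := by
  ext i
  rw [Finset.mem_filter_univ, h.iff, Finset.mem_insert, Finset.mem_singleton]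

lemma solutionPaths_subset_loops (h : IsOccurrences w fst snd) :
    solutionPaths w N ⊆ loops N (2 * k) := by
  intro x hx
  have hsum : ∑ i, steps x i = 0 := by
    rw [← Finset.sum_fiberwise (s := Finset.univ) (g := w)]
    refine Finset.sum_eq_zero fun a _ => ?_
    rw [h.filter_eq, Finset.sum_pair (h.lt a).ne]
    exact (Finset.mem_filter.1 hx).2 _ _ (h.lt a) (by rw [h.apply_fst, h.apply_snd])
  rw [sum_steps] at hsum
  exact Finset.mem_filter.2 ⟨Finset.mem_univ _, Fin.ext (by omega)⟩

lemma image_label (h : IsOccurrences w fst snd) {x : Fin (2 * k + 1) → Fin N}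
    (hx : ∀ i j, w i = w j → label x i = label x j) :
    Finset.univ.image (label x) = Finset.univ.image fun a => label x (fst a) := by
  refine Finset.Subset.antisymm ?_ ?_ <;> rw [Finset.image_subset_iff]
  · exact fun i _ => Finset.mem_image.2 ⟨w i, Finset.mem_univ _, hx _ _ (h.apply_fst _)⟩
  · exact fun a _ => Finset.mem_image_of_mem _ (Finset.mem_univ _)

lemma card_image_label_lt (h : IsOccurrences w fst snd) {x : Fin (2 * k + 1) → Fin N}
    (hx : x ∈ solutionPaths w N \ kernelLoops w N) : (Finset.univ.image (label x)).card < k := by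
  obtain ⟨hsolution, hkernel⟩ := Finset.mem_sdiff.1 hx
  have hlabel (i j : Fin (2 * k)) : w i = w j → label x i = label x j :=
    label_eq_of_mem_solutionPaths hsolution
  rw [h.image_label hlabel]
  refine (Finset.card_image_le.trans_eq (Finset.card_fin k)).lt_of_ne fun hcard => hkernel ?_
  have hinj : Function.Injective fun a => label x (fst a) := by
    rw [← Set.injOn_univ, ← Finset.coe_univ]
    exact Finset.card_image_iff.1 (hcard.trans (Finset.card_fin k).symm)
  refine Finset.mem_filter.2 ⟨h.solutionPaths_subset_loops hsolution, fun i j =>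
    ⟨fun hij => hinj ?_, hlabel i j⟩⟩
  simp only [hlabel _ i (h.apply_fst _), hlabel _ j (h.apply_fst _), hij]

lemma card_solutionPaths_sdiff_le (h : IsOccurrences w fst snd) (hN : 0 < N) :
    (solutionPaths w N \ kernelLoops w N).card ≤ (2 * k + 1) ^ (2 * k) * N ^ k := by
  cases k with
  | zero =>
    rw [Finset.eq_empty_of_forall_notMem fun x hx => Nat.not_lt_zero _ (h.card_image_label_lt hx)]
    exact Nat.zero_le _
  | succ q =>
    refine (card_paths_le_of_card_labels_le hN fun x hx =>
      Nat.lt_succ_iff.1 (h.card_image_label_lt hx)).trans ?_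
    gcongr
    exact Nat.le_succ q

lemma exists_card_erase_nonzeroLabels_lt (h : IsOccurrences w fst snd)
    {x : Fin (2 * k + 1) → Fin N} (hx : x ∈ kernelLoops w N \ solutionPaths w N) :
    ∃ v : ℕ, ((nonzeroLabels (steps x)).erase v).card < k ∧
      ∑ l with (steps x l).natAbs = v, steps x l ≠ 0 := by
  obtain ⟨hkernel, hsolution⟩ := Finset.mem_sdiff.1 hx
  have hlabel := (Finset.mem_filter.1 hkernel).2
  obtain ⟨i, j, hij, hw, hne⟩ :
      ∃ i j, i < j ∧ w i = w j ∧ steps x i + steps x j ≠ 0 := by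
    rw [solutionPaths, Finset.mem_filter_univ] at hsolution
    push Not at hsolution
    exact hsolution
  refine ⟨label x i, ?_, ?_⟩
  · have hmem : label x i ∈ nonzeroLabels (steps x) := by
      refine Finset.mem_erase.2 ⟨?_, Finset.mem_image.2 ⟨i, Finset.mem_univ _, rfl⟩⟩
      have hlabel_eq := (hlabel i j).2 hw
      simp only [label] at hlabel_eq ⊢
      omega
    calc ((nonzeroLabels (steps x)).erase (label x i)).card
        < (nonzeroLabels (steps x)).card := Finset.card_erase_lt_of_mem hmem
      _ ≤ (Finset.univ.image (label x)).card := Finset.card_le_card (nonzeroLabels_subset _)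
      _ ≤ (Finset.univ : Finset (Fin k)).card := by
        rw [h.image_label fun i j => (hlabel i j).2]
        exact Finset.card_image_le
      _ = k := Finset.card_fin k
  · have hfiber : (Finset.univ.filter fun l => (steps x l).natAbs = label x i) = {i, j} := by
      obtain ⟨hi, hj⟩ := h.eq_fst_and_eq_snd_of_lt hij hw
      calc _ = Finset.univ.filter fun l => w l = w i :=
            Finset.filter_congr fun l _ => hlabel l i
        _ = {i, j} := by rw [h.filter_eq, ← hi, ← hj]
    rwa [hfiber, Finset.sum_pair hij.ne]

lemma card_kernelLoops_sdiff_le (h : IsOccurrences w fst snd) (hN : 0 < N) :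
    (kernelLoops w N \ solutionPaths w N).card ≤ (6 * k + 3) ^ (2 * k) * N ^ k := by
  cases k with
  | zero =>
    rw [Finset.eq_empty_of_forall_notMem fun x hx =>
      Nat.not_lt_zero _ (h.exists_card_erase_nonzeroLabels_lt hx).choose_spec.1]
    exact Nat.zero_le _
  | succ q =>
    have hsteps : ((kernelLoops w N \ solutionPaths w N).image steps).card ≤
        (6 * q + 3) ^ Fintype.card (Fin (2 * (q + 1))) * N ^ q := by
      refine card_le_of_card_nonzeroLabels_erase_le (J := Finset.univ) hN ?_ ?_ ?_ <;>
        simp only [Finset.forall_mem_image]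
      · exact fun x _ => natAbs_steps_lt x
      · exact fun x hx =>
          sum_steps_eq_zero (Finset.mem_filter.1 (Finset.mem_sdiff.1 hx).1).1
      · intro x hx
        obtain ⟨v, hcard, hsum⟩ := h.exists_card_erase_nonzeroLabels_lt hx
        exact ⟨v, Nat.lt_succ_iff.1 hcard, hsum⟩
    rw [Fintype.card_fin] at hsteps
    calc (kernelLoops w N \ solutionPaths w N).card
        ≤ N * ((6 * q + 3) ^ (2 * (q + 1)) * N ^ q) :=
          (card_paths_le _).trans (Nat.mul_le_mul_left _ hsteps)
      _ = (6 * q + 3) ^ (2 * (q + 1)) * N ^ (q + 1) := by ring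
      _ ≤ _ := by gcongr; exact Nat.le_succ q

lemma abs_card_kernelLoops_sub_le (h : IsOccurrences w fst snd) (hN : 0 < N) :
    |((kernelLoops w N).card : ℝ) - (solutionPaths w N).card| ≤
      ((2 * k + 1) ^ (2 * k) + (6 * k + 3) ^ (2 * k)) * (N : ℝ) ^ k := by
  have hsolution : ((solutionPaths w N \ kernelLoops w N).card : ℝ) ≤
      (2 * k + 1) ^ (2 * k) * (N : ℝ) ^ k := by exact_mod_cast h.card_solutionPaths_sdiff_le hN
  have hkernel : ((kernelLoops w N \ solutionPaths w N).card : ℝ) ≤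
      (6 * k + 3) ^ (2 * k) * (N : ℝ) ^ k := by exact_mod_cast h.card_kernelLoops_sdiff_le hN
  have hsub : ((kernelLoops w N).card : ℝ) - (solutionPaths w N).card =
      (kernelLoops w N \ solutionPaths w N).card - (solutionPaths w N \ kernelLoops w N).card := by
    rw [sub_eq_sub_iff_add_eq_add]
    norm_cast
    rw [add_comm, Finset.card_sdiff_add_card, Finset.card_sdiff_add_card, Finset.union_comm]
  rw [hsub, abs_le]
  constructor <;>
    linarith [Nat.cast_nonneg (α := ℝ) (solutionPaths w N \ kernelLoops w N).card,
      Nat.cast_nonneg (α := ℝ) (kernelLoops w N \ solutionPaths w N).card]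

lemma tendsto_card_kernelLoops (h : IsOccurrences w fst snd) :
    Tendsto (fun n : ℕ => ((kernelLoops w (n + 1)).card : ℝ) / ((n + 1 : ℕ) : ℝ) ^ (k + 1)) atTop
      (𝓝 (toeplitzVolume w)) := by
  set K : ℝ := (2 * k + 1) ^ (2 * k) + (6 * k + 3) ^ (2 * k)
  have hdiff : Tendsto (fun n : ℕ => (((kernelLoops w (n + 1)).card : ℝ) -
      (solutionPaths w (n + 1)).card) / ((n + 1 : ℕ) : ℝ) ^ (k + 1)) atTop (𝓝 0) := by
    have hlim : Tendsto (fun n : ℕ => K * (((n + 1 : ℕ) : ℝ))⁻¹) atTop (𝓝 0) := by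
      simpa using (tendsto_inv_atTop_nhds_zero_nat.comp (tendsto_add_atTop_nat 1)).const_mul K
    refine squeeze_zero_norm (fun n => ?_) hlim
    have hn : (0 : ℝ) < (n + 1 : ℕ) := Nat.cast_pos.2 n.succ_pos
    rw [norm_div, Real.norm_eq_abs, Real.norm_of_nonneg (pow_pos hn _).le,
      div_le_iff₀ (pow_pos hn _), pow_succ', mul_assoc, inv_mul_cancel_left₀ hn.ne']
    exact h.abs_card_kernelLoops_sub_le n.succ_pos
  have hsum := hdiff.add h.tendsto_card_solutionPaths
  rw [zero_add] at hsum
  refine hsum.congr fun n => ?_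
  rw [← add_div, sub_add_cancel]

lemma range_fst (h : IsOccurrences w fst snd) :
    Set.range fst = (firstPositions w : Set (Fin (2 * k))) := by
  ext i
  rw [Finset.mem_coe, mem_firstPositions, h.first_iff]
  constructor
  · rintro ⟨a, rfl⟩
    rw [h.apply_fst]
  · exact fun hi => ⟨w i, hi.symm⟩

lemma range_fst_eq_compl (h : IsOccurrences w fst snd) : Set.range fst = (Set.range snd)ᶜ := by
  ext i
  constructor
  · rintro ⟨a, rfl⟩ ⟨b, hb⟩
    have hab : b = a := by rw [← h.apply_snd b, hb, h.apply_fst]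
    exact (h.lt a).ne' (hab ▸ hb)
  · exact fun hi => ⟨_, ((h.eq_fst_or_eq_snd i).resolve_right fun he => hi ⟨_, he.symm⟩).symm⟩

lemma eq_of_snd_eq {w' : Fin (2 * k) → Fin k} {fst' : Fin k → Fin (2 * k)}
    (h : IsOccurrences w fst snd) (h' : IsOccurrences w' fst' snd) : w = w' := by
  have hfst : fst = fst' := by
    rw [← h.mono.range_inj h'.mono, h.range_fst_eq_compl, h'.range_fst_eq_compl]
  subst hfst
  funext i
  exact ((h'.iff i (w i)).2 (h.eq_fst_or_eq_snd i)).symm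

end IsOccurrences

lemma IsPartitionWord.eq_of_kernel_eq {w w' : Fin (2 * k) → Fin k} (hw : IsPartitionWord w)
    (hw' : IsPartitionWord w') (hker : ∀ i j, w i = w j ↔ w' i = w' j) : w = w' := by
  obtain ⟨fst, snd, h⟩ := hw.exists_occurrences
  obtain ⟨fst', snd', h'⟩ := hw'.exists_occurrences
  have hfst : fst = fst' := by
    rw [← h.mono.range_inj h'.mono, h.range_fst, h'.range_fst]
    ext i
    simp only [Finset.mem_coe, mem_firstPositions, hker]
  funext i
  have hfirst : w' i = w' (fst (w i)) := (hker _ _).1 (h.apply_fst (w i)).symm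
  rw [hfirst, hfst, h'.apply_fst]

lemma exists_isPartitionWord {α : Type*} [DecidableEq α] {l : Fin (2 * k) → α}
    (hl : ∀ i, multiplicity l i = 2) :
    ∃ w : Fin (2 * k) → Fin k, IsPartitionWord w ∧ ∀ i j, l i = l j ↔ w i = w j := by
  have hcard : (firstPositions l).card = k := by
    have := two_mul_card_image_eq hl
    rw [Fintype.card_fin, ← card_firstPositions] at this
    omega
  let e := (firstPositions l).orderEmbOfFin hcard
  have he (a : Fin k) : e a ∈ firstPositions l := (firstPositions l).orderEmbOfFin_mem hcard a
  have hex (i : Fin (2 * k)) : ∃ a, l (e a) = l i := by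
    obtain ⟨f, hf, hfi⟩ := exists_mem_firstPositions (l := l) i
    rw [← Finset.mem_coe, ← (firstPositions l).range_orderEmbOfFin hcard] at hf
    obtain ⟨a, rfl⟩ := hf
    exact ⟨a, hfi⟩
  choose w hw using hex
  have hiff (i : Fin (2 * k)) (a : Fin k) : w i = a ↔ l i = l (e a) := by
    refine ⟨fun hi => hi ▸ (hw i).symm, fun hi => e.injective ?_⟩
    exact injOn_firstPositions (he _) (he _) ((hw i).trans hi)
  refine ⟨w, ⟨fun a => ?_, fun a b hab => ⟨e a, (hiff _ _).2 rfl, fun j hj => ?_⟩⟩,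
    fun i j => ?_⟩
  · simp only [hiff]
    exact hl (e a)
  · exact (e.strictMono hab).trans_le (mem_firstPositions.1 (he b) j ((hiff j b).1 hj))
  · rw [hiff, hw]

lemma card_pairLoops_eq : (pairLoops N (2 * k)).card =
    ∑ w ∈ partitionWords k, (kernelLoops w N).card := by
  rw [← Finset.card_biUnion]
  · congr 1
    ext x
    simp only [Finset.mem_biUnion]
    constructor
    · intro hx
      obtain ⟨hloop, hmult⟩ := Finset.mem_filter.1 hx
      obtain ⟨w, hw, hker⟩ := exists_isPartitionWord hmult
      exact ⟨w, Finset.mem_filter.2 ⟨Finset.mem_univ _, hw⟩, Finset.mem_filter.2 ⟨hloop, hker⟩⟩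
    · rintro ⟨w, hw, hx⟩
      obtain ⟨hloop, hker⟩ := Finset.mem_filter.1 hx
      refine Finset.mem_filter.2 ⟨hloop, fun i => ?_⟩
      simp only [multiplicity, hker]
      exact (Finset.mem_filter.1 hw).2.1 (w i)
  · intro w hw w' hw' hne
    refine Finset.disjoint_left.2 fun x hx hx' => hne ?_
    refine (Finset.mem_filter.1 hw).2.eq_of_kernel_eq (Finset.mem_filter.1 hw').2 fun i j => ?_
    rw [← (Finset.mem_filter.1 hx).2 i j, (Finset.mem_filter.1 hx').2 i j]

lemma tendsto_card_pairLoops (k : ℕ) :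
    Tendsto (fun n : ℕ => ((pairLoops (n + 1) (2 * k)).card : ℝ) / ((n + 1 : ℕ) : ℝ) ^ (k + 1))
      atTop (𝓝 (∑ w ∈ partitionWords k, toeplitzVolume w)) := by
  simp only [card_pairLoops_eq, Nat.cast_sum, Finset.sum_div]
  refine tendsto_finsetSum _ fun w hw => ?_
  obtain ⟨fst, snd, h⟩ := (Finset.mem_filter.1 hw).2.exists_occurrences
  exact h.tendsto_card_kernelLoops

lemma card_partitionWords_le (k : ℕ) : (partitionWords k).card ≤ (2 * k) ^ k := by
  have hex (w : partitionWords k) : ∃ snd fst : Fin k → Fin (2 * k), IsOccurrences w.1 fst snd :=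
    exists_comm.1 (Finset.mem_filter.1 w.2).2.exists_occurrences
  choose snd fst h using hex
  have hinj : Function.Injective snd := fun w w' hsnd =>
    Subtype.ext ((h w).eq_of_snd_eq (hsnd ▸ h w'))
  simpa using Fintype.card_le_of_injective snd hinj

lemma sum_toeplitzVolume_le (k : ℕ) :
    ∑ w ∈ partitionWords k, toeplitzVolume w ≤ (2 * k : ℝ) ^ k := by
  calc ∑ w ∈ partitionWords k, toeplitzVolume w ≤ ∑ _w ∈ partitionWords k, (1 : ℝ) :=
        Finset.sum_le_sum fun w _ => toeplitzVolume_le_one w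
    _ = (partitionWords k).card := by rw [Finset.sum_const, nsmul_eq_mul, mul_one]
    _ ≤ _ := by exact_mod_cast card_partitionWords_le k

end PairLoops

section LowerBound

variable {k N : ℕ} {y z : Fin (k + 1) → Fin N}

/-- The multiset of steps of a path. The steps lie strictly between `-N` and `N`, so adding `N`
moves them into a type with `2 * N` elements. -/
def stepMultiset (y : Fin (k + 1) → Fin N) : Sym (Fin (2 * N)) k :=
  ⟨(Finset.univ : Finset (Fin k)).val.map fun i => ⟨(steps y i + N).toNat, by
    have := natAbs_steps_lt y i; omega⟩, by simp⟩

lemma map_steps_eq (h : stepMultiset y = stepMultiset z) :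
    (Finset.univ : Finset (Fin k)).val.map (steps y) =
      (Finset.univ : Finset (Fin k)).val.map (steps z) := by
  have hshift (y : Fin (k + 1) → Fin N) (i : Fin k) :
      ((steps y i + N).toNat : ℤ) - N = steps y i := by
    have := natAbs_steps_lt y i
    omega
  have hmap := congrArg (fun s => Multiset.map (fun v : Fin (2 * N) => ((v : ℕ) : ℤ) - N) s.1) h
  simpa only [stepMultiset, Multiset.map_map, Function.comp_def, hshift] using hmap

lemma exists_steps_eq (h : stepMultiset y = stepMultiset z) (i : Fin k) :
    ∃ j, steps z j = steps y i := by
  have hmem : steps y i ∈ (Finset.univ : Finset (Fin k)).val.map (steps z) :=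
    map_steps_eq h ▸ Multiset.mem_map_of_mem _ (Finset.mem_univ i)
  obtain ⟨j, -, hj⟩ := Multiset.mem_map.1 hmem
  exact ⟨j, hj⟩

lemma last_eq_of_stepMultiset_eq (hzero : y 0 = z 0) (h : stepMultiset y = stepMultiset z) :
    y (Fin.last k) = z (Fin.last k) := by
  have hsum : ∑ i, steps y i = ∑ i, steps z i := congrArg Multiset.sum (map_steps_eq h)
  rw [sum_steps, sum_steps, hzero] at hsum
  exact Fin.ext (by omega)

/-- The path that follows `y` and returns along `z`. -/
def glue (y z : Fin (k + 1) → Fin N) : Fin (2 * k + 1) → Fin N := fun i =>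
  if h : (i : ℕ) ≤ k then y ⟨i, by omega⟩ else z ⟨2 * k - i, by omega⟩

lemma glue_of_le {i : Fin (2 * k + 1)} (hi : (i : ℕ) ≤ k) : glue y z i = y ⟨i, by omega⟩ :=
  dif_pos hi

lemma glue_of_ge (hlast : y (Fin.last k) = z (Fin.last k)) {i : Fin (2 * k + 1)}
    (hi : k ≤ (i : ℕ)) : glue y z i = z ⟨2 * k - i, by omega⟩ := by
  rcases hi.eq_or_lt with hik | hlt
  · rw [glue_of_le hik.ge]
    convert hlast using 2 <;> ext <;> simp only [Fin.val_last] <;> omega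
  · exact dif_neg hlt.not_ge

lemma steps_glue_castLE (i : Fin k) :
    steps (glue y z) (i.castLE (by omega)) = steps y i := by
  rw [steps, glue_of_le, glue_of_le]
  · rfl
  · exact i.2
  · exact i.2.le

lemma steps_glue_rev_castLE (hlast : y (Fin.last k) = z (Fin.last k)) (j : Fin k) :
    steps (glue y z) (j.castLE (by omega : k ≤ 2 * k)).rev = -steps z j := by
  have hj := j.2
  rw [steps, glue_of_ge hlast, glue_of_ge hlast, steps, neg_sub]
  · congr! 4 <;> ext <;>
      simp only [Fin.val_succ, Fin.val_castSucc, Fin.val_rev, Fin.val_castLE] <;> omega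
  all_goals simp only [Fin.val_succ, Fin.val_castSucc, Fin.val_rev, Fin.val_castLE]; omega

lemma eq_castLE_or_eq_rev_castLE (i : Fin (2 * k)) :
    ∃ j : Fin k, i = j.castLE (by omega) ∨ i = (j.castLE (by omega)).rev := by
  rcases lt_or_ge (i : ℕ) k with hi | hi
  · exact ⟨⟨i, hi⟩, Or.inl rfl⟩
  · refine ⟨⟨2 * k - 1 - i, by omega⟩, Or.inr (Fin.ext ?_)⟩
    simp only [Fin.val_rev, Fin.val_castLE]
    omega

lemma castLE_ne_rev_castLE (i j : Fin k) :
    i.castLE (by omega : k ≤ 2 * k) ≠ (j.castLE (by omega)).rev := by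
  simp only [ne_eq, Fin.ext_iff, Fin.val_rev, Fin.val_castLE]
  omega

lemma two_le_multiplicity_of_ne {I α : Type*} [Fintype I] [DecidableEq α] {l : I → α} {i j : I}
    (hij : i ≠ j) (hl : l i = l j) : 2 ≤ multiplicity l i :=
  Finset.one_lt_card.2 ⟨i, by simp, j, by simp [hl], hij⟩

/-- Pairs of paths with the same starting point and the same multiset of steps. -/
def returnPairs (k N : ℕ) : Finset ((Fin (k + 1) → Fin N) × (Fin (k + 1) → Fin N)) :=
  Finset.univ.filter fun p => p.1 0 = p.2 0 ∧ stepMultiset p.1 = stepMultiset p.2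

lemma glue_mem_loops (hzero : y 0 = z 0) (h : stepMultiset y = stepMultiset z) :
    glue y z ∈ loops N (2 * k) := by
  refine Finset.mem_filter.2 ⟨Finset.mem_univ _, ?_⟩
  rw [glue_of_le (Nat.zero_le k), glue_of_ge (last_eq_of_stepMultiset_eq hzero h)]
  · exact hzero.trans (congrArg z (Fin.ext (Nat.sub_self (2 * k)).symm))
  · rw [Fin.val_last]
    omega

lemma two_le_multiplicity_label_glue (hzero : y 0 = z 0) (h : stepMultiset y = stepMultiset z)
    (i : Fin (2 * k)) : 2 ≤ multiplicity (label (glue y z)) i := by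
  have hlast := last_eq_of_stepMultiset_eq hzero h
  obtain ⟨j, rfl | rfl⟩ := eq_castLE_or_eq_rev_castLE i
  · obtain ⟨j', hj'⟩ := exists_steps_eq h j
    refine two_le_multiplicity_of_ne (castLE_ne_rev_castLE j j') ?_
    rw [label, label, steps_glue_castLE, steps_glue_rev_castLE hlast, hj', Int.natAbs_neg]
  · obtain ⟨j', hj'⟩ := exists_steps_eq h.symm j
    refine two_le_multiplicity_of_ne (castLE_ne_rev_castLE j' j).symm ?_
    rw [label, label, steps_glue_castLE, steps_glue_rev_castLE hlast, hj', Int.natAbs_neg]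

lemma injOn_glue : Set.InjOn (fun p => glue p.1 p.2)
    (returnPairs k N : Set ((Fin (k + 1) → Fin N) × (Fin (k + 1) → Fin N))) := by
  rintro ⟨y, z⟩ hp ⟨y', z'⟩ hp' h
  obtain ⟨hzero, hmultiset⟩ := (Finset.mem_filter.1 hp).2
  obtain ⟨hzero', hmultiset'⟩ := (Finset.mem_filter.1 hp').2
  change glue y z = glue y' z' at h
  refine Prod.ext (funext fun i => ?_) (funext fun i => ?_)
  · have hi := congrFun h ⟨i, by omega⟩
    have hle : (i : ℕ) ≤ k := Nat.lt_succ_iff.1 i.2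
    rwa [glue_of_le hle, glue_of_le hle] at hi
  · have hge : k ≤ 2 * k - i := by omega
    have hi := congrFun h ⟨2 * k - i, by omega⟩
    rw [glue_of_ge (last_eq_of_stepMultiset_eq hzero hmultiset) hge,
      glue_of_ge (last_eq_of_stepMultiset_eq hzero' hmultiset') hge] at hi
    convert hi using 2 <;> ext <;> simp only <;> omega

lemma card_returnPairs_le (hN : 0 < N) : (returnPairs k N).card ≤
    (pairLoops N (2 * k)).card + (2 * (2 * k) + 1) ^ (2 * k) * N ^ k := by
  have hglue : (returnPairs k N).card ≤
      (pairLoops N (2 * k) ∪ degenerateLoops N (2 * k)).card := by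
    refine Finset.card_le_card_of_injOn (fun p => glue p.1 p.2) (fun p hp => ?_) injOn_glue
    obtain ⟨hzero, hmultiset⟩ := (Finset.mem_filter.1 hp).2
    have hloop := glue_mem_loops hzero hmultiset
    by_cases hpair : ∀ i, multiplicity (label (glue p.1 p.2)) i = 2
    · exact Finset.mem_union_left _ (Finset.mem_filter.2 ⟨hloop, hpair⟩)
    · exact Finset.mem_union_right _ (Finset.mem_filter.2
        ⟨hloop, two_le_multiplicity_label_glue hzero hmultiset, hpair⟩)
  have hdegenerate := card_degenerateLoops_le hN (2 * k)
  rw [show (2 * k + 1) / 2 = k by omega] at hdegenerate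
  exact hglue.trans ((Finset.card_union_le _ _).trans (Nat.add_le_add_left hdegenerate _))

lemma sq_card_le_card_mul_card_filter_eq {α β : Type*} [Fintype α] [Fintype β] [DecidableEq β]
    (f : α → β) : Fintype.card α ^ 2 ≤
      Fintype.card β * (Finset.univ.filter fun p : α × α => f p.1 = f p.2).card := by
  have hcard : ∑ b, (Finset.univ.filter fun a => f a = b).card = Fintype.card α :=
    (Finset.card_eq_sum_card_fiberwise fun _ _ => Finset.mem_univ _).symm
  have hpairs : ∑ b, (Finset.univ.filter fun a => f a = b).card ^ 2 =
      (Finset.univ.filter fun p : α × α => f p.1 = f p.2).card := by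
    rw [Finset.card_eq_sum_card_fiberwise (f := fun p => f p.1) fun _ _ => Finset.mem_univ _]
    refine Finset.sum_congr rfl fun b _ => ?_
    rw [sq, ← Finset.card_product]
    congr 1
    ext p
    rw [Finset.mem_product, Finset.mem_filter_univ, Finset.mem_filter_univ, Finset.mem_filter,
      Finset.mem_filter_univ]
    constructor
    · rintro ⟨hfst, hsnd⟩
      exact ⟨hfst.trans hsnd.symm, hfst⟩
    · rintro ⟨heq, hfst⟩
      exact ⟨hfst, heq ▸ hfst⟩
  rw [← hcard, ← hpairs]
  exact sq_sum_le_card_mul_sum_sq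

lemma sq_card_le_card_mul_card_returnPairs (k N : ℕ) :
    (N ^ (k + 1)) ^ 2 ≤ (N * (2 * N).multichoose k) * (returnPairs k N).card := by
  have h := sq_card_le_card_mul_card_filter_eq
    fun y : Fin (k + 1) → Fin N => (y 0, stepMultiset y)
  simpa only [returnPairs, Prod.mk.injEq, Fintype.card_prod, Fintype.card_fun, Fintype.card_fin,
    Sym.card_sym_eq_multichoose] using h

lemma multichoose_le_pow_div (n k : ℕ) : (n.multichoose k : ℝ) ≤ (n + k : ℝ) ^ k / k ! := by
  rw [Nat.multichoose_eq]
  refine (Nat.choose_le_pow_div k _).trans ?_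
  gcongr
  exact_mod_cast Nat.sub_le (n + k) 1

lemma factorial_mul_pow_le (hN : 0 < N) :
    (k ! : ℝ) * ((N : ℝ) / (2 * N + k)) ^ k ≤
      ((pairLoops N (2 * k)).card : ℝ) / (N : ℝ) ^ (k + 1) +
        (2 * (2 * k) + 1) ^ (2 * k) * (N : ℝ)⁻¹ := by
  set P : ℝ := (pairLoops N (2 * k)).card + (2 * (2 * k) + 1) ^ (2 * k) * (N : ℝ) ^ k
  have : (0 : ℝ) < N := Nat.cast_pos.2 hN
  have hcauchy : ((N : ℝ) ^ (k + 1)) ^ 2 ≤ (N * ((2 * N).multichoose k : ℝ)) *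
      (returnPairs k N).card := by
    exact_mod_cast sq_card_le_card_mul_card_returnPairs k N
  have hpairs : ((returnPairs k N).card : ℝ) ≤ P := by
    simp only [P]
    exact_mod_cast card_returnPairs_le (k := k) hN
  have hchoose : ((2 * N).multichoose k : ℝ) ≤ (2 * N + k : ℝ) ^ k / k ! := by
    exact_mod_cast multichoose_le_pow_div (2 * N) k
  have hbound : ((N : ℝ) ^ (k + 1)) ^ 2 ≤ (N * ((2 * N + k : ℝ) ^ k / k !)) * P :=
    hcauchy.trans (by gcongr)
  calc (k ! : ℝ) * ((N : ℝ) / (2 * N + k)) ^ k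
      = ((N : ℝ) ^ (k + 1)) ^ 2 * (k ! / (N * (2 * N + k : ℝ) ^ k * (N : ℝ) ^ (k + 1))) := by
        rw [div_pow]
        field_simp
        ring
    _ ≤ (N * ((2 * N + k : ℝ) ^ k / k !)) * P *
          (k ! / (N * (2 * N + k : ℝ) ^ k * (N : ℝ) ^ (k + 1))) := by gcongr
    _ = P / (N : ℝ) ^ (k + 1) := by field_simp
    _ = _ := by
        rw [add_div, pow_succ]
        field_simp

lemma tendsto_div_two_mul_add (c : ℝ) :
    Tendsto (fun x : ℝ => x / (2 * x + c)) atTop (𝓝 2⁻¹) := by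
  have hlim : Tendsto (fun x : ℝ => (2 + c * x⁻¹)⁻¹) atTop (𝓝 (2 + c * 0)⁻¹) :=
    (tendsto_const_nhds.add (tendsto_inv_atTop_zero.const_mul c)).inv₀ (by norm_num)
  rw [mul_zero, add_zero] at hlim
  refine hlim.congr' ((eventually_ne_atTop 0).mono fun x hx => ?_)
  change _ = x / (2 * x + c)
  rw [show 2 * x + c = x * (2 + c * x⁻¹) by field_simp, div_mul_eq_div_div, div_self hx, one_div]

lemma factorial_div_le_sum_toeplitzVolume (k : ℕ) :
    (k ! : ℝ) / 2 ^ k ≤ ∑ w ∈ partitionWords k, toeplitzVolume w := by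
  have hN : Tendsto (fun n : ℕ => ((n + 1 : ℕ) : ℝ)) atTop atTop :=
    tendsto_natCast_atTop_atTop.comp (tendsto_add_atTop_nat 1)
  have hlower := (((tendsto_div_two_mul_add k).comp hN).pow k).const_mul (k ! : ℝ)
  have hupper := (tendsto_card_pairLoops k).add
    ((tendsto_inv_atTop_zero.comp hN).const_mul ((2 * (2 * k) + 1 : ℝ) ^ (2 * k)))
  rw [mul_zero, add_zero] at hupper
  rw [div_eq_mul_inv, ← inv_pow]
  exact le_of_tendsto_of_tendsto' hlower hupper fun n => factorial_mul_pow_le n.succ_pos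

end LowerBound

section ExpRemainder

/-- The remainder of the Taylor expansion of the complex exponential at `0`, after `N` terms. -/
noncomputable def expRemainder (N : ℕ) (z : ℂ) : ℂ :=
  Complex.exp z - ∑ j ∈ Finset.range N, z ^ j / (j ! : ℂ)

lemma hasDerivAt_expRemainder_succ (N : ℕ) (z : ℂ) :
    HasDerivAt (expRemainder (N + 1)) (expRemainder N z) z := by
  have hsum : HasDerivAt (fun z : ℂ => ∑ j ∈ Finset.range (N + 1), z ^ j / (j ! : ℂ))
      (∑ j ∈ Finset.range (N + 1), (j * z ^ (j - 1)) / (j ! : ℂ)) z :=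
    HasDerivAt.fun_sum fun j _ => (hasDerivAt_pow j z).div_const _
  refine ((Complex.hasDerivAt_exp z).sub hsum).congr_deriv ?_
  rw [expRemainder, Finset.sum_range_succ', Nat.cast_zero, zero_mul, zero_div, add_zero]
  congr 1
  refine Finset.sum_congr rfl fun j _ => ?_
  rw [Nat.factorial_succ, Nat.add_sub_cancel, Nat.cast_mul,
    mul_div_mul_left _ _ (Nat.cast_ne_zero.2 j.succ_ne_zero)]

lemma expRemainder_succ_zero (N : ℕ) : expRemainder (N + 1) 0 = 0 := by
  simp [expRemainder, Finset.sum_range_succ']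

lemma hasDerivAt_pow_succ_div_factorial (N : ℕ) (c s : ℝ) :
    HasDerivAt (fun s => (s * c) ^ (N + 1) / (N + 1)!) (c * ((s * c) ^ N / N !)) s := by
  refine ((((hasDerivAt_id s).mul_const c).pow (N + 1)).div_const _).congr_deriv ?_
  rw [Nat.factorial_succ, Nat.cast_mul, Nat.add_sub_cancel, mul_assoc,
    mul_div_mul_left _ _ (Nat.cast_ne_zero.2 N.succ_ne_zero), one_mul, id, mul_comm c,
    mul_div_right_comm]

lemma norm_expRemainder_le (N : ℕ) {z : ℂ} (hz : z.re ≤ 0) :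
    ‖expRemainder N z‖ ≤ ‖z‖ ^ N / N ! := by
  induction N generalizing z with
  | zero => simpa [expRemainder, Complex.norm_exp] using hz
  | succ N ih =>
    have hderiv (s : ℝ) :
        HasDerivAt (fun s : ℝ => expRemainder (N + 1) (s * z)) (expRemainder N (s * z) * z) s := by
      have hmul : HasDerivAt (fun s : ℝ => (s : ℂ) * z) z s := by
        simpa only [id, Complex.ofReal_one, one_mul] using
          (hasDerivAt_id s).ofReal_comp.mul_const z
      exact (hasDerivAt_expRemainder_succ N (s * z)).comp s hmul
    have hbound (s : ℝ) (hs : 0 ≤ s) :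
        ‖expRemainder N (s * z) * z‖ ≤ ‖z‖ * ((s * ‖z‖) ^ N / N !) := by
      have hre : ((s : ℂ) * z).re ≤ 0 := by
        rw [Complex.re_ofReal_mul]
        exact mul_nonpos_of_nonneg_of_nonpos hs hz
      rw [norm_mul, mul_comm]
      gcongr
      simpa only [norm_mul, Complex.norm_of_nonneg hs] using ih hre
    have hmean := image_norm_le_of_norm_deriv_right_le_deriv_boundary (a := 0) (b := 1)
      (fun s _ => (hderiv s).continuousAt.continuousWithinAt)
      (fun s _ => (hderiv s).hasDerivWithinAt)
      (by simp [expRemainder_succ_zero])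
      (hasDerivAt_pow_succ_div_factorial N ‖z‖)
      (fun s hs => hbound s hs.1) (Set.right_mem_Icc.2 zero_le_one)
    simpa only [Complex.ofReal_one, one_mul] using hmean

end ExpRemainder

section MomentMethod

/-- The measure `μ` has finite moments of all orders, given by the sequence `m`. -/
def HasMoments (μ : Measure ℝ) (m : ℕ → ℝ) : Prop :=
  ∀ r : ℕ, Integrable (fun x : ℝ => x ^ r) μ ∧ ∫ x, x ^ r ∂μ = m r

namespace HasMoments

variable {μ : Measure ℝ} {m : ℕ → ℝ}

lemma integral_sum_pow (h : HasMoments μ m) (c : ℕ → ℂ) (s : Finset ℕ) :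
    Integrable (fun x : ℝ => ∑ j ∈ s, c j * ((x ^ j : ℝ) : ℂ)) μ ∧
      ∫ x, ∑ j ∈ s, c j * ((x ^ j : ℝ) : ℂ) ∂μ = ∑ j ∈ s, c j * (m j : ℂ) := by
  have hint (j : ℕ) : Integrable (fun x : ℝ => c j * ((x ^ j : ℝ) : ℂ)) μ :=
    ((h j).1.ofReal (𝕜 := ℂ)).const_mul _
  refine ⟨integrable_finsetSum _ fun j _ => hint j, ?_⟩
  rw [integral_finsetSum _ fun j _ => hint j]
  refine Finset.sum_congr rfl fun j _ => ?_
  rw [integral_const_mul, integral_complex_ofReal, (h j).2]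

variable [IsProbabilityMeasure μ]

lemma norm_charFun_sub_sum_le (h : HasMoments μ m) (t : ℝ) (K : ℕ) :
    ‖charFun μ t - ∑ j ∈ Finset.range (2 * K), (t * Complex.I) ^ j / (j ! : ℂ) * (m j : ℂ)‖ ≤
      t ^ (2 * K) / (2 * K)! * m (2 * K) := by
  have hexp : Integrable (fun x : ℝ => Complex.exp (t * x * Complex.I)) μ := by
    refine (integrable_const (1 : ℝ)).mono' (by fun_prop) (ae_of_all _ fun x => ?_)
    rw [← Complex.ofReal_mul, Complex.norm_exp_ofReal_mul_I]
  obtain ⟨hint, hsum⟩ :=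
    h.integral_sum_pow (fun j => (t * Complex.I) ^ j / (j ! : ℂ)) (Finset.range (2 * K))
  rw [← hsum, charFun_apply_real, ← integral_sub hexp hint, ← (h (2 * K)).2, ← integral_const_mul]
  refine norm_integral_le_of_norm_le ((h (2 * K)).1.const_mul _) (ae_of_all _ fun x => ?_)
  have hremainder := norm_expRemainder_le (2 * K) (z := t * x * Complex.I) (by simp)
  calc _ = ‖expRemainder (2 * K) (t * x * Complex.I)‖ := by
        rw [expRemainder]
        congr 2
        refine Finset.sum_congr rfl fun j _ => ?_
        push_cast
        ring
    _ ≤ ‖(t * x * Complex.I : ℂ)‖ ^ (2 * K) / (2 * K)! := hremainder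
    _ = t ^ (2 * K) / (2 * K)! * x ^ (2 * K) := by
        rw [← Complex.ofReal_mul, Complex.norm_mul, Complex.norm_I, mul_one, Complex.norm_real,
          Real.norm_eq_abs, (even_two_mul K).pow_abs, mul_pow, mul_div_right_comm]

lemma integral_pow_add_sq (h : HasMoments μ m) (r : ℕ) (a : ℝ) :
    Integrable (fun x : ℝ => (x ^ r + a) ^ 2) μ ∧
      ∫ x, (x ^ r + a) ^ 2 ∂μ = m (2 * r) + 2 * a * m r + a ^ 2 := by
  have hexpand (x : ℝ) : (x ^ r + a) ^ 2 = x ^ (2 * r) + 2 * a * x ^ r + a ^ 2 := by ring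
  have hint : Integrable (fun x : ℝ => x ^ (2 * r) + 2 * a * x ^ r) μ :=
    (h (2 * r)).1.add ((h r).1.const_mul (2 * a))
  simp only [hexpand]
  refine ⟨hint.add (integrable_const _), ?_⟩
  rw [integral_add hint (integrable_const _), integral_add (h (2 * r)).1 ((h r).1.const_mul _),
    integral_const_mul, (h (2 * r)).2, (h r).2, integral_const, probReal_univ, one_smul]

end HasMoments

lemma tendsto_charFun_of_hasMoments {ι : Type*} {l : Filter ι} {μ : ι → ProbabilityMeasure ℝ}
    {γ : ProbabilityMeasure ℝ} {m : ℕ → ℝ} {M : ι → ℕ → ℝ} (hγ : HasMoments γ m)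
    (hμ : ∀ i, HasMoments (μ i) (M i)) (hM : ∀ r, Tendsto (fun i => M i r) l (𝓝 (m r)))
    (hm : ∀ t : ℝ, Tendsto (fun K : ℕ => t ^ (2 * K) / (2 * K)! * m (2 * K)) atTop (𝓝 0)) (t : ℝ) :
    Tendsto (fun i => charFun (μ i : Measure ℝ) t) l (𝓝 (charFun (γ : Measure ℝ) t)) := by
  rw [Metric.tendsto_nhds]
  intro ε hε
  obtain ⟨K, hK⟩ := ((hm t).eventually (gt_mem_nhds (show 0 < ε / 4 by positivity))).exists
  let p : (ℕ → ℝ) → ℂ := fun m =>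
    ∑ j ∈ Finset.range (2 * K), (t * Complex.I) ^ j / (j ! : ℂ) * (m j : ℂ)
  have hp : Tendsto (fun i => p (M i)) l (𝓝 (p m)) := tendsto_finsetSum _ fun j _ =>
    ((Complex.continuous_ofReal.tendsto _).comp (hM j)).const_mul _
  have hremainder := ((hM (2 * K)).const_mul (t ^ (2 * K) / (2 * K)!)).eventually (gt_mem_nhds hK)
  filter_upwards [hremainder, Metric.tendsto_nhds.1 hp (ε / 4) (by positivity)] with i hMi hpi
  have hdist_i := (hμ i).norm_charFun_sub_sum_le t K
  have hdist := hγ.norm_charFun_sub_sum_le t K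
  rw [← dist_eq_norm] at hdist_i hdist
  rw [dist_comm] at hdist
  linarith [dist_triangle4 (charFun (μ i : Measure ℝ) t) (p (M i)) (p m)
    (charFun (γ : Measure ℝ) t)]

lemma integral_le_of_tendsto_probabilityMeasure {Ω : Type*} [MeasurableSpace Ω]
    [TopologicalSpace Ω] [OpensMeasurableSpace Ω] [HasOuterApproxClosed Ω]
    {μ : ℕ → ProbabilityMeasure Ω} {γ : ProbabilityMeasure Ω} (hμ : Tendsto μ atTop (𝓝 γ))
    {f : Ω → ℝ} (hf : Continuous f) (hf_nonneg : 0 ≤ f)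
    (hint : ∀ i, Integrable f (μ i : Measure Ω)) {c : ℝ}
    (hc : Tendsto (fun i => ∫ x, f x ∂(μ i : Measure Ω)) atTop (𝓝 c)) :
    Integrable f (γ : Measure Ω) ∧ ∫ x, f x ∂(γ : Measure Ω) ≤ c := by
  have hmeas : AEStronglyMeasurable f (γ : Measure Ω) := hf.measurable.aestronglyMeasurable
  have hlintegral : ∫⁻ x, ENNReal.ofReal (f x) ∂(γ : Measure Ω) ≤ ENNReal.ofReal c := by
    calc ∫⁻ x, ENNReal.ofReal (f x) ∂(γ : Measure Ω)
        ≤ atTop.liminf fun i => ∫⁻ x, ENNReal.ofReal (f x) ∂(μ i : Measure Ω) :=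
          lintegral_le_liminf_lintegral_of_forall_isOpen_measure_le_liminf_measure hf hf_nonneg
            fun _ hG => ProbabilityMeasure.le_liminf_measure_open_of_tendsto hμ hG
      _ = ENNReal.ofReal c := by
          simp only [← ofReal_integral_eq_lintegral_ofReal (hint _) (ae_of_all _ hf_nonneg)]
          exact (ENNReal.tendsto_ofReal hc).liminf_eq
  refine ⟨⟨hmeas, ?_⟩, ?_⟩
  · rw [hasFiniteIntegral_iff_ofReal (ae_of_all _ hf_nonneg)]
    exact hlintegral.trans_lt ENNReal.ofReal_lt_top
  · rw [integral_eq_lintegral_of_nonneg_ae (ae_of_all _ hf_nonneg) hmeas]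
    exact ENNReal.toReal_le_of_le_ofReal
      (ge_of_tendsto' hc fun i => integral_nonneg hf_nonneg) hlintegral

/- By Fatou, `∫ (x ^ r + a) ^ 2 ∂γ ≤ m (2 * r) + 2 * a * m r + a ^ 2` for every real `a`. Since `a`
is arbitrary, the terms linear in `a` must agree. -/
lemma hasMoments_of_tendsto {μ : ℕ → ProbabilityMeasure ℝ} {γ : ProbabilityMeasure ℝ}
    {M : ℕ → ℕ → ℝ} {m : ℕ → ℝ} (h : Tendsto μ atTop (𝓝 γ)) (hμ : ∀ i, HasMoments (μ i) (M i))
    (hM : ∀ r, Tendsto (fun i => M i r) atTop (𝓝 (m r))) : HasMoments γ m := by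
  have hfatou (r : ℕ) (a : ℝ) : Integrable (fun x : ℝ => (x ^ r + a) ^ 2) (γ : Measure ℝ) ∧
      ∫ x, (x ^ r + a) ^ 2 ∂(γ : Measure ℝ) ≤ m (2 * r) + 2 * a * m r + a ^ 2 := by
    refine integral_le_of_tendsto_probabilityMeasure h
      (f := fun x => (x ^ r + a) ^ 2) (by fun_prop) (fun x => sq_nonneg _)
      (fun i => ((hμ i).integral_pow_add_sq r a).1) ?_
    simp only [((hμ _).integral_pow_add_sq r a).2]
    exact ((hM (2 * r)).add ((hM r).const_mul _)).add tendsto_const_nhds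
  have hint (r : ℕ) : Integrable (fun x : ℝ => x ^ r) (γ : Measure ℝ) := by
    have hpolarization := (((hfatou r 1).1.sub (hfatou r (-1)).1).div_const 4)
    exact hpolarization.congr (ae_of_all _ fun x => by simp only [Pi.sub_apply]; ring)
  have hself : HasMoments γ fun r => ∫ x, x ^ r ∂(γ : Measure ℝ) := fun r => ⟨hint r, rfl⟩
  refine fun r => ⟨hint r, ?_⟩
  set d := ∫ x, x ^ r ∂(γ : Measure ℝ) - m r
  set c := m (2 * r) - ∫ x, x ^ (2 * r) ∂(γ : Measure ℝ)
  have hlinear (a : ℝ) : 2 * a * d ≤ c := by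
    have := (hself.integral_pow_add_sq r a).2.symm.trans_le (hfatou r a).2
    linarith
  by_contra hne
  have hd_ne : d ≠ 0 := sub_ne_zero.2 hne
  have := hlinear ((c + 1) / (2 * d))
  rw [show 2 * ((c + 1) / (2 * d)) * d = c + 1 by field_simp] at this
  linarith

lemma isTightMeasureSet_of_integral_sq_le {S : Set (Measure ℝ)} (hS : ∀ μ ∈ S, IsFiniteMeasure μ)
    {C : ℝ} (hint : ∀ μ ∈ S, Integrable (fun x : ℝ => x ^ 2) μ)
    (hle : ∀ μ ∈ S, ∫ x, x ^ 2 ∂μ ≤ C) : IsTightMeasureSet S := by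
  refine isTightMeasureSet_of_tendsto_measure_norm_gt ?_
  have hlim : Tendsto (fun r : ℝ => ENNReal.ofReal (C / r ^ 2)) atTop (𝓝 0) := by
    rw [← ENNReal.ofReal_zero]
    exact ENNReal.tendsto_ofReal (tendsto_const_nhds.div_atTop (tendsto_pow_atTop two_ne_zero))
  refine tendsto_of_tendsto_of_tendsto_of_le_of_le' tendsto_const_nhds hlim
    (Eventually.of_forall fun _ => zero_le) ?_
  filter_upwards [eventually_gt_atTop 0] with r hr
  refine iSup₂_le fun μ hμ => ?_
  have := hS μ hμ
  have hsubset : {x : ℝ | r < ‖x‖} ⊆ {x : ℝ | r ^ 2 ≤ x ^ 2} := fun x (hx : r < |x|) =>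
    (sq_le_sq₀ hr.le (abs_nonneg x)).2 hx.le |>.trans_eq (sq_abs x)
  have hmarkov : μ.real {x : ℝ | r < ‖x‖} ≤ C / r ^ 2 := by
    rw [le_div_iff₀ (by positivity), mul_comm]
    calc r ^ 2 * μ.real {x : ℝ | r < ‖x‖} ≤ r ^ 2 * μ.real {x : ℝ | r ^ 2 ≤ x ^ 2} := by
          gcongr
          exact measure_ne_top _ _
      _ ≤ ∫ x, x ^ 2 ∂μ := mul_meas_ge_le_integral_of_nonneg
        (ae_of_all _ fun x => sq_nonneg x) (hint μ hμ) (r ^ 2)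
      _ ≤ C := hle μ hμ
  rw [← ofReal_measureReal]
  exact ENNReal.ofReal_le_ofReal hmarkov

lemma exists_hasMoments_of_tendsto {μ : ℕ → ProbabilityMeasure ℝ} {M : ℕ → ℕ → ℝ} {m : ℕ → ℝ}
    (hμ : ∀ i, HasMoments (μ i) (M i)) (hM : ∀ r, Tendsto (fun i => M i r) atTop (𝓝 (m r))) :
    ∃ γ : ProbabilityMeasure ℝ, HasMoments γ m := by
  obtain ⟨C, hC⟩ := (hM 2).bddAbove_range
  have htight : IsTightMeasureSet
      {((ν : ProbabilityMeasure ℝ) : Measure ℝ) | ν ∈ Set.range μ} := by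
    refine isTightMeasureSet_of_integral_sq_le (C := C) ?_ ?_ ?_ <;>
      rintro _ ⟨_, ⟨i, rfl⟩, rfl⟩
    · infer_instance
    · exact (hμ i 2).1
    · exact (hμ i 2).2.trans_le (hC ⟨i, rfl⟩)
  obtain ⟨γ, -, a, ha, hγ⟩ := (isCompact_closure_of_isTightMeasureSet htight).tendsto_subseq
    fun i => subset_closure (Set.mem_range_self i)
  exact ⟨γ, hasMoments_of_tendsto hγ (fun i => hμ (a i))
    fun r => (hM r).comp ha.tendsto_atTop⟩

end MomentMethod

section MomentProblem

variable {γ : ProbabilityMeasure ℝ} {m : ℕ → ℝ}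

lemma eq_of_hasMoments {μ : ProbabilityMeasure ℝ} (hμ : HasMoments μ m) (hγ : HasMoments γ m)
    (hm : ∀ t : ℝ, Tendsto (fun K : ℕ => t ^ (2 * K) / (2 * K)! * m (2 * K)) atTop (𝓝 0)) :
    (μ : Measure ℝ) = γ :=
  Measure.ext_of_charFun <| funext fun t => tendsto_nhds_unique tendsto_const_nhds
    (tendsto_charFun_of_hasMoments (l := (atTop : Filter ℕ)) hγ (fun _ => hμ)
      (fun _ => tendsto_const_nhds) hm t)

lemma HasMoments.map_neg {μ : Measure ℝ} (h : HasMoments μ m) (hodd : ∀ r, Odd r → m r = 0) :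
    HasMoments (μ.map fun t => -t) m := by
  intro r
  have hpow : (fun x : ℝ => (-x) ^ r) = fun x => (-1) ^ r * x ^ r := funext fun x => neg_pow x r
  constructor
  · rw [integrable_map_measure (by fun_prop) measurable_neg.aemeasurable, Function.comp_def, hpow]
    exact (h r).1.const_mul _
  · rw [integral_map measurable_neg.aemeasurable (by fun_prop), hpow, integral_const_mul, (h r).2]
    rcases r.even_or_odd with hr | hr
    · rw [hr.neg_one_pow, one_mul]
    · rw [hodd r hr, mul_zero]

lemma HasMoments.le_pow_of_ae_abs_le {μ : Measure ℝ} [IsProbabilityMeasure μ]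
    (h : HasMoments μ m) {R : ℝ} (hR : ∀ᵐ x ∂μ, |x| ≤ R) (k : ℕ) :
    m (2 * k) ≤ (R ^ 2) ^ k := by
  rw [← (h (2 * k)).2]
  calc ∫ x, x ^ (2 * k) ∂μ ≤ ∫ _, (R ^ 2) ^ k ∂μ := by
        refine integral_mono_ae (h (2 * k)).1 (integrable_const _) ?_
        filter_upwards [hR] with x hx
        rw [pow_mul]
        exact pow_le_pow_left₀ (sq_nonneg x) (sq_le_sq' (neg_le_of_abs_le hx) (le_of_abs_le hx)) k
    _ = (R ^ 2) ^ k := by rw [integral_const, probReal_univ, one_smul]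

end MomentProblem

section LimitLaw

/-- The moments of the limiting spectral distribution `γ_T`: the moment of order `2k` is the sum
of the volumes `p_T(w)` over the partition words `w` of length `2k`. -/
noncomputable def limitMoments : ℕ → ℝ :=
  evenMoments fun k => ∑ w ∈ partitionWords k, toeplitzVolume w

lemma limitMoments_two_mul (k : ℕ) :
    limitMoments (2 * k) = ∑ w ∈ partitionWords k, toeplitzVolume w := by
  rw [limitMoments, evenMoments, if_pos (even_two_mul k), Nat.mul_div_cancel_left k two_pos]

lemma limitMoments_of_odd {r : ℕ} (hr : Odd r) : limitMoments r = 0 :=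
  if_neg (Nat.not_even_iff_odd.2 hr)

lemma tendsto_pow_div_factorial_mul_limitMoments (t : ℝ) :
    Tendsto (fun K : ℕ => t ^ (2 * K) / (2 * K)! * limitMoments (2 * K)) atTop (𝓝 0) := by
  have ht (K : ℕ) : 0 ≤ t ^ (2 * K) := (even_two_mul K).pow_nonneg t
  have hnonneg (K : ℕ) : 0 ≤ ∑ w ∈ partitionWords K, toeplitzVolume w :=
    Finset.sum_nonneg fun w _ => toeplitzVolume_nonneg w
  simp only [limitMoments_two_mul]
  refine squeeze_zero (fun K => mul_nonneg (div_nonneg (ht K) (Nat.cast_nonneg _)) (hnonneg K))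
    (fun K => ?_) (FloorSemiring.tendsto_pow_div_factorial_atTop (2 * t ^ 2))
  have hfactorial : (K ! : ℝ) * ((K : ℝ) + 1) ^ K ≤ (2 * K)! := by
    rw [two_mul]
    exact_mod_cast Nat.factorial_mul_pow_le_factorial (m := K) (n := K)
  calc t ^ (2 * K) / (2 * K)! * ∑ w ∈ partitionWords K, toeplitzVolume w
      ≤ t ^ (2 * K) / (K ! * ((K : ℝ) + 1) ^ K) * (2 * ((K : ℝ) + 1)) ^ K := by
        gcongr
        · exact hnonneg K
        · exact div_nonneg (ht K) (by positivity)
        · exact ht K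
        · exact (sum_toeplitzVolume_le K).trans (by gcongr; linarith)
    _ = (2 * t ^ 2) ^ K / K ! := by
        rw [mul_pow, mul_pow, pow_mul]
        field_simp

variable {γ : ProbabilityMeasure ℝ}

lemma map_neg_eq_of_hasMoments (hγ : HasMoments γ limitMoments) :
    (γ : Measure ℝ).map (fun t => -t) = (γ : Measure ℝ) :=
  eq_of_hasMoments
    (μ := ⟨_, Measure.isProbabilityMeasure_map measurable_neg.aemeasurable⟩)
    (hγ.map_neg fun _ => limitMoments_of_odd) hγ tendsto_pow_div_factorial_mul_limitMoments

/-- A law supported in `[-R, R]` has moments of order `2k` at most `R ^ (2k)`, whereas here they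
are at least `k! / 2 ^ k`. -/
lemma not_isBounded_support_of_hasMoments (hγ : HasMoments γ limitMoments) :
    ¬ Bornology.IsBounded (γ : Measure ℝ).support := by
  intro hbounded
  obtain ⟨R, hR⟩ := hbounded.subset_closedBall 0
  have hae : ∀ᵐ x ∂(γ : Measure ℝ), |x| ≤ R := by
    filter_upwards [Measure.support_mem_ae (μ := (γ : Measure ℝ))] with x hx
    simpa using hR hx
  obtain ⟨k, hk⟩ := ((FloorSemiring.tendsto_pow_div_factorial_atTop (2 * R ^ 2)).eventually
    (gt_mem_nhds one_pos)).exists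
  have hmoment : (k ! : ℝ) / 2 ^ k ≤ (R ^ 2) ^ k :=
    (factorial_div_le_sum_toeplitzVolume k).trans
      ((limitMoments_two_mul k).symm.trans_le (hγ.le_pow_of_ae_abs_le hae k))
  rw [div_le_iff₀ (by positivity), ← mul_pow, mul_comm] at hmoment
  rw [div_lt_one (Nat.cast_pos.2 (Nat.factorial_pos k))] at hk
  exact hmoment.not_gt hk

lemma exists_isBoundedNoise : ∃ (P : Measure (ℕ → Bool)) (_ : IsProbabilityMeasure P)
    (Y : ℕ → (ℕ → Bool) → ℝ), IsBoundedNoise Y P 1 := by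
  let coin : Measure Bool := (PMF.uniformOfFintype Bool).toMeasure
  let sign : Bool → ℝ := fun b => if b then 1 else -1
  have hsign : Measurable sign := measurable_of_finite sign
  have hlaw (i : ℕ) : (Measure.infinitePi fun _ : ℕ => coin).map (fun ω => ω i) = coin :=
    Measure.infinitePi_map_eval (fun _ : ℕ => coin) i
  have hintegral (g : ℝ → ℝ) : ∫ ω : ℕ → Bool, g (sign (ω 1)) ∂(Measure.infinitePi fun _ => coin) =
      (g 1 + g (-1)) / 2 := by
    have hmap := integral_map (μ := Measure.infinitePi fun _ : ℕ => coin)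
      (measurable_pi_apply (X := fun _ => Bool) 1).aemeasurable
      (f := fun b => g (sign b)) (measurable_of_finite _).aestronglyMeasurable
    rw [← hmap, hlaw 1, PMF.integral_eq_sum]
    simp [sign]
    ring
  refine ⟨Measure.infinitePi fun _ => coin, inferInstance, fun i ω => sign (ω i),
    { measurable := fun i => hsign.comp (measurable_pi_apply i)
      indep := iIndepFun_infinitePi fun _ => hsign
      ident := fun i => ?_
      bound := fun i ω => ?_
      mean := by simpa using hintegral id
      var := (hintegral fun x => x ^ 2).trans (by norm_num) }⟩
  · refine IdentDistrib.comp (f := fun ω : ℕ → Bool => ω i) (g := fun ω : ℕ → Bool => ω 1)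
      ⟨(measurable_pi_apply i).aemeasurable, (measurable_pi_apply 1).aemeasurable, ?_⟩ hsign
    rw [hlaw, hlaw]
  · cases ω i <;> simp [sign]

lemma hasMoments_toeplitzMeasure (n : ℕ) [NeZero n] (x : ℕ → ℝ) :
    HasMoments (toeplitzMeasure n x) fun r => ∫ t, t ^ r ∂(toeplitzMeasure n x : Measure ℝ) :=
  fun _ => ⟨integrable_spectralMeasure _ _, rfl⟩

lemma exists_hasMoments_limitMoments : ∃ γ : ProbabilityMeasure ℝ, HasMoments γ limitMoments := by
  obtain ⟨P, hP, Y, hY⟩ := exists_isBoundedNoise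
  obtain ⟨ω, hω⟩ := (hY.ae_tendsto_moments tendsto_card_pairLoops).exists
  exact exists_hasMoments_of_tendsto
    (fun m => hasMoments_toeplitzMeasure ((m + 1) ^ 2) fun k => Y k ω) hω

end LimitLaw

section SquareSizes

variable {x : ℕ → ℝ} {C : ℝ}

lemma norm_charFun_toeplitzMeasure_sub_le_of_le {n N : ℕ} [NeZero n] [NeZero N]
    (hx : ∀ k, |x k| ≤ C) (h : N ≤ n) (t : ℝ) :
    ‖charFun (toeplitzMeasure n x : Measure ℝ) t - charFun (toeplitzMeasure N x : Measure ℝ) t‖ ≤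
      |t| * √(3 * C ^ 2 * (((n : ℝ) - N) / n)) + 2 * (((n : ℝ) - N) / n) := by
  obtain ⟨m, rfl⟩ := Nat.exists_eq_add_of_le h
  convert norm_charFun_toeplitzMeasure_add_size_sub_le hx t using 7 <;> push_cast <;> ring

lemma sub_sqrt_sq_div_le (n : ℕ) : ((n : ℝ) - (n.sqrt : ℝ) ^ 2) / n ≤ 2 / n.sqrt := by
  rcases n.eq_zero_or_pos with rfl | hn
  · simp
  have : (0 : ℝ) < n.sqrt := Nat.cast_pos.2 (Nat.sqrt_pos.2 hn)
  have hlower : (n.sqrt : ℝ) ^ 2 ≤ n := by exact_mod_cast Nat.sqrt_le' n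
  have hupper : (n : ℝ) ≤ n.sqrt * n.sqrt + n.sqrt + n.sqrt := by exact_mod_cast n.sqrt_le_add
  calc ((n : ℝ) - (n.sqrt : ℝ) ^ 2) / (n : ℝ) ≤ (2 * n.sqrt) / (n.sqrt : ℝ) ^ 2 := by
        gcongr
        linarith
    _ = 2 / (n.sqrt : ℝ) := by field_simp

lemma tendsto_charFun_toeplitzMeasure_of_squares (hx : ∀ k, |x k| ≤ C) {t : ℝ} {z : ℂ}
    (h : Tendsto (fun m => charFun (toeplitzMeasure ((m + 1) ^ 2) x : Measure ℝ) t) atTop (𝓝 z)) :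
    Tendsto (fun n => charFun (toeplitzMeasure (n + 1) x : Measure ℝ) t) atTop (𝓝 z) := by
  set root : ℕ → ℕ := fun n => (n + 1).sqrt - 1
  have hroot_add_one (n : ℕ) : root n + 1 = (n + 1).sqrt :=
    Nat.sub_add_cancel (Nat.sqrt_pos.2 n.succ_pos)
  have hroot_tendsto : Tendsto root atTop atTop := by
    refine tendsto_atTop_atTop.2 fun b => ⟨(b + 1) ^ 2, fun n hn => ?_⟩
    exact Nat.le_sub_of_add_le (Nat.le_sqrt'.2 (by omega))
  have hbound : Tendsto (fun s : ℕ => |t| * √(3 * C ^ 2 * (2 / ((s : ℝ) + 1))) +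
      2 * (2 / ((s : ℝ) + 1))) atTop (𝓝 0) := by
    have hinv : Tendsto (fun s : ℕ => 2 / ((s : ℝ) + 1)) atTop (𝓝 0) :=
      tendsto_const_nhds.div_atTop (tendsto_atTop_add_const_right _ _ tendsto_natCast_atTop_atTop)
    simpa using ((hinv.const_mul (3 * C ^ 2)).sqrt.const_mul |t|).add (hinv.const_mul 2)
  have hdiff : Tendsto (fun n => charFun (toeplitzMeasure (n + 1) x : Measure ℝ) t -
      charFun (toeplitzMeasure ((root n + 1) ^ 2) x : Measure ℝ) t) atTop (𝓝 0) := by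
    refine squeeze_zero_norm (fun n => ?_) (hbound.comp hroot_tendsto)
    have hle : (root n + 1) ^ 2 ≤ n + 1 := hroot_add_one n ▸ Nat.sqrt_le' (n + 1)
    have hratio : (((n + 1 : ℕ) : ℝ) - ((root n + 1) ^ 2 : ℕ)) / (n + 1 : ℕ) ≤
        2 / ((root n : ℝ) + 1) := by
      simpa [← hroot_add_one] using sub_sqrt_sq_div_le (n + 1)
    refine (norm_charFun_toeplitzMeasure_sub_le_of_le hx hle t).trans ?_
    simp only [Function.comp_apply]
    gcongr
  simpa only [Function.comp_apply, sub_add_cancel, zero_add] using hdiff.add (h.comp hroot_tendsto)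

lemma IsBoundedNoise.ae_tendsto_charFun {Ω : Type*} [MeasurableSpace Ω] {P : Measure Ω}
    [IsProbabilityMeasure P] {Y : ℕ → Ω → ℝ} (h : IsBoundedNoise Y P C)
    {γ : ProbabilityMeasure ℝ} (hγ : HasMoments γ limitMoments) :
    ∀ᵐ ω ∂P, ∀ t : ℝ, Tendsto
      (fun n => charFun (toeplitzMeasure (n + 1) fun k => Y k ω : Measure ℝ) t) atTop
      (𝓝 (charFun (γ : Measure ℝ) t)) := by
  filter_upwards [h.ae_tendsto_moments tendsto_card_pairLoops] with ω hω t
  exact tendsto_charFun_toeplitzMeasure_of_squares (fun k => h.bound k ω)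
    (tendsto_charFun_of_hasMoments hγ
      (fun m => hasMoments_toeplitzMeasure ((m + 1) ^ 2) fun k => Y k ω) hω
      tendsto_pow_div_factorial_mul_limitMoments t)

end SquareSizes

section Truncation

variable {α : Type*} [MeasurableSpace α] {ν : Measure α} {f h : α → ℝ}

lemma integral_sub_const_mul_sq (hf : MemLp f 2 ν) (hh : MemLp h 2 ν) (s : ℝ) :
    ∫ x, (f x - s * h x) ^ 2 ∂ν =
      ∫ x, f x ^ 2 ∂ν - 2 * s * ∫ x, f x * h x ∂ν + s ^ 2 * ∫ x, h x ^ 2 ∂ν := by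
  have hcross : Integrable (fun x => 2 * s * (f x * h x)) ν := (hf.integrable_mul hh).const_mul _
  have hsquare : Integrable (fun x => s ^ 2 * h x ^ 2) ν := hh.integrable_sq.const_mul _
  have hsub : Integrable (fun x => f x ^ 2 - 2 * s * (f x * h x)) ν := hf.integrable_sq.sub hcross
  have hexpand (x : α) :
      (f x - s * h x) ^ 2 = f x ^ 2 - 2 * s * (f x * h x) + s ^ 2 * h x ^ 2 := by
    ring
  simp only [hexpand]
  rw [integral_add hsub hsquare, integral_sub hf.integrable_sq hcross,
    integral_const_mul, integral_const_mul]

lemma integral_sub_normalized_sq_le (hf : MemLp f 2 ν) (hh : MemLp h 2 ν)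
    (hnorm : ∫ x, f x ^ 2 ∂ν = 1) (hclose : ∫ x, (f x - h x) ^ 2 ∂ν ≤ 1 / 4) :
    0 < ∫ x, h x ^ 2 ∂ν ∧ ∫ x, (f x - (√(∫ x, h x ^ 2 ∂ν))⁻¹ * h x) ^ 2 ∂ν ≤
      2 * ∫ x, (f x - h x) ^ 2 ∂ν := by
  have hdist := integral_sub_const_mul_sq hf hh
  simp only [hnorm] at hdist
  have hdist_one := hdist 1
  simp only [one_mul, mul_one, one_pow] at hdist_one
  have hdist_two : 0 ≤ 1 - 2 * 2 * ∫ x, f x * h x ∂ν + 2 ^ 2 * ∫ x, h x ^ 2 ∂ν :=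
    (integral_nonneg fun x => sq_nonneg _).trans_eq (hdist 2)
  have hclose_nonneg : 0 ≤ ∫ x, (f x - h x) ^ 2 ∂ν := integral_nonneg fun x => sq_nonneg _
  rw [hdist]
  set D := ∫ x, (f x - h x) ^ 2 ∂ν
  set a := ∫ x, f x * h x ∂ν
  set v := ∫ x, h x ^ 2 ∂ν
  have hv : 1 / 4 ≤ v := by linarith
  refine ⟨by linarith, ?_⟩
  set σ := √v
  have hσ_sq : σ ^ 2 = v := Real.sq_sqrt (by linarith)
  have hσ : 1 / 2 ≤ σ := Real.le_sqrt_of_sq_le (by linarith)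
  have hσ_pos : 0 < σ := by linarith
  rw [← hσ_sq] at hdist_one ⊢
  calc 1 - 2 * σ⁻¹ * a + σ⁻¹ ^ 2 * σ ^ 2 = (2 * σ - 2 * a) / σ := by
        field_simp
        ring
    _ ≤ D / σ := by
        gcongr
        linarith [sq_nonneg (1 - σ)]
    _ ≤ 2 * D := by
        rw [div_le_iff₀ hσ_pos]
        nlinarith

/-- Centering does not increase the distance in `L²` to a centered function. -/
lemma exists_bounded_centered [TopologicalSpace α] [NormalSpace α] [BorelSpace α]
    [IsProbabilityMeasure ν] [ν.WeaklyRegular] (hf : MemLp f 2 ν) (hmean : ∫ x, f x ∂ν = 0)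
    {ε : ℝ} (hε : 0 < ε) :
    ∃ g : α → ℝ, Measurable g ∧ (∃ C, ∀ x, |g x| ≤ C) ∧ ∫ x, g x ∂ν = 0 ∧
      ∫ x, (f x - g x) ^ 2 ∂ν ≤ ε := by
  obtain ⟨h, happrox, hmem⟩ := MemLp.exists_boundedContinuous_integral_rpow_sub_le (μ := ν)
    two_pos (by simpa using hf) hε
  simp only [Real.rpow_two, Real.norm_eq_abs, sq_abs] at happrox
  replace hmem : MemLp (⇑h) 2 ν := by simpa using hmem
  have hint : Integrable (⇑h) ν := hmem.integrable one_le_two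
  set c := ∫ x, h x ∂ν
  have hcentered : ∫ x, h x - c ∂ν = 0 := by
    rw [integral_sub hint (integrable_const c), integral_const, probReal_univ, one_smul, sub_self]
  have hmean_sub : ∫ x, (f - ⇑h) x ∂ν = -c := by
    rw [integral_sub' (hf.integrable one_le_two) hint, hmean, zero_sub]
  refine ⟨fun x => h x - c, h.continuous.measurable.sub_const c,
    ⟨‖h‖ + |c|, fun x => (abs_sub _ _).trans (by gcongr; exact h.norm_coe_le_norm x)⟩,
    hcentered, ?_⟩
  calc ∫ x, (f x - (h x - c)) ^ 2 ∂ν = Var[f - ⇑h; ν] := by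
        rw [variance_eq_integral (hf.1.sub hmem.1).aemeasurable, hmean_sub]
        simp only [Pi.sub_apply, sub_neg_eq_add, sub_sub_eq_add_sub, sub_add_eq_add_sub]
    _ ≤ ∫ x, ((f - ⇑h) ^ 2) x ∂ν := variance_le_expectation_sq (hf.1.sub hmem.1)
    _ ≤ ε := happrox

lemma exists_bounded_normalized [TopologicalSpace α] [NormalSpace α] [BorelSpace α]
    [IsProbabilityMeasure ν] [ν.WeaklyRegular] (hf : MemLp f 2 ν) (hmean : ∫ x, f x ∂ν = 0)
    (hnorm : ∫ x, f x ^ 2 ∂ν = 1) {ε : ℝ} (hε : 0 < ε) :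
    ∃ g : α → ℝ, Measurable g ∧ (∃ C, ∀ x, |g x| ≤ C) ∧ ∫ x, g x ∂ν = 0 ∧ ∫ x, g x ^ 2 ∂ν = 1 ∧
      ∫ x, (f x - g x) ^ 2 ∂ν ≤ ε := by
  obtain ⟨h, hmeas, ⟨C, hC⟩, hcentered, hclose⟩ := exists_bounded_centered hf hmean
    (show 0 < min (1 / 4) (ε / 2) by positivity)
  have hmem : MemLp h 2 ν := MemLp.of_bound hmeas.aestronglyMeasurable C (ae_of_all _ hC)
  obtain ⟨hpos, hdist⟩ :=
    integral_sub_normalized_sq_le hf hmem hnorm (hclose.trans (min_le_left _ _))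
  set σ := √(∫ x, h x ^ 2 ∂ν)
  refine ⟨fun x => σ⁻¹ * h x, hmeas.const_mul _, ⟨σ⁻¹ * C, fun x => ?_⟩, ?_, ?_, ?_⟩
  · rw [abs_mul, abs_of_nonneg (by positivity)]
    gcongr
    exact hC x
  · rw [integral_const_mul, hcentered, mul_zero]
  · simp only [mul_pow]
    rw [integral_const_mul, inv_pow, Real.sq_sqrt hpos.le, inv_mul_cancel₀ hpos.ne']
  · linarith [hclose.trans (min_le_right _ _)]

end Truncation

section AlmostSureConvergence

lemma eventually_norm_charFun_toeplitzMeasure_sub_lt {x y : ℕ → ℝ} {c δ t η : ℝ} {z : ℂ}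
    (hy : Tendsto (fun n => charFun (toeplitzMeasure (n + 1) y : Measure ℝ) t) atTop (𝓝 z))
    (havg : Tendsto (fun n : ℕ => (∑ k ∈ Finset.range n, (x k - c - y k) ^ 2) / n) atTop (𝓝 δ))
    (hη : |t| * √(2 * δ) < η) :
    ∀ᶠ n : ℕ in atTop, ‖charFun (toeplitzMeasure (n + 1) x : Measure ℝ) t - z‖ < η := by
  have hshift : Tendsto (fun n : ℕ => |t| * |c| / √((n + 1 : ℕ) : ℝ)) atTop (𝓝 0) :=
    tendsto_const_nhds.div_atTop (Real.tendsto_sqrt_atTop.comp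
      (tendsto_natCast_atTop_atTop.comp (tendsto_add_atTop_nat 1)))
  have htruncation : Tendsto (fun n : ℕ => |t| * √(2 * ((∑ k ∈ Finset.range (n + 1),
      (x k - c - y k) ^ 2) / (n + 1 : ℕ)))) atTop (𝓝 (|t| * √(2 * δ))) :=
    ((havg.comp (tendsto_add_atTop_nat 1)).const_mul 2).sqrt.const_mul |t|
  have hlimit := (hshift.add htruncation).add (tendsto_iff_norm_sub_tendsto_zero.1 hy)
  rw [zero_add, add_zero] at hlimit
  filter_upwards [hlimit.eventually (gt_mem_nhds hη)] with n hn
  refine lt_of_le_of_lt ?_ hn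
  have hdist_shift := norm_charFun_toeplitzMeasure_add_const_sub_le (n := n + 1)
    (fun k => x k - c) c t
  have hdist_truncation := norm_charFun_toeplitzMeasure_sub_le (n := n + 1) (fun k => x k - c) y t
  simp only [sub_add_cancel, ← dist_eq_norm] at hdist_shift hdist_truncation ⊢
  exact (dist_triangle4 _ _ _ _).trans (add_le_add_left (add_le_add hdist_shift hdist_truncation) _)

variable {Ω : Type*} [MeasurableSpace Ω] {P : Measure Ω} {X : ℕ → Ω → ℝ}

lemma ae_tendsto_average_comp (hind : iIndepFun X P) (hid : ∀ i, IdentDistrib (X i) (X 1) P P)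
    {g : ℝ → ℝ} (hg : Measurable g) (hint : Integrable (fun ω => g (X 1 ω)) P) :
    ∀ᵐ ω ∂P, Tendsto (fun n : ℕ => (∑ k ∈ Finset.range n, g (X k ω)) / n) atTop
      (𝓝 (∫ ω, g (X 1 ω) ∂P)) := by
  have hident (i j : ℕ) : IdentDistrib (fun ω => g (X i ω)) (fun ω => g (X j ω)) P P :=
    ((hid i).trans (hid j).symm).comp hg
  rw [← (hident 0 1).integral_eq]
  exact strong_law_ae_real (fun k ω => g (X k ω)) ((hident 0 1).integrable_iff.2 hint)
    (fun i j hij => (hind.comp (fun _ => g) fun _ => hg).indepFun hij) fun i => hident i 0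

variable [IsProbabilityMeasure P]

lemma exists_isBoundedNoise_comp (hX : ∀ i, Measurable (X i)) (hind : iIndepFun X P)
    (hid : ∀ i, IdentDistrib (X i) (X 1) P P) (hvar : Var[X 1; P] = 1) {ε : ℝ} (hε : 0 < ε) :
    ∃ g : ℝ → ℝ, Measurable g ∧ (∃ C, IsBoundedNoise (fun k ω => g (X k ω)) P C) ∧
      MemLp (X 1) 2 P ∧ ∫ ω, (X 1 ω - P[X 1] - g (X 1 ω)) ^ 2 ∂P ≤ ε := by
  have hmem : MemLp (X 1) 2 P := by
    by_contra hnot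
    rw [variance_of_not_memLp (hX 1).aestronglyMeasurable hnot] at hvar
    exact zero_ne_one hvar
  set c := P[X 1]
  have : IsProbabilityMeasure (P.map (X 1)) :=
    Measure.isProbabilityMeasure_map (hX 1).aemeasurable
  have hmap {f : ℝ → ℝ} (hf : Measurable f) : ∫ x, f x ∂(P.map (X 1)) = ∫ ω, f (X 1 ω) ∂P :=
    integral_map (hX 1).aemeasurable hf.aestronglyMeasurable
  have hsub : Measurable fun x : ℝ => x - c := measurable_id.sub_const c
  have hmean : ∫ x, x - c ∂(P.map (X 1)) = 0 := by
    rw [hmap hsub, integral_sub (hmem.integrable one_le_two) (integrable_const c), integral_const,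
      probReal_univ, one_smul, sub_self]
  have hnorm : ∫ x, (x - c) ^ 2 ∂(P.map (X 1)) = 1 := by
    rw [hmap (hsub.pow_const 2), ← hvar, variance_eq_integral (hX 1).aemeasurable]
  obtain ⟨g, hg, ⟨C, hC⟩, hg_mean, hg_norm, hg_dist⟩ := exists_bounded_normalized
    ((memLp_map_measure_iff hsub.aestronglyMeasurable (hX 1).aemeasurable).2
      (hmem.sub (memLp_const c))) hmean hnorm hε
  rw [hmap hg] at hg_mean
  rw [hmap (hg.pow_const 2)] at hg_norm
  rw [hmap (f := fun x => (x - c - g x) ^ 2) ((hsub.sub hg).pow_const 2)] at hg_dist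
  exact ⟨g, hg, ⟨C, fun i => hg.comp (hX i), hind.comp (fun _ => g) fun _ => hg,
    fun i => (hid i).comp hg, fun i ω => hC _, hg_mean, hg_norm⟩, hmem, hg_dist⟩

lemma ae_eventually_norm_charFun_sub_lt (hX : ∀ i, Measurable (X i)) (hind : iIndepFun X P)
    (hid : ∀ i, IdentDistrib (X i) (X 1) P P) (hvar : Var[X 1; P] = 1)
    {γ : ProbabilityMeasure ℝ} (hγ : HasMoments γ limitMoments) {ε : ℝ} (hε : 0 < ε) :
    ∀ᵐ ω ∂P, ∀ t : ℝ, ∀ η > |t| * √(2 * ε), ∀ᶠ n : ℕ in atTop,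
      ‖charFun (toeplitzMeasure (n + 1) fun k => X k ω : Measure ℝ) t -
        charFun (γ : Measure ℝ) t‖ < η := by
  obtain ⟨g, hg, ⟨C, hnoise⟩, hmem, hdist⟩ := exists_isBoundedNoise_comp hX hind hid hvar hε
  have hmem_noise : MemLp (fun ω => g (X 1 ω)) 2 P :=
    MemLp.of_bound (hnoise.measurable 1).aestronglyMeasurable C (ae_of_all _ (hnoise.bound 1))
  have hlaw := ae_tendsto_average_comp (g := fun x => (x - P[X 1] - g x) ^ 2) hind hid
    (((measurable_id.sub_const P[X 1]).sub hg).pow_const 2)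
    ((hmem.sub (memLp_const P[X 1])).sub hmem_noise).integrable_sq
  filter_upwards [hlaw, hnoise.ae_tendsto_charFun hγ] with ω haverage hcharFun t η hη
  refine eventually_norm_charFun_toeplitzMeasure_sub_lt (hcharFun t) haverage (lt_of_le_of_lt ?_ hη)
  gcongr

lemma ae_tendsto_toeplitzMeasure (hX : ∀ i, Measurable (X i)) (hind : iIndepFun X P)
    (hid : ∀ i, IdentDistrib (X i) (X 1) P P) (hvar : Var[X 1; P] = 1)
    {γ : ProbabilityMeasure ℝ} (hγ : HasMoments γ limitMoments) :
    ∀ᵐ ω ∂P, Tendsto (fun n : ℕ => toeplitzMeasure (n + 1) fun k => X k ω) atTop (𝓝 γ) := by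
  have happrox : ∀ᵐ ω ∂P, ∀ j : ℕ, ∀ t : ℝ, ∀ η > |t| * √(2 * (1 / ((j : ℝ) + 1))),
      ∀ᶠ n : ℕ in atTop,
      ‖charFun (toeplitzMeasure (n + 1) fun k => X k ω : Measure ℝ) t -
        charFun (γ : Measure ℝ) t‖ < η :=
    ae_all_iff.2 fun j => ae_eventually_norm_charFun_sub_lt hX hind hid hvar hγ (by positivity)
  filter_upwards [happrox] with ω hω
  refine ProbabilityMeasure.tendsto_iff_tendsto_charFun.2 fun t => ?_
  refine Metric.tendsto_nhds.2 fun η hη => ?_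
  have hlim : Tendsto (fun j : ℕ => |t| * √(2 * (1 / ((j : ℝ) + 1)))) atTop (𝓝 0) := by
    simpa using
      ((tendsto_one_div_add_atTop_nhds_zero_nat (𝕜 := ℝ)).const_mul 2).sqrt.const_mul |t|
  obtain ⟨j, hj⟩ := (hlim.eventually (gt_mem_nhds hη)).exists
  simpa only [dist_eq_norm] using hω j t η hj

end AlmostSureConvergence

section Circle

/-- The representative in `[0, 1)` of a point of the circle. -/
noncomputable def circleRep (y : UnitAddCircle) : ℝ := (AddCircle.equivIco 1 0 y : ℝ)

lemma circleRep_mem_Ico (y : UnitAddCircle) : circleRep y ∈ Set.Ico (0 : ℝ) 1 :=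
  (zero_add (1 : ℝ)) ▸ (AddCircle.equivIco (1 : ℝ) 0 y).2

lemma coe_circleRep (y : UnitAddCircle) : (circleRep y : UnitAddCircle) = y :=
  AddCircle.coe_equivIco

lemma circleRep_eq {v : ℝ} (hv : v ∈ Set.Ico (0 : ℝ) 1) {y : UnitAddCircle}
    (h : (v : UnitAddCircle) = y) : circleRep y = v := by
  rw [← h]
  exact AddCircle.equivIco_coe_of_mem (by rwa [zero_add])

lemma circleRep_injective : Function.Injective circleRep :=
  Function.LeftInverse.injective coe_circleRep

lemma measurable_circleRep : Measurable circleRep :=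
  measurable_subtype_coe.comp (AddCircle.measurableEquivIco 1 0).measurable

lemma circleRep_sub_of_le {x y : UnitAddCircle} (h : circleRep y ≤ circleRep x) :
    circleRep (x - y) = circleRep x - circleRep y := by
  have hx := circleRep_mem_Ico x
  have hy := circleRep_mem_Ico y
  refine circleRep_eq ⟨by linarith, by linarith [hx.2, hy.1]⟩ ?_
  rw [AddCircle.coe_sub, coe_circleRep, coe_circleRep]

lemma circleRep_sub_of_lt {x y : UnitAddCircle} (h : circleRep x < circleRep y) :
    circleRep (x - y) = circleRep x - circleRep y + 1 := by
  have hx := circleRep_mem_Ico x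
  have hy := circleRep_mem_Ico y
  refine circleRep_eq ⟨by linarith [hx.1, hy.2], by linarith⟩ ?_
  rw [AddCircle.coe_add, AddCircle.coe_sub, coe_circleRep, coe_circleRep, AddCircle.coe_period,
    add_zero]

lemma circleRep_zero : circleRep 0 = 0 := circleRep_eq ⟨le_rfl, one_pos⟩ (AddCircle.coe_zero 1)

lemma circleRep_pos {y : UnitAddCircle} (hy : y ≠ 0) : 0 < circleRep y :=
  (circleRep_mem_Ico y).1.lt_of_ne' <| circleRep_zero ▸ circleRep_injective.ne hy

lemma circleRep_neg {y : UnitAddCircle} (hy : y ≠ 0) : circleRep (-y) = 1 - circleRep y := by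
  have hlt : circleRep 0 < circleRep y := circleRep_zero.trans_lt (circleRep_pos hy)
  rw [← zero_sub, circleRep_sub_of_lt hlt, circleRep_zero]
  ring

end Circle

section Torus

instance isProbabilityMeasure_volume_circle :
    IsProbabilityMeasure (volume : Measure UnitAddCircle) :=
  ⟨UnitAddCircle.measure_univ⟩

variable {ι κ : Type*} [Fintype ι] [Fintype κ]

lemma volume_circle_singleton (y : UnitAddCircle) : volume {y} = 0 := by
  rw [← Metric.closedBall_zero, AddCircle.volume_closedBall]
  simp

lemma measurePreserving_torus_hom {f : (ι → UnitAddCircle) →+ (κ → UnitAddCircle)}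
    (hf : Continuous f) (hsurj : Function.Surjective f) : MeasurePreserving f volume volume :=
  f.measurePreserving hf hsurj (by rw [measure_univ, measure_univ])

lemma ae_torus_hom_ne_zero {f : (ι → UnitAddCircle) →+ UnitAddCircle} (hf : Continuous f)
    (hsurj : Function.Surjective f) : ∀ᵐ u : ι → UnitAddCircle, f u ≠ 0 := by
  have hmp : MeasurePreserving f volume volume :=
    f.measurePreserving hf hsurj (by rw [measure_univ, measure_univ])
  exact hmp.quasiMeasurePreserving.ae (measure_eq_zero_iff_ae_notMem.1 (volume_circle_singleton 0))

lemma ae_torus_apply_ne_zero (i : ι) : ∀ᵐ u : ι → UnitAddCircle, u i ≠ 0 :=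
  ae_torus_hom_ne_zero (f := Pi.evalAddMonoidHom (fun _ : ι => UnitAddCircle) i)
    (continuous_apply i) (Function.surjective_eval i)

lemma ae_torus_apply_ne_apply {i j : ι} (hij : i ≠ j) : ∀ᵐ u : ι → UnitAddCircle, u i ≠ u j := by
  classical
  let coord (k : ι) := Pi.evalAddMonoidHom (fun _ : ι => UnitAddCircle) k
  have hsub : ∀ᵐ u : ι → UnitAddCircle, (coord i - coord j) u ≠ 0 :=
    ae_torus_hom_ne_zero ((continuous_apply i).sub (continuous_apply j))
      fun y => ⟨Pi.single i y, by simp [coord, hij.symm]⟩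
  filter_upwards [hsub] with u hu
  exact sub_ne_zero.1 hu

lemma ae_torus_injective : ∀ᵐ u : ι → UnitAddCircle, Function.Injective u := by
  have hne : ∀ᵐ u : ι → UnitAddCircle, ∀ i j : ι, i ≠ j → u i ≠ u j := by
    simp only [ae_all_iff]
    exact fun i j => ae_torus_apply_ne_apply
  filter_upwards [hne] with u hu i j
  exact not_imp_not.1 (hu i j)

lemma measurePreserving_coe_torus :
    MeasurePreserving (fun (u : ι → ℝ) i => (u i : UnitAddCircle))
      (volume.restrict (Set.univ.pi fun _ => Set.Ico (0 : ℝ) 1)) volume := by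
  rw [volume_pi, Measure.restrict_pi_pi]
  refine measurePreserving_pi _ _ fun _ => ?_
  rw [Measure.restrict_congr_set Ico_ae_eq_Ioc]
  simpa only [zero_add] using AddCircle.measurePreserving_mk 1 0

lemma volume_real_torus_preimage {s : Set (ι → ℝ)} (hs : MeasurableSet s)
    (hsub : s ⊆ Set.univ.pi fun _ => Set.Icc (0 : ℝ) 1) :
    volume.real {y : ι → UnitAddCircle | (fun i => circleRep (y i)) ∈ s} = volume.real s := by
  have hpreimage : MeasurableSet {y : ι → UnitAddCircle | (fun i => circleRep (y i)) ∈ s} :=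
    (measurable_pi_iff.2 fun i => measurable_circleRep.comp (measurable_pi_apply i)) hs
  rw [← measurePreserving_coe_torus.measureReal_preimage hpreimage.nullMeasurableSet,
    measureReal_restrict_apply (measurePreserving_coe_torus.measurable hpreimage)]
  have hcube : (Set.univ.pi fun _ : ι => Set.Ico (0 : ℝ) 1) =ᵐ[volume]
      Set.univ.pi fun _ : ι => Set.Icc (0 : ℝ) 1 := Measure.pi_Ico_ae_eq_pi_Icc
  have hinter : volume.real (s ∩ Set.univ.pi fun _ => Set.Ico (0 : ℝ) 1) = volume.real s := by
    rw [measureReal_congr ((ae_eq_refl s).inter hcube), Set.inter_eq_left.2 hsub]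
  rw [← hinter]
  congr 1
  ext u
  refine and_congr_left fun hu => ?_
  have hrep : (fun i => circleRep (u i : UnitAddCircle)) = u :=
    funext fun i => circleRep_eq (hu i trivial) rfl
  rw [Set.mem_preimage, Set.mem_ofPred_eq, hrep]

end Torus

section Rises

/-- The number of rises of a finite sequence, the first position always counting as a rise. -/
def riseCount {α : Type*} [LinearOrder α] {n : ℕ} (f : Fin n → α) : ℕ :=
  (Finset.univ.filter fun i : Fin n => ∀ j : Fin n, (j : ℕ) + 1 = (i : ℕ) → f j < f i).card

variable {α β : Type*} [LinearOrder α] [LinearOrder β] {n : ℕ}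

lemma riseCount_congr {f : Fin n → α} {g : Fin n → β} (h : ∀ i j, f i < f j ↔ g i < g j) :
    riseCount f = riseCount g := by
  simp only [riseCount, h]

lemma riseCount_succ (f : Fin (n + 1) → α) :
    riseCount f = 1 + ∑ i : Fin n, if f i.castSucc < f i.succ then 1 else 0 := by
  have hrise : ∀ i : Fin n,
      (∀ j : Fin (n + 1), (j : ℕ) + 1 = i.succ → f j < f i.succ) ↔ f i.castSucc < f i.succ :=
    fun i => ⟨fun h => h i.castSucc (by simp),
      fun h j hj => (Fin.ext (by simpa using hj) : j = i.castSucc) ▸ h⟩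
  rw [riseCount, Finset.card_filter, Fin.sum_univ_succ]
  simp only [hrise]
  simp

lemma exists_perm_lt_iff {f : Fin n → α} (hf : Function.Injective f) :
    ∃ σ : Equiv.Perm (Fin n), ∀ i j, f i < f j ↔ σ i < σ j := by
  have hmono : StrictMono (f ∘ Tuple.sort f) :=
    (Tuple.monotone_sort f).strictMono_of_injective (hf.comp (Tuple.sort f).injective)
  refine ⟨(Tuple.sort f)⁻¹, fun i j => ?_⟩
  rw [← hmono.lt_iff_lt]
  simp

lemma perm_eq_of_lt_iff {σ τ : Equiv.Perm (Fin n)} (h : ∀ i j, σ i < σ j ↔ τ i < τ j) :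
    σ = τ := by
  let e : Fin n ≃o Fin n :=
    { toEquiv := σ⁻¹.trans τ
      map_rel_iff' := fun {i j} => by simpa using not_congr (h (σ⁻¹ j) (σ⁻¹ i)).symm }
  have hrefl : e = OrderIso.refl _ := Subsingleton.elim _ _
  ext i
  have happly : e (σ i) = τ i := by simp [e]
  rw [← happly, hrefl, OrderIso.refl_apply]

end Rises

section OrderCells

variable {n : ℕ}

/-- The part of the torus on which the coordinates are ordered as the values of `σ`. -/
def orderCell (σ : Equiv.Perm (Fin n)) : Set (Fin n → UnitAddCircle) :=
  {x | ∀ i j, circleRep (x i) < circleRep (x j) ↔ σ i < σ j}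

lemma measurableSet_orderCell (σ : Equiv.Perm (Fin n)) : MeasurableSet (orderCell σ) := by
  have hlt : ∀ i j, MeasurableSet {x : Fin n → UnitAddCircle | circleRep (x i) < circleRep (x j)} :=
    fun i j => measurableSet_lt (measurable_circleRep.comp (measurable_pi_apply i))
      (measurable_circleRep.comp (measurable_pi_apply j))
  simp only [orderCell, Set.ofPred_forall]
  exact MeasurableSet.iInter fun i => MeasurableSet.iInter fun j =>
    (hlt i j).iff (MeasurableSet.const _)

lemma perm_eq_of_mem_orderCell {σ τ : Equiv.Perm (Fin n)} {x : Fin n → UnitAddCircle}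
    (hσ : x ∈ orderCell σ) (hτ : x ∈ orderCell τ) : σ = τ :=
  perm_eq_of_lt_iff fun i j => (hσ i j).symm.trans (hτ i j)

lemma volume_real_orderCell_eq (σ : Equiv.Perm (Fin n)) :
    volume.real (orderCell σ) = volume.real (orderCell (1 : Equiv.Perm (Fin n))) := by
  have hmp := volume_measurePreserving_piCongrLeft (fun _ : Fin n => UnitAddCircle) σ
  rw [← hmp.measureReal_preimage (measurableSet_orderCell 1).nullMeasurableSet]
  congr 1
  ext x
  refine Iff.trans ?_ σ.surjective.forall₂.symm
  simp only [MeasurableEquiv.piCongrLeft_apply_apply]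
  rfl

lemma ae_exists_mem_orderCell :
    ∀ᵐ x : Fin n → UnitAddCircle, ∃ σ : Equiv.Perm (Fin n), x ∈ orderCell σ := by
  filter_upwards [ae_torus_injective] with x hx
  exact exists_perm_lt_iff (circleRep_injective.comp hx)

lemma volume_real_biUnion_orderCell (S : Finset (Equiv.Perm (Fin n))) :
    volume.real (⋃ σ ∈ S, orderCell σ) =
      S.card * volume.real (orderCell (1 : Equiv.Perm (Fin n))) := by
  have hdisj : (S : Set (Equiv.Perm (Fin n))).PairwiseDisjoint orderCell := fun σ _ τ _ hne =>
    Set.disjoint_left.2 fun _ hσ hτ => hne (perm_eq_of_mem_orderCell hσ hτ)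
  rw [measureReal_biUnion_finset hdisj fun σ _ => measurableSet_orderCell σ,
    Finset.sum_congr rfl fun σ _ => volume_real_orderCell_eq σ, Finset.sum_const, nsmul_eq_mul]

lemma volume_real_orderCell_one :
    volume.real (orderCell (1 : Equiv.Perm (Fin n))) = 1 / (n ! : ℝ) := by
  have hcover : volume.real (⋃ σ ∈ Finset.univ, orderCell (n := n) σ) = 1 := by
    refine (measureReal_congr (eventuallyEq_univ.2 ?_)).trans probReal_univ
    filter_upwards [ae_exists_mem_orderCell (n := n)] with x hx
    simpa using hx
  rw [volume_real_biUnion_orderCell, Finset.card_univ, Fintype.card_perm, Fintype.card_fin]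
    at hcover
  rw [eq_div_iff (Nat.cast_ne_zero.2 (Nat.factorial_ne_zero n)), mul_comm, hcover]

lemma volume_real_riseCount_eq (m : ℕ) :
    volume.real {x : Fin n → UnitAddCircle | riseCount (fun i => circleRep (x i)) = m} =
      (eulerianNumber n m : ℝ) / n ! := by
  have hnum : eulerianNumber n m =
      (Finset.univ.filter fun σ : Equiv.Perm (Fin n) => riseCount σ = m).card := rfl
  rw [hnum, div_eq_mul_one_div, ← volume_real_orderCell_one, ← volume_real_biUnion_orderCell]
  refine measureReal_congr ?_
  filter_upwards [ae_exists_mem_orderCell (n := n)] with x ⟨σ, hσ⟩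
  refine propext ?_
  change riseCount (fun i => circleRep (x i)) = m ↔ x ∈ ⋃ τ ∈ _, orderCell τ
  rw [riseCount_congr hσ, Set.mem_iUnion₂]
  refine ⟨fun h => ⟨σ, (Finset.mem_filter_univ σ).2 h, hσ⟩, ?_⟩
  rintro ⟨τ, hτ, hx⟩
  rw [perm_eq_of_mem_orderCell hσ hx]
  exact (Finset.mem_filter_univ τ).1 hτ

end OrderCells

section CircleIncrements

variable {p : ℕ}

/-- The increments of a sequence of points of the circle that starts from the origin. -/
def circleIncrements (p : ℕ) :
    (Fin (p + 1) → UnitAddCircle) →+ (Fin (p + 1) → UnitAddCircle) where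
  toFun x := Fin.cons (x 0) fun i : Fin p => x i.succ - x i.castSucc
  map_zero' := by
    ext i
    cases i using Fin.cases <;> simp
  map_add' x y := by
    ext i
    cases i using Fin.cases
    · simp
    · simp only [Fin.cons_succ, Pi.add_apply]
      abel

lemma circleIncrements_zero (x : Fin (p + 1) → UnitAddCircle) : circleIncrements p x 0 = x 0 := rfl

lemma circleIncrements_succ (x : Fin (p + 1) → UnitAddCircle) (i : Fin p) :
    circleIncrements p x i.succ = x i.succ - x i.castSucc := rfl

lemma measurePreserving_circleIncrements (p : ℕ) :
    MeasurePreserving (circleIncrements p) volume volume := by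
  refine measurePreserving_torus_hom (continuous_pi fun i => ?_) fun y =>
    ⟨fun i => Fin.partialSum y i.succ, funext fun i => ?_⟩
  · cases i using Fin.cases with
    | zero => exact continuous_apply 0
    | succ j => exact (continuous_apply j.succ).sub (continuous_apply j.castSucc)
  · cases i using Fin.cases with
    | zero => simp [circleIncrements_zero, Fin.partialSum_succ]
    | succ j =>
      rw [circleIncrements_succ, Fin.partialSum_succ, Fin.succ_castSucc, add_sub_cancel_left]

lemma sum_circleRep_circleIncrements {x : Fin (p + 1) → UnitAddCircle}
    (hx : Function.Injective x) :
    ∑ i, circleRep (circleIncrements p x i) =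
      circleRep (x (Fin.last p)) + ((p : ℝ) + 1 - riseCount fun i => circleRep (x i)) := by
  have hincrement : ∀ i : Fin p, circleRep (circleIncrements p x i.succ) =
      (circleRep (x i.succ) - circleRep (x i.castSucc)) +
        (1 - if circleRep (x i.castSucc) < circleRep (x i.succ) then 1 else 0) := by
    intro i
    rw [circleIncrements_succ]
    split_ifs with hrise
    · rw [circleRep_sub_of_le hrise.le]
      ring
    · have hne : circleRep (x i.succ) ≠ circleRep (x i.castSucc) :=
        circleRep_injective.ne (hx.ne Fin.castSucc_lt_succ.ne')
      rw [circleRep_sub_of_lt ((not_lt.1 hrise).lt_of_ne hne), sub_zero]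
  have htelescope : circleRep (x 0) + ∑ i : Fin p, (circleRep (x i.succ) - circleRep (x i.castSucc))
      = circleRep (x (Fin.last p)) := by
    rw [Finset.sum_sub_distrib, ← add_sub_assoc, ← Fin.sum_univ_succ fun i => circleRep (x i),
      Fin.sum_univ_castSucc, add_sub_cancel_left]
  rw [Fin.sum_univ_succ, circleIncrements_zero, Finset.sum_congr rfl fun i _ => hincrement i,
    Finset.sum_add_distrib, ← add_assoc, htelescope, riseCount_succ, Finset.sum_sub_distrib]
  push_cast
  simp only [Finset.sum_const, Finset.card_univ, Fintype.card_fin, nsmul_eq_mul, mul_one]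
  ring

lemma measurableSet_sum_circleRep_sub_mem (b : ℕ) :
    MeasurableSet {y : Fin p → UnitAddCircle | ∑ i, circleRep (y i) - b ∈ Set.Icc (0 : ℝ) 1} :=
  ((Finset.measurable_fun_sum _ fun i _ =>
    measurable_circleRep.comp (measurable_pi_apply i)).sub_const (b : ℝ)) measurableSet_Icc

lemma volume_real_sum_circleRep_sub_mem {a b : ℕ} (hab : a + b = p + 1) :
    volume.real {y : Fin (p + 1) → UnitAddCircle |
      ∑ i, circleRep (y i) - b ∈ Set.Icc (0 : ℝ) 1} =
        (eulerianNumber (p + 1) a : ℝ) / (p + 1)! := by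
  rw [← volume_real_riseCount_eq, ← (measurePreserving_circleIncrements p).measureReal_preimage
    (measurableSet_sum_circleRep_sub_mem b).nullMeasurableSet]
  refine measureReal_congr ?_
  filter_upwards [ae_torus_injective, ae_torus_apply_ne_zero (Fin.last p)] with x hinj hlast
  refine propext ?_
  change ∑ i, circleRep (circleIncrements p x i) - b ∈ Set.Icc (0 : ℝ) 1 ↔
    riseCount (fun i => circleRep (x i)) = a
  rw [sum_circleRep_circleIncrements hinj]
  have hpos : 0 < circleRep (x (Fin.last p)) := circleRep_pos hlast
  have hlt : circleRep (x (Fin.last p)) < 1 := (circleRep_mem_Ico _).2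
  have hcast : (a : ℝ) + b = p + 1 := mod_cast hab
  set r := riseCount fun i => circleRep (x i)
  constructor
  · rintro ⟨hnonneg, hle⟩
    have hra : (r : ℝ) < (a + 1 : ℕ) := by push_cast; linarith
    have har : (a : ℝ) < (r + 1 : ℕ) := by push_cast; linarith
    rw [Nat.cast_lt] at hra har
    omega
  · intro hr
    rw [hr]
    constructor <;> linarith

end CircleIncrements

section EulerianVolume

variable {ι κ : Type*} [DecidableEq ι]

/-- The coordinates along `e` of a point of the torus, with those outside `A` reflected. -/
def reflectedCoordinates (A : Finset ι) (e : κ ↪ ι) :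
    (ι → UnitAddCircle) →+ (κ → UnitAddCircle) where
  toFun u j := if e j ∈ A then u (e j) else -u (e j)
  map_zero' := by
    ext j
    simp
  map_add' u v := by
    ext j
    simp only [Pi.add_apply]
    split_ifs
    · rfl
    · rw [neg_add]

lemma reflectedCoordinates_apply (A : Finset ι) (e : κ ↪ ι) (u : ι → UnitAddCircle) (j : κ) :
    reflectedCoordinates A e u j = if e j ∈ A then u (e j) else -u (e j) := rfl

lemma continuous_reflectedCoordinates (A : Finset ι) (e : κ ↪ ι) :
    Continuous (reflectedCoordinates A e) := by
  refine continuous_pi fun j => ?_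
  simp only [reflectedCoordinates_apply]
  split_ifs
  · exact continuous_apply _
  · exact (continuous_apply _).neg

lemma surjective_reflectedCoordinates (A : Finset ι) (e : κ ↪ ι) :
    Function.Surjective (reflectedCoordinates A e) := fun y => by
  refine ⟨Function.extend e (fun j => if e j ∈ A then y j else -y j) 0, funext fun j => ?_⟩
  rw [reflectedCoordinates_apply, e.injective.extend_apply]
  split_ifs
  · rfl
  · rw [neg_neg]

lemma sum_circleRep_reflectedCoordinates [Fintype κ] {A B : Finset ι} (hdisj : Disjoint A B)
    {e : κ ↪ ι} (he : Finset.univ.map e = A ∪ B) {u : ι → UnitAddCircle} (hu : ∀ i ∈ B, u i ≠ 0) :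
    ∑ j, circleRep (reflectedCoordinates A e u j) - B.card =
      ∑ i ∈ A, circleRep (u i) - ∑ i ∈ B, circleRep (u i) := by
  have hB : ∀ i ∈ B, circleRep (if i ∈ A then u i else -u i) = 1 - circleRep (u i) :=
    fun i hi => by rw [if_neg (Finset.disjoint_right.1 hdisj hi), circleRep_neg (hu i hi)]
  have hA : ∀ i ∈ A, circleRep (if i ∈ A then u i else -u i) = circleRep (u i) :=
    fun i hi => by rw [if_pos hi]
  simp only [reflectedCoordinates_apply]
  rw [← Finset.sum_map Finset.univ e fun i => circleRep (if i ∈ A then u i else -u i), he,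
    Finset.sum_union hdisj, Finset.sum_congr rfl hA, Finset.sum_congr rfl hB,
    Finset.sum_sub_distrib, Finset.sum_const, nsmul_one]
  ring

lemma measurableSet_eulerianSolid {d : ℕ} (A B : Finset (Fin d)) :
    MeasurableSet (eulerianSolid A B) := by
  refine MeasurableSet.inter ?_ ?_
  · change MeasurableSet {u : Fin d → ℝ | ∀ i, u i ∈ Set.Icc (0 : ℝ) 1}
    rw [Set.ofPred_forall]
    exact MeasurableSet.iInter fun i => measurable_pi_apply i measurableSet_Icc
  · exact ((Finset.measurable_fun_sum _ fun i _ => measurable_pi_apply i).sub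
      (Finset.measurable_fun_sum _ fun i _ => measurable_pi_apply i)) measurableSet_Icc

lemma volume_real_eulerianSolid {d : ℕ} {A B : Finset (Fin d)} (hdisj : Disjoint A B)
    (hcard : A.card = B.card + 1) :
    volume.real (eulerianSolid A B) =
      (eulerianNumber (A.card + B.card) A.card : ℝ) / (A.card + B.card)! := by
  obtain ⟨p, hp⟩ : ∃ p, A.card + B.card = p + 1 := ⟨B.card + B.card, by omega⟩
  have hunion : (A ∪ B).card = p + 1 := by rw [Finset.card_union_of_disjoint hdisj, hp]
  let e : Fin (p + 1) ↪ Fin d := ((A ∪ B).orderEmbOfFin hunion).toEmbedding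
  have hmp : MeasurePreserving (reflectedCoordinates A e) volume volume :=
    measurePreserving_torus_hom (continuous_reflectedCoordinates A e)
      (surjective_reflectedCoordinates A e)
  rw [← volume_real_torus_preimage (measurableSet_eulerianSolid A B) fun u hu i _ => hu.1 i, hp,
    ← volume_real_sum_circleRep_sub_mem hp,
    ← hmp.measureReal_preimage (measurableSet_sum_circleRep_sub_mem B.card).nullMeasurableSet]
  refine measureReal_congr ?_
  filter_upwards [ae_all_iff.2 fun i => ae_torus_apply_ne_zero (ι := Fin d) i] with u hu
  refine propext ?_
  change (fun i => circleRep (u i)) ∈ eulerianSolid A B ↔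
    ∑ j, circleRep (reflectedCoordinates A e u j) - B.card ∈ Set.Icc (0 : ℝ) 1
  rw [sum_circleRep_reflectedCoordinates hdisj (Finset.map_orderEmbOfFin_univ _ hunion)
    fun i _ => hu i]
  exact and_iff_right fun i => Set.Ico_subset_Icc_self (circleRep_mem_Ico _)

end EulerianVolume

end ToeplitzSpectrum

open ToeplitzSpectrum in
theorem theorem1p1 :
    (∃ γ : ProbabilityMeasure ℝ,
      -- almost sure weak convergence, with a limit that does not depend on the i.i.d. sequence
      (∀ (Ω : Type*) [MeasurableSpace Ω] (P : Measure Ω) [IsProbabilityMeasure P]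
        (X : ℕ → Ω → ℝ), (∀ i, Measurable (X i)) → iIndepFun X P →
        (∀ i, IdentDistrib (X i) (X 1) P P) → variance (X 1) P = 1 →
        ∀ᵐ ω ∂P, Tendsto
          (fun n : ℕ => spectralMeasure (scaledToeplitz (n + 1) fun i => X i ω)
            (scaledToeplitz_isHermitian (n + 1) fun i => X i ω))
          atTop (𝓝 γ)) ∧
      -- the limit is symmetric and has unbounded support
      (γ : Measure ℝ).map (fun t => -t) = (γ : Measure ℝ) ∧
      ¬ Bornology.IsBounded (γ : Measure ℝ).support ∧
      -- its even moments
      ∀ k : ℕ, Integrable (fun t : ℝ => t ^ (2 * k)) (γ : Measure ℝ) ∧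
        ∫ t, t ^ (2 * k) ∂(γ : Measure ℝ) = ∑ w ∈ partitionWords k, toeplitzVolume w) ∧
    -- the cube sections are intersections of solids whose volumes are given by Eulerian numbers
    (∀ (k : ℕ), ∀ w ∈ partitionWords k, ∃ A B : Fin k → Finset (Fin (k + 1)),
      toeplitzSection w = (unitCube (k + 1) ∩ ⋂ a, eulerianSolid (A a) (B a)) ∧
      ∀ a, Disjoint (A a) (B a) ∧ (A a).card = (B a).card + 1 ∧
        volume.real (eulerianSolid (A a) (B a)) =
          (eulerianNumber ((A a).card + (B a).card) (A a).card : ℝ) /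
            ((A a).card + (B a).card)!) := by
  refine ⟨?_, fun k w hw => ?_⟩
  · obtain ⟨γ, hγ⟩ := exists_hasMoments_limitMoments
    refine ⟨γ, ?_, map_neg_eq_of_hasMoments hγ, not_isBounded_support_of_hasMoments hγ, fun k =>
      ⟨(hγ (2 * k)).1, (hγ (2 * k)).2.trans (limitMoments_two_mul k)⟩⟩
    intro Ω _ P _ X hX hind hid hvar
    exact ae_tendsto_toeplitzMeasure hX hind hid hvar hγ
  · obtain ⟨fst, snd, h⟩ := (Finset.mem_filter.1 hw).2.exists_occurrences
    refine ⟨plusSet fst snd, minusSet fst snd, h.toeplitzSection_eq, fun a => ?_⟩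
    exact ⟨disjoint_plusSet_minusSet a, h.card_plusSet a,
      volume_real_eulerianSolid (disjoint_plusSet_minusSet a) (h.card_plusSet a)⟩
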